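/- **Setting.** Let $D=(V,A)$ be a finite acyclic digraph (parallel arcs allowed) and $b\colon V\to\mathbb R$. Vertices with $b(v)>0$ are sources, vertices with $b(v)<0$ are sinks; assume that there is at least one sink, and let $d_t=|b(t)|$ for each sink $t$ and $d_{\max}=\max_t d_t$. A $b$-transshipment is $x\in\mathbb R^A_{\ge 0}$ with $\sum_{a\in\delta^{\rm out}(v)}x_a-\sum_{a\in\delta^{\rm in}(v)}x_a=b(v)$ for all $v\in V$. An unsplittable $b$-transshipment is a $b$-transshipment $y$ together with a decomposition of $y$ into flow-carrying source–sink paths, with at most one path for each source–sink pair. **Algorithm (adapted Modified DGG Algorithm).** Given a $b$-transshipment $x$, add a super-source $s^*$ and an arc $(s^*,s)$ with flow $b(s)$ for each source $s$, and let $y:=x$ on the other arcs. Arcs of flow $0$ are absent (they are removed whenever this happens). Each sink $t$, with demand $d_t$, is initially located at the vertex $t$. *Moving* a (sub-)sink $t$ located at the head of an arc $a$ backward along $a$ means that $y_a$ decreases by the demand of $t$ and $t$ is relocated to the tail of $a$. When a (sub-)sink reaches $s^*$, the path that it has traced, without its arc at $s^*$, is output with its demand as flow value. *Preliminary phase:*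 as long as possible, move a sink $t$ backward along an arc $a$ entering its vertex with $y_a\ge d_t$. Then, while some (sub-)sink has not reached $s^*$, perform the following *iteration*. Label an arc singular if its head and all vertices reachable from its head have out-degree at most one; call a vertex non-funnel if its out-degree is at least two. Starting at an arbitrary vertex $\ne s^*$ with an outgoing arc, follow arbitrary outgoing (forward) arcs until reaching a vertex $w$ without outgoing arcs, along an arc $a'$. By backward depth-first search from $w$ (for a fixed order of the arcs), ignoring $a'$ and not continuing beyond non-funnel vertices, look for a non-funnel vertex $v\neq s^*$. If one is found, follow the backward path from $w$ to $v$ and continue forward from $v$ along another arc, and so on, until a vertex is revisited. 1. If a vertex is revisited, this closes a (nice) alternating cycle $C$ of forward and backward arcs avoiding $s^*$. In contrast to the original algorithm, *increase* $y$ on the forward arcs and *decrease* $y$ on the backward arcs of $C$ by the same amount, the minimum of all $y_a$ over backward arcs $a$ of $C$ and of all $d_t-y_a$ over forward arcs $a$ of $C$ and (sub-)sinks $t$ at the head of $a$ with $d_t>y_a$. 2. If instead some backward search from a vertex $w$ finds no non-funnel vertex other than $s^*$, the explored arcs form the singular digraph rooted at $w$. Choose a (sub-)sink $t$ at $w$ with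 $d_t>y_{a'}$ and split it into $t_1,t_2$ with demands $y_{a'}$ and $d_t-y_{a'}$. Decompose the flow on the singular digraph into paths to all other (sub-)sinks located at its vertices and to $t_2$, and move these (sub-)sinks backward along these paths to $s^*$, split into one sub-sink per path. This is done greedily: take the other (sub-)sinks in arbitrary order, and $t_2$ last; for each of them repeatedly follow arbitrary arcs of the singular digraph backward to $s^*$ and move along this path as much of the remaining demand as the flow on its arcs allows. Remove all arcs of the singular digraph and move $t_1$ backward along $a'$. At the end of the iteration, as long as possible, move (sub-)sinks $t$ backward, preferably along a labeled singular arc $a$ with $y_a=d_t$, and otherwise along a non-singular arc $a$ with $y_a\ge d_t$ (with the labels from the beginning of the iteration). **Theorem.** There is a polynomial $p$ such that for every finite acyclic digraph $D=(V,A)$, every $b$ with at least one sink and every $b$-transshipment $x$, the adapted Modified DGG Algorithm, whatever arbitrary choices it makes (choices of the start vertices, the forward arcs, the sinks and arcs for the moves, the sink $t$ to be split, and the sinks and arcs in the greedy decompositions), never gets stuck, halts after at most $p(|V|+|A|)$ elementary steps (array and list accesses, comparisons, additions and subtractions of real numbers), and outputs an unsplittable $b$-transshipment $y$, with its path decomposition,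 such that $$y_a > x_a-d_{\max}\qquad\text{for all }a\in A.$$ -/

import Mathlib

/-! # Transshipments and the adapted Modified DGG Algorithm -/

namespace Transship

/-! ## Digraphs, paths, transshipments -/

/-- A finite directed multigraph with vertex set `Fin n` and arc set `Fin m`
(parallel arcs are allowed). -/
structure Network (n m : ℕ) where
  src : Fin m → Fin n
  dst : Fin m → Fin n

variable {n m : ℕ}

/-- `G.IsWalk u v p`: the arcs in the list `p`, in this order, form a directed walk from `u`
to `v`. -/
def Network.IsWalk (G : Network n m) : Fin n → Fin n → List (Fin m) → Prop
  | u, v, [] => u = v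
  | u, v, a :: p => G.src a = u ∧ G.IsWalk (G.dst a) v p

/-- A directed path: a directed walk that visits no vertex twice. -/
def Network.IsPath (G : Network n m) (u v : Fin n) (p : List (Fin m)) : Prop :=
  G.IsWalk u v p ∧ (u :: p.map G.dst).Nodup

/-- There is no directed cycle (in particular no loop). -/
def Network.Acyclic (G : Network n m) : Prop :=
  ∀ (v : Fin n) (p : List (Fin m)), G.IsWalk v v p → p = []

/-- `x` is a `b`-transshipment: nonnegative, and outflow minus inflow is `b v` at each `v`. -/
def IsTransshipment (G : Network n m) (b : Fin n → ℝ) (x : Fin m → ℝ) : Prop :=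
  (∀ a, 0 ≤ x a) ∧
  ∀ v, (∑ a with G.src a = v, x a) - (∑ a with G.dst a = v, x a) = b v

/-- A path of a path decomposition: end vertices, list of arcs, flow value. -/
structure RoutedPath (n m : ℕ) where
  source : Fin n
  sink : Fin n
  arcs : List (Fin m)
  value : ℝ

/-- `y` together with the path decomposition `L` is an unsplittable `b`-transshipment: `y` is a
`b`-transshipment, `L` consists of paths of positive flow value from sources to sinks, at most one
for each source-sink pair, and the flow on each arc is the sum of the values of the paths of `L`
through this arc. -/
structure IsUnsplittable (G : Network n m) (b : Fin n → ℝ) (y : Fin m → ℝ)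
    (L : List (RoutedPath n m)) : Prop where
  transshipment : IsTransshipment G b y
  source_pos : ∀ P ∈ L, 0 < b P.source
  sink_neg : ∀ P ∈ L, b P.sink < 0
  isPath : ∀ P ∈ L, G.IsPath P.source P.sink P.arcs
  value_pos : ∀ P ∈ L, 0 < P.value
  one_path : (L.map fun P => (P.source, P.sink)).Nodup
  decomposition : ∀ a, y a = (L.map fun P => if a ∈ P.arcs then P.value else 0).sum

/-- The maximum demand `d_max`, the maximum of `|b t|` over all sinks `t`. -/
noncomputable def maxDemand (b : Fin n → ℝ) : ℝ :=
  ⨆ t : {t : Fin n // b t < 0}, |b t|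

/-! ## Computations with a step budget

The model is a unit-cost machine with arrays and lists (stacks) over vertices, arcs and real
numbers. An elementary line reads or writes a bounded number of array entries, pushes or pops a
bounded number of list elements, allocates an array with constant entries, and makes a bounded
number of comparisons, additions and subtractions (the only arithmetic operations that are used). Each elementary line and each round of each loop consumes one unit of `fuel`, and a
computation that runs out of fuel fails. So a computation that succeeds with fuel `T` halts within
`T` steps. -/

/-- Arcs of the extended network `D*` with the super-source `s*`: the arcs of the digraph, and
for each vertex `v` a dummy arc `(s*, v)`. An arc is present in the current network if and only if
its current flow is positive; dummy arcs to non-sources never carry flow. -/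
abbrev ExtArc (n m : ℕ) := Fin m ⊕ Fin n

/-- Head of an arc of `D*`. -/
def Network.head (G : Network n m) : ExtArc n m → Fin n
  | .inl e => G.dst e
  | .inr s => s

/-- The memory. At each time each original sink `t` has at most one (sub-)sink that has not reached
`s*` yet. -/
structure Memory (n m : ℕ) where
  /-- remaining steps -/
  fuel : ℕ
  /-- current flow on `D*` -/
  flow : ExtArc n m → ℝ
  /-- current position of the (sub-)sink of `t`; `none` if there is none -/
  loc : Fin n → Option (Fin n)
  /-- current demand of the (sub-)sink of `t`; zero if there is none -/
  dem : Fin n → ℝ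
  /-- arcs along which the (sub-)sink of `t` has been moved: a path from `loc t` to `t` -/
  trail : Fin n → List (Fin m)
  /-- finished paths -/
  paths : List (RoutedPath n m)
  /-- total flow of the finished paths on each arc -/
  total : Fin m → ℝ

/-- Computations: they transform the memory and return a result, or fail. -/
abbrev Alg (n m : ℕ) := StateT (Memory n m) Option

/-- Consume one unit of fuel. -/
def tick : Alg n m Unit := do
  let s ← get
  match s.fuel with
  | 0 => failure
  | k + 1 => set { s with fuel := k }

/-- An elementary line that reads. -/
def rd {α : Type} (f : Memory n m → α) : Alg n m α := do
  tick
  let s ← get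
  return f s

/-- An elementary line that writes. -/
def wr (f : Memory n m → Memory n m) : Alg n m Unit := do
  tick
  modify f

def wrFlow (a : ExtArc n m) (r : ℝ) : Alg n m Unit :=
  wr fun s => { s with flow := Function.update s.flow a r }

def wrLoc (t : Fin n) (v : Option (Fin n)) : Alg n m Unit :=
  wr fun s => { s with loc := Function.update s.loc t v }

def wrDem (t : Fin n) (r : ℝ) : Alg n m Unit :=
  wr fun s => { s with dem := Function.update s.dem t r }

def loopRounds {σ β : Type} (body : σ → Alg n m (σ ⊕ β)) : ℕ → σ → Alg n m β
  | 0, _ => failure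
  | k + 1, c => do
    tick
    match ← body c with
    | .inl c' => loopRounds body k c'
    | .inr r => return r

/-- Unbounded loop: repeat `body` on the loop variable until it returns a result `.inr r`. As each
round consumes fuel, there are at most as many rounds as there is fuel. -/
def loop {σ β : Type} (body : σ → Alg n m (σ ⊕ β)) (c : σ) : Alg n m β := do
  let s ← get
  loopRounds body s.fuel c

/-- Loop over the elements of a list. -/
def forEach {α σ : Type} (body : σ → α → Alg n m σ) : List α → σ → Alg n m σ
  | [], c => return c
  | a :: l, c => do
    tick
    let c' ← body c a
    forEach body l c'

/-- The elements of a list that pass a test. -/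
def collect {α : Type} (test : Memory n m → α → Bool) : List α → Alg n m (List α)
  | [] => return []
  | a :: l => do
    let r ← rd fun s => test s a
    let l' ← collect test l
    return if r then a :: l' else l'

/-- Arbitrary choice of an element of a nonempty list: walk through the list and stop at an
arbitrary element. Arbitrary decisions are read off from `χ`, at the current amount of fuel; as
this amount decreases with each decision, each sequence of decisions arises from some `χ`. -/
def pick {α : Type} (χ : ℕ → Bool) : List α → Alg n m α
  | [] => failure
  | [a] => do
    tick
    return a
  | a :: a' :: l => do
    let r ← rd fun s => χ s.fuel
    if r then return a else pick χ (a' :: l)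

def verts : List (Fin n) := List.finRange n

def arcs : List (Fin m) := List.finRange m

def extArcs : List (ExtArc n m) := arcs.map Sum.inl ++ verts.map Sum.inr

def sinkArcPairs : List (Fin n × ExtArc n m) := verts.product extArcs

/-! ## The algorithm -/

/-- Set up `D*`, the initial flow, and the sinks with their demands. -/
noncomputable def setup (b : Fin n → ℝ) (x : Fin m → ℝ) : Alg n m Unit := do
  forEach (fun _ e => wrFlow (.inl e) (x e)) arcs ()
  forEach (fun _ v => do
    if 0 < b v then
      wrFlow (.inr v) (b v)
    else if b v < 0 then
      wrLoc v (some v)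
      wrDem v (-b v)) verts ()

/-- Output a path from `s` to `t` with flow value `d`. -/
noncomputable def emit (s t : Fin n) (p : List (Fin m)) (d : ℝ) : Alg n m Unit := do
  forEach (fun _ e => wr fun c =>
    { c with total := Function.update c.total e (c.total e + d) }) p ()
  wr fun c => { c with paths := ⟨s, t, p, d⟩ :: c.paths }

/-- The (sub-)sink of `t` disappears (all of its demand has reached `s*`). -/
noncomputable def finish (t : Fin n) : Alg n m Unit := do
  wrLoc t none
  wrDem t 0

/-- Move the (sub-)sink of `t` backward along the arc `a` and decrease the flow on `a` by its
demand. -/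
noncomputable def moveSink (G : Network n m) (t : Fin n) (a : ExtArc n m) : Alg n m Unit := do
  let d ← rd fun s => s.dem t
  let f ← rd fun s => s.flow a
  wrFlow a (f - d)
  match a with
  | .inl e =>
    wrLoc t (some (G.src e))
    wr fun c => { c with trail := Function.update c.trail t (e :: c.trail t) }
  | .inr s =>
    let p ← rd fun c => c.trail t
    emit s t p d
    finish t

/-- Preliminary phase: as long as possible, move a sink backward along an arc whose flow is at
least its demand. -/
noncomputable def preliminary (G : Network n m) (χ : ℕ → Bool) : Alg n m Unit :=
  loop (fun _ => do
    let l ← collect (fun s q => decide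
      (0 < s.dem q.1 ∧ s.loc q.1 = some (G.head q.2) ∧ s.dem q.1 ≤ s.flow q.2)) sinkArcPairs
    match l with
    | [] => return .inr ()
    | _ :: _ => do
      let q ← pick χ l
      moveSink G q.1 q.2
      return .inl ()) ()

/-- Labels of an iteration: the out-degrees of the vertices other than `s*`, and the vertices from
which a vertex of out-degree at least two is reachable. A present arc of `D*` is *singular* if
its head and all vertices reachable from its head have out-degree at most one. -/
structure Labels (n : ℕ) where
  deg : Fin n → ℕ
  branching : Fin n → Bool

def Labels.singular (lab : Labels n) (G : Network n m) (a : ExtArc n m) : Bool :=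
  !lab.branching (G.head a)

noncomputable def computeLabels (G : Network n m) : Alg n m (Labels n) := do
  let deg ← forEach (fun deg e => do
    let f ← rd fun s => s.flow (.inl e)
    return if 0 < f then Function.update deg (G.src e) (deg (G.src e) + 1) else deg)
    arcs (fun _ => 0)
  let br ← forEach (fun br v => return Function.update br v (decide (2 ≤ deg v)))
    verts (fun _ => false)
  let br ← forEach (fun br (_ : Fin n) =>
    forEach (fun br e => do
      let f ← rd fun s => s.flow (.inl e)
      return if 0 < f ∧ br (G.dst e) then Function.update br (G.src e) true else br) arcs br)
    verts br
  return ⟨deg, br⟩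

/-- A step of an alternating walk: it leaves the vertex `start` along the arc `arc`, in the
direction of the arc (forward) or against it (backward). -/
structure WalkStep (n m : ℕ) where
  start : Fin n
  arc : Fin m
  forward : Bool

/-- The walk (most recent step first) has just reached `u`. If it left `u` before, return the
closed part of the walk. -/
def closeCycle (u : Fin n) : List (WalkStep n m) → Alg n m (Option (List (WalkStep n m)))
  | [] => return none
  | w :: l => do
    tick
    if w.start = u then return some [w]
    else
      let c ← closeCycle u l
      return c.map (w :: ·)

/-- Result of a backward depth-first search: a backward path to a non-funnel vertex other than
`s*` (as list of arcs in the direction of the arcs), or the singular digraph: its vertices other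
than `s*`, and its arcs. -/
inductive Backward (n m : ℕ) where
  | path (p : List (Fin m))
  | digraph (mark : Fin n → Bool) (E : List (ExtArc n m))

/-- Loop variable of the backward search: a stack of backward paths to be continued, the
marked vertices, and the explored arcs. -/
structure SearchState (n m : ℕ) where
  stack : List (List (Fin m))
  mark : Fin n → Bool
  explored : List (ExtArc n m)

/-- Explore all arcs entering `v`, except for `a'`; `p` is the path from `v` to the junction. -/
noncomputable def expand (G : Network n m) (a' : Fin m) (v : Fin n) (p : List (Fin m))
    (c : SearchState n m) : Alg n m (SearchState n m) := do
  let l ← collect (fun s a => decide (G.head a = v ∧ 0 < s.flow a ∧ a ≠ .inl a')) extArcs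
  forEach (fun c a => return match a with
    | .inl e => { c with stack := (e :: p) :: c.stack, explored := a :: c.explored }
    | .inr _ => { c with explored := a :: c.explored })
    l { c with mark := Function.update c.mark v true }

/-- Backward depth-first search from the junction vertex `w`, ignoring the arc `a'`. -/
noncomputable def backwardSearch (G : Network n m) (lab : Labels n) (w : Fin n) (a' : Fin m) :
    Alg n m (Backward n m) := do
  let c ← expand G a' w [] ⟨[], fun _ => false, []⟩
  loop (fun c => do
    match c.stack with
    | [] => return .inr (.digraph c.mark c.explored)
    | [] :: _ => failure
    | (e :: p) :: st =>
      if 2 ≤ lab.deg (G.src e) then return .inr (.path (e :: p))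
      else do
        let c' ← expand G a' (G.src e) (e :: p) { c with stack := st }
        return .inl c') c

/-- Result of the search for a nice alternating cycle: such a cycle, or a junction vertex `w`,
the arc `a'` along which it was reached, and the singular digraph rooted at `w`. -/
inductive Found (n m : ℕ) where
  | cycle (C : List (WalkStep n m))
  | digraph (w : Fin n) (a' : Fin m) (mark : Fin n → Bool) (E : List (ExtArc n m))

/-- Loop variable of the search: the walk (most recent step first) and its last vertex. -/
structure WalkState (n m : ℕ) where
  walk : List (WalkStep n m)
  cur : Fin n

/-- Append one step to the walk and check whether this closes a cycle. -/
def extend (G : Network n m) (c : WalkState n m) (e : Fin m) (fwd : Bool) :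
    Alg n m (WalkState n m ⊕ Found n m) := do
  let u := if fwd then G.dst e else G.src e
  let walk := ⟨c.cur, e, fwd⟩ :: c.walk
  match ← closeCycle u walk with
  | some C => return .inr (.cycle C)
  | none => return .inl ⟨walk, u⟩

/-- Search for a nice alternating cycle, starting at `v`: follow arbitrary outgoing arcs to a
junction vertex; from there, take a backward path to a non-funnel vertex other than `s*`, and
continue forward along another arc. Stop if a vertex is revisited or if there is no such backward
path. -/
noncomputable def findCycle (G : Network n m) (χ : ℕ → Bool) (lab : Labels n) (v : Fin n) :
    Alg n m (Found n m) :=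
  loop (fun c => do
    let last := c.walk.head?.map WalkStep.arc
    let l ← collect (fun s e => decide
      (G.src e = c.cur ∧ 0 < s.flow (.inl e) ∧ last ≠ some e)) arcs
    match l, last with
    | [], none => failure
    | [], some a' => do
      match ← backwardSearch G lab c.cur a' with
      | .digraph mark E => return .inr (.digraph c.cur a' mark E)
      | .path p => do
        let p' ← forEach (fun q e => return e :: q) p []
        forEach (fun r e =>
          match r with
          | .inl c => extend G c e false
          | .inr C => return .inr C) p' (.inl c)
    | _ :: _, _ => do
      let e ← pick χ l
      extend G c e true) (⟨[], v⟩ : WalkState n m)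

/-- The minimum of a candidate for a minimum (if there is one) and `r`. -/
noncomputable def minWith (o : Option ℝ) (r : ℝ) : Option ℝ :=
  match o with
  | none => some r
  | some q => some (min q r)

/-- Augmentation along a nice alternating cycle, in the direction opposite to the original one:
increase the flow on forward arcs and decrease it on backward arcs by the same amount, the minimum
of the flow values on backward arcs and of the values `d_t - y_a` over all forward arcs `a` and all
(sub-)sinks `t` at the head of `a` with `d_t > y_a`. -/
noncomputable def augment (G : Network n m) (C : List (WalkStep n m)) : Alg n m Unit := do
  let o ← forEach (fun o w => do
    let f ← rd fun s => s.flow (.inl w.arc)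
    if w.forward then
      forEach (fun o t => do
        let d ← rd fun s => s.dem t
        let v ← rd fun s => s.loc t
        return if v = some (G.dst w.arc) ∧ f < d then minWith o (d - f) else o) verts o
    else return minWith o f) C none
  match o with
  | none => failure
  | some ε =>
    forEach (fun _ w => do
      let f ← rd fun s => s.flow (.inl w.arc)
      wrFlow (.inl w.arc) (if w.forward then f + ε else f - ε)) C ()

/-- Follow present arcs other than `a'` backward from `v` to `s*`. Return the source that is
passed immediately before `s*`, the path from this source to `v`, and the concatenation of this
path with the given path `p`. -/
noncomputable def traceBack (G : Network n m) (χ : ℕ → Bool) (a' : Fin m) (v : Fin n)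
    (p : List (Fin m)) : Alg n m (Fin n × List (Fin m) × List (Fin m)) :=
  loop (fun (c : Fin n × List (Fin m) × List (Fin m)) => do
    let l ← collect (fun s a =>
      decide (G.head a = c.1 ∧ 0 < s.flow a ∧ a ≠ .inl a')) extArcs
    let a ← pick χ l
    match a with
    | .inl e => return .inl (G.src e, e :: c.2.1, e :: c.2.2)
    | .inr _ => return .inr c) (v, [], p)

/-- Move `r` units of the demand of the (sub-)sink of `t` backward to `s*`, along paths in the
singular digraph, one sub-sink for each path. -/
noncomputable def routeDemand (G : Network n m) (χ : ℕ → Bool) (a' : Fin m) (t : Fin n) (r : ℝ) :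
    Alg n m Unit :=
  loop (fun r => do
    if 0 < r then
      match ← rd (fun s => s.loc t) with
      | none => failure
      | some v => do
        let p ← rd fun s => s.trail t
        let c ← traceBack G χ a' v p
        let f ← rd fun s => s.flow (.inr c.1)
        let δ ← forEach (fun δ e => do
          let f ← rd fun s => s.flow (.inl e)
          return min δ f) c.2.1 (min r f)
        wrFlow (.inr c.1) (f - δ)
        forEach (fun _ e => do
          let f ← rd fun s => s.flow (.inl e)
          wrFlow (.inl e) (f - δ)) c.2.1 ()
        emit c.1 t c.2.2 δ
        return .inl (r - δ)
    else return .inr ()) r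

/-- Treatment of the singular digraph rooted at the junction vertex `w` that was reached along
`a'`. Choose a (sub-)sink `t` at `w` with demand larger than the flow on `a'`. Move the demand of
all other (sub-)sinks in the singular digraph, and then the part `d_t - y_{a'}` of the demand of
`t`, backward to `s*` inside the singular digraph. Remove the arcs of the singular
digraph and move the rest `y_{a'}` of the demand of `t` backward along `a'`. -/
noncomputable def processDigraph (G : Network n m) (χ : ℕ → Bool) (w : Fin n) (a' : Fin m)
    (mark : Fin n → Bool) (E : List (ExtArc n m)) : Alg n m Unit := do
  let f ← rd fun s => s.flow (.inl a')
  let l ← collect (fun s t => decide (s.loc t = some w ∧ f < s.dem t)) verts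
  let t ← pick χ l
  loop (fun _ => do
    let others ← collect (fun s r => decide
      (r ≠ t ∧ 0 < s.dem r) && (s.loc r).any mark) verts
    match others with
    | [] => return .inr ()
    | _ :: _ => do
      let r ← pick χ others
      let d ← rd fun s => s.dem r
      routeDemand G χ a' r d
      finish r
      return .inl ()) ()
  let d ← rd fun s => s.dem t
  routeDemand G χ a' t (d - f)
  wrDem t f
  forEach (fun _ a => wrFlow a 0) E ()
  moveSink G t (.inl a')

/-- Moving rules at the end of an iteration: as long as possible, move a (sub-)sink backward,
preferably along a singular arc carrying exactly its demand, and otherwise along a non-singular arc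
carrying at least its demand. The labels are those of the beginning of the iteration. -/
noncomputable def moveSinks (G : Network n m) (χ : ℕ → Bool) (lab : Labels n) : Alg n m Unit :=
  loop (fun _ => do
    let l ← collect (fun s q => decide
      (0 < s.dem q.1 ∧ s.loc q.1 = some (G.head q.2) ∧
        if lab.singular G q.2 then s.flow q.2 = s.dem q.1 else s.dem q.1 ≤ s.flow q.2))
      sinkArcPairs
    match l with
    | [] => return .inr ()
    | _ :: _ => do
      let q ← pick χ l
      let l' ← collect (fun s a => decide
        (s.loc q.1 = some (G.head a) ∧ lab.singular G a ∧ s.flow a = s.dem q.1)) extArcs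
      let a ← match l' with
        | [] => pure q.2
        | _ :: _ => pick χ l'
      moveSink G q.1 a
      return .inl ()) ()

/-- One iteration. The search starts at an arbitrary vertex other than `s*` with an outgoing
arc. -/
noncomputable def iteration (G : Network n m) (χ : ℕ → Bool) : Alg n m Unit := do
  let lab ← computeLabels G
  let l ← collect (fun _ v => decide (0 < lab.deg v)) verts
  let v ← pick χ l
  match ← findCycle G χ lab v with
  | .cycle C => augment G C
  | .digraph w a' mark E => processDigraph G χ w a' mark E
  moveSinks G χ lab

/-- The adapted Modified DGG Algorithm. -/
noncomputable def adaptedDGG (G : Network n m) (b : Fin n → ℝ) (x : Fin m → ℝ) (χ : ℕ → Bool) :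
    Alg n m ((Fin m → ℝ) × List (RoutedPath n m)) := do
  setup b x
  preliminary G χ
  loop (fun _ => do
    let l ← collect (fun s t => decide (0 < s.dem t)) verts
    match l with
    | [] => return .inr ()
    | _ :: _ => do
      iteration G χ
      return .inl ()) ()
  let y ← rd fun s => s.total
  let L ← rd fun s => s.paths
  return (y, L)

/-- Run the algorithm for at most `T` steps, with arbitrary decisions given by `χ`. The result is
`none` if the algorithm has not halted after `T` steps, or if it gets stuck. -/
noncomputable def runAdaptedDGG (G : Network n m) (b : Fin n → ℝ) (x : Fin m → ℝ) (χ : ℕ → Bool)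
    (T : ℕ) : Option ((Fin m → ℝ) × List (RoutedPath n m)) :=
  ((adaptedDGG G b x χ).run
    { fuel := T, flow := fun _ => 0, loc := fun _ => none, dem := fun _ => 0,
      trail := fun _ => [], paths := [], total := fun _ => 0 }).map Prod.fst

end Transship

/-! Lower bound. For an arc `e`, consider the demand already moved over `e` (`St.routed`) plus the
flow still on `e`. Moving and routing sinks preserve this sum (`Movable.routed`, `RouteInv.routed`).
Augmentation raises it on forward arcs and lowers it only on backward arcs, which are singular. At
the start of an iteration a present singular arc carries less than `d_max` (`StartInv.flow_lt`).
Hence, as soon as `e` is singular, `x e ≤ routed + flow` gives `x e - d_max < routed`, and this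
survives everything later because `routed` never decreases. In the end all flow is zero and `routed`
is the output.

Why singular arcs carry little. A sink is irregular if its demand is smaller than the flow on some
arc entering its vertex. At the start of every iteration, a vertex with an irregular sink has no
outgoing flow and no second irregular sink. By conservation, every present arc whose head has a sink
or has no outgoing flow is then met by a sink with larger demand (`StartInv.exists_lt`). Follow a
singular arc forward: until such a vertex is reached, all flow continues along the unique outgoing
arc, so the flow does not decrease and is finally below some demand. The same lemma provides the
sink to be split. Within an iteration the two conditions are kept only at heads of singular arcs
(`MidInv`); elsewhere the moving rules remove irregular sinks before the iteration ends.

One path per pair. Absent arcs never return. When a path to a sink is output and the sink is not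
finished, either the dummy arc of the source is exhausted, or every walk from the source to the
current position of the sink contains an absent arc (`NoReturn`). In the singular digraph this holds
because walks to a fixed vertex are unique there, so a saturated arc of the path blocks all of them.

Termination. The number of present arcs plus the number of moves still possible for the active sinks
(`St.potential`) is polynomial and drops in every iteration: an arc vanishes, or an augmentation
makes a flow equal to a demand and thereby enables a move.

The program is treated by a total-correctness calculus with costs (`Runs`). Choices are demonic: a
postcondition must hold for every element that may be picked. Composing the bounds yields
`Runs.adaptedDGG`, whose cost is a polynomial in the number of vertices and arcs. -/

namespace Transship

variable {n m : ℕ}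

/-! ## Weakest preconditions with a cost bound -/

/-- The memory without the fuel. -/
structure St (n m : ℕ) where
  flow : ExtArc n m → ℝ
  loc : Fin n → Option (Fin n)
  dem : Fin n → ℝ
  trail : Fin n → List (Fin m)
  paths : List (RoutedPath n m)
  total : Fin m → ℝ

/-- The memory with `k` units of fuel. -/
def St.mem (s : St n m) (k : ℕ) : Memory n m :=
  ⟨k, s.flow, s.loc, s.dem, s.trail, s.paths, s.total⟩

/-- With at least `c` units of fuel, the computation `f` started in `s` succeeds, consumes at most
`c` units of fuel, and the result and the final state satisfy `Q`. -/
def Runs {α : Type} (f : Alg n m α) (c : ℕ) (s : St n m) (Q : α → St n m → Prop) : Prop :=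
  ∀ k, c ≤ k → ∃ r s' k', f (s.mem k) = some (r, s'.mem k') ∧ k ≤ k' + c ∧ Q r s'

namespace Runs

variable {α β σ : Type} {s : St n m} {c c₁ c₂ : ℕ}

theorem mono {f : Alg n m α} {Q Q' : α → St n m → Prop} (h : Runs f c₁ s Q') (hc : c₁ ≤ c)
    (hQ : ∀ r s', Q' r s' → Q r s') : Runs f c s Q := by
  intro k hk
  obtain ⟨r, s', k', h1, h2, h3⟩ := h k (hc.trans hk)
  exact ⟨r, s', k', h1, by omega, hQ _ _ h3⟩

theorem le {f : Alg n m α} {Q : α → St n m → Prop} (h : Runs f c₁ s Q) (hc : c₁ ≤ c) :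
    Runs f c s Q := h.mono hc fun _ _ h => h

theorem pure {r : α} {Q : α → St n m → Prop} (h : Q r s) : Runs (Pure.pure r) c s Q :=
  fun k _ => ⟨r, s, k, rfl, by omega, h⟩

theorem bind {f : Alg n m α} {g : α → Alg n m β} {Q' : α → St n m → Prop}
    {Q : β → St n m → Prop} (hf : Runs f c₁ s Q')
    (hg : ∀ r s', Q' r s' → Runs (g r) c₂ s' Q) (hc : c₁ + c₂ ≤ c) : Runs (f >>= g) c s Q := by
  intro k hk
  obtain ⟨r, s', k', h1, h2, h3⟩ := hf k (by omega)
  obtain ⟨r', s'', k'', h4, h5, h6⟩ := hg r s' h3 k' (by omega)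
  refine ⟨r', s'', k'', ?_, by omega, h6⟩
  change (f (s.mem k) >>= fun p => g p.1 p.2) = _
  rw [h1]
  exact h4

theorem tick {Q : Unit → St n m → Prop} (h : Q () s) : Runs tick (c + 1) s Q := by
  intro k hk
  obtain ⟨k, rfl⟩ : ∃ j, k = j + 1 := ⟨k - 1, by omega⟩
  exact ⟨(), s, k, rfl, by omega, h⟩

theorem tick_bind {g : Unit → Alg n m β} {Q : β → St n m → Prop} (h : Runs (g ()) c s Q) :
    Runs (Transship.tick >>= g) (c + 1) s Q :=
  bind (c₁ := 1) (c₂ := c) (Q' := fun _ s' => s' = s) (tick (c := 0) rfl)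
    (by rintro _ _ rfl; exact h) (by omega)

/-- The value read may depend on the fuel, since arbitrary decisions are looked up there; hence the
quantifier over `k`. -/
theorem rd {f : Memory n m → α} {Q : α → St n m → Prop} (h : ∀ k, Q (f (s.mem k)) s) :
    Runs (rd f) (c + 1) s Q := by
  refine tick_bind ?_
  intro k _
  exact ⟨_, s, k, rfl, by omega, h k⟩

theorem rd_bind {f : Memory n m → α} {g : α → Alg n m β} {Q : β → St n m → Prop}
    (h : ∀ k, Runs (g (f (s.mem k))) c s Q) : Runs (Transship.rd f >>= g) (c + 1) s Q :=
  bind (c₁ := 1) (c₂ := c) (Q' := fun r s' => s' = s ∧ ∃ k, r = f (s.mem k))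
    (rd (c := 0) fun k => ⟨rfl, k, rfl⟩)
    (by rintro _ _ ⟨rfl, k, rfl⟩; exact h k) (by omega)

theorem rd_bind_eq {f : Memory n m → α} (r : α) (hr : ∀ k, f (s.mem k) = r) {g : α → Alg n m β}
    {Q : β → St n m → Prop} (h : Runs (g r) c s Q) : Runs (Transship.rd f >>= g) (c + 1) s Q :=
  rd_bind fun k => by rw [hr]; exact h

theorem wr {f : Memory n m → Memory n m} {s' : St n m} (hf : ∀ k, f (s.mem k) = s'.mem k)
    {Q : Unit → St n m → Prop} (h : Q () s') : Runs (wr f) (c + 1) s Q := by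
  refine tick_bind ?_
  intro k _
  refine ⟨(), s', k, ?_, by omega, h⟩
  rw [← hf]
  rfl

theorem wr_bind {f : Memory n m → Memory n m} {s' : St n m} (hf : ∀ k, f (s.mem k) = s'.mem k)
    {g : Unit → Alg n m β} {Q : β → St n m → Prop} (h : Runs (g ()) c s' Q) :
    Runs (Transship.wr f >>= g) (c + 1) s Q :=
  bind (c₁ := 1) (c₂ := c) (Q' := fun _ s₁ => s₁ = s') (wr (c := 0) hf rfl)
    (by rintro _ _ rfl; exact h) (by omega)

/-- The invariant is indexed by the part of the list still to be processed. One extra unit per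
element pays for the tick of the loop. -/
theorem forEach {body : σ → α → Alg n m σ} {k : ℕ} (I : List α → σ → St n m → Prop)
    (hb : ∀ a l x s, I (a :: l) x s → Runs (body x a) k s (I l)) :
    ∀ (l : List α) (x : σ) (s : St n m), I l x s →
      Runs (forEach body l x) (l.length * (k + 1)) s (I [])
  | [], x, s, h => pure h
  | a :: l, x, s, h => by
    refine (tick_bind (bind (hb a l x s h) (fun r s' h' => forEach I hb l r s' h')
      (Nat.le_refl _))).le ?_
    simp only [List.length_cons]
    ring_nf
    omega

theorem loopRounds {body : σ → Alg n m (σ ⊕ β)} {k : ℕ} (I : σ → St n m → Prop)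
    (μ : σ → St n m → ℕ) {Q : β → St n m → Prop}
    (hb : ∀ x s, I x s → Runs (body x) k s fun r s' =>
      match r with
      | .inl x' => I x' s' ∧ μ x' s' < μ x s
      | .inr y => Q y s') :
    ∀ (M : ℕ) (j : ℕ) (x : σ) (s : St n m), I x s → μ x s ≤ M → M + 1 ≤ j →
      Runs (loopRounds body j x) ((M + 1) * (k + 1)) s Q := by
  intro M
  induction M with
  | zero =>
    intro j x s hI hμ hj
    obtain ⟨j, rfl⟩ : ∃ i, j = i + 1 := ⟨j - 1, by omega⟩
    refine (tick_bind (c := k) (bind (c₂ := 0) (hb x s hI) ?_ le_rfl)).le (by omega)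
    rintro (x' | y) s' h
    · exact absurd h.2 (by omega)
    · exact pure h
  | succ M ih =>
    intro j x s hI hμ hj
    obtain ⟨j, rfl⟩ : ∃ i, j = i + 1 := ⟨j - 1, by omega⟩
    refine (tick_bind (c := k + (M + 1) * (k + 1))
      (bind (c₂ := (M + 1) * (k + 1)) (hb x s hI) ?_ le_rfl)).le (by ring_nf; omega)
    rintro (x' | y) s' h
    · exact ih j x' s' h.1 (by omega) (by omega)
    · exact pure h

theorem loop {body : σ → Alg n m (σ ⊕ β)} {k : ℕ} (I : σ → St n m → Prop)
    (μ : σ → St n m → ℕ) (M : ℕ) {Q : β → St n m → Prop}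
    (hb : ∀ x s, I x s → Runs (body x) k s fun r s' =>
      match r with
      | .inl x' => I x' s' ∧ μ x' s' < μ x s
      | .inr y => Q y s')
    {x : σ} (hI : I x s) (hM : μ x s ≤ M) :
    Runs (loop body x) ((M + 1) * (k + 1)) s Q := by
  intro j hj
  -- The loop may use as many rounds as there is fuel, and the claimed cost is at least the number
  -- `M + 1` of rounds.
  have : M + 1 ≤ j := le_trans (Nat.le_mul_of_pos_right _ (by omega)) hj
  obtain ⟨r, s', k', h1, h2, h3⟩ := loopRounds I μ hb M j x s hI hM this j hj
  exact ⟨r, s', k', h1, h2, h3⟩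

theorem collect {test : Memory n m → α → Bool} {T : α → Bool}
    (hT : ∀ k a, test (s.mem k) a = T a) {Q : List α → St n m → Prop} :
    ∀ (l : List α), Q (l.filter T) s → Runs (collect test l) l.length s Q := by
  suffices H : ∀ l : List α, Runs (Transship.collect test l) l.length s
      fun r s' => r = l.filter T ∧ s' = s from
    fun l h => (H l).mono le_rfl (by rintro _ _ ⟨rfl, rfl⟩; exact h)
  intro l
  induction l with
  | nil => exact pure ⟨rfl, rfl⟩
  | cons a l ih =>
    refine rd_bind fun k => ?_
    refine bind (c₂ := 0) ih ?_ le_rfl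
    rintro _ _ ⟨rfl, rfl⟩
    refine pure ⟨?_, rfl⟩
    rw [hT, List.filter_cons]

theorem collect_bind {test : Memory n m → α → Bool} (T : α → Bool)
    (hT : ∀ k a, test (s.mem k) a = T a) {l : List α} {g : List α → Alg n m β}
    {Q : β → St n m → Prop} (h : Runs (g (l.filter T)) c s Q) :
    Runs (Transship.collect test l >>= g) (l.length + c) s Q :=
  bind (collect (Q := fun r s' => r = l.filter T ∧ s' = s) hT l ⟨rfl, rfl⟩)
    (by rintro _ _ ⟨rfl, rfl⟩; exact h) le_rfl

/-- From here on `χ` is irrelevant: membership in the list is all that is retained about a choice,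
so the correctness proof covers every sequence of decisions. -/
theorem pick (χ : ℕ → Bool) : ∀ (l : List α), l ≠ [] →
    Runs (pick χ l) l.length s fun a s' => a ∈ l ∧ s' = s
  | [], h => absurd rfl h
  | [a], _ => tick_bind (c := 0) (pure ⟨by simp, rfl⟩)
  | a :: a' :: l, _ => by
    refine rd_bind (c := (a' :: l).length) fun k => ?_
    split_ifs
    · exact pure ⟨by simp, rfl⟩
    · refine (pick χ (a' :: l) (by simp)).mono le_rfl ?_
      rintro r s' ⟨h, rfl⟩
      exact ⟨List.mem_cons_of_mem _ h, rfl⟩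

theorem pick_bind {χ : ℕ → Bool} {l : List α} (hl : l ≠ []) {g : α → Alg n m β}
    {Q : β → St n m → Prop} (h : ∀ a ∈ l, Runs (g a) c s Q) :
    Runs (Transship.pick χ l >>= g) (l.length + c) s Q :=
  bind (pick χ l hl) (by rintro a _ ⟨ha, rfl⟩; exact h a ha) le_rfl

end Runs

end Transship

namespace Transship

variable {n m : ℕ} {G : Network n m}

/-! ## Walks in acyclic digraphs -/

namespace Network

theorem IsWalk.append : ∀ {p : List (Fin m)} {u v w : Fin n} {q : List (Fin m)},
    G.IsWalk u v p → G.IsWalk v w q → G.IsWalk u w (p ++ q)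
  | [], _, _, _, _, h, h' => by cases h; exact h'
  | _ :: _, _, _, _, _, h, h' => ⟨h.1, IsWalk.append h.2 h'⟩

theorem IsWalk.split : ∀ {p : List (Fin m)} {u w : Fin n} {q : List (Fin m)},
    G.IsWalk u w (p ++ q) → ∃ v, G.IsWalk u v p ∧ G.IsWalk v w q
  | [], u, _, _, h => ⟨u, rfl, h⟩
  | _ :: _, _, _, _, h => by
    obtain ⟨v, h1, h2⟩ := IsWalk.split h.2
    exact ⟨v, ⟨h.1, h1⟩, h2⟩

theorem IsWalk.exists_prefix : ∀ {p : List (Fin m)} {u v w : Fin n},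
    G.IsWalk u v p → w ∈ p.map G.dst → ∃ q, q ≠ [] ∧ G.IsWalk u w q
  | [], _, _, _, _, hw => by simp at hw
  | a :: p, u, v, w, h, hw => by
    rcases List.mem_cons.1 hw with rfl | hw
    · exact ⟨[a], by simp, h.1, rfl⟩
    · obtain ⟨q, _, h2⟩ := h.2.exists_prefix hw
      exact ⟨a :: q, by simp, h.1, h2⟩

theorem IsWalk.nodup (hG : G.Acyclic) : ∀ {p : List (Fin m)} {u v : Fin n},
    G.IsWalk u v p → (u :: p.map G.dst).Nodup
  | [], _, _, _ => by simp
  | a :: p, u, v, h => by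
    refine List.nodup_cons.2 ⟨fun hu => ?_, h.2.nodup hG⟩
    obtain ⟨q, hq, hw⟩ := IsWalk.exists_prefix (p := a :: p) h hu
    exact hq (hG _ _ hw)

theorem IsWalk.arcs_nodup (hG : G.Acyclic) {p : List (Fin m)} {u v : Fin n}
    (h : G.IsWalk u v p) : p.Nodup :=
  List.Nodup.of_map G.dst (List.nodup_cons.1 (h.nodup hG)).2

theorem IsWalk.length_lt (hG : G.Acyclic) {p : List (Fin m)} {u v : Fin n}
    (h : G.IsWalk u v p) : p.length < n := by
  have h1 := (h.nodup hG).length_le_card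
  rw [List.length_cons, List.length_map, Fintype.card_fin] at h1
  exact h1

theorem src_ne_dst (hG : G.Acyclic) (e : Fin m) : G.src e ≠ G.dst e := fun h => by
  have := hG (G.src e) [e] ⟨rfl, h.symm⟩
  simp at this

theorem IsWalk.notMem (hG : G.Acyclic) {p : List (Fin m)} {e : Fin m} {v : Fin n}
    (h : G.IsWalk (G.dst e) v p) : e ∉ p := fun he => by
  have h' : G.IsWalk (G.src e) v (e :: p) := ⟨rfl, h⟩
  exact (List.nodup_cons.1 (h'.arcs_nodup hG)).1 he

/-- In an acyclic digraph, no property of arcs propagates forward forever. -/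
theorem not_of_propagates (hG : G.Acyclic) {P : Fin m → Prop}
    (hP : ∀ e, P e → ∃ e', G.src e' = G.dst e ∧ P e') (e : Fin m) : ¬ P e := by
  intro he
  have H : ∀ k : ℕ, ∀ e, P e → ∃ v p, G.IsWalk (G.src e) v p ∧ p.length = k := by
    intro k
    induction k with
    | zero => exact fun e _ => ⟨_, [], rfl, rfl⟩
    | succ k ih =>
      intro e he
      obtain ⟨e', h1, h2⟩ := hP e he
      obtain ⟨v, p, h3, h4⟩ := ih e' h2
      exact ⟨v, e :: p, ⟨rfl, h1 ▸ h3⟩, by simp [h4]⟩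
  -- A walk with `n` arcs would visit `n + 1` distinct vertices.
  obtain ⟨v, p, h1, h2⟩ := H n e he
  exact absurd (h1.length_lt hG) (by omega)

/-- If the vertices in a set `S`, which contains the heads of all present arcs that leave it, have
at most one present outgoing arc, then present walks from `S` to a fixed vertex are unique. -/
theorem IsWalk.unique (hG : G.Acyclic) {Pres : Fin m → Prop} {S : Fin n → Prop}
    (h1 : ∀ e e', Pres e → Pres e' → S (G.src e) → G.src e = G.src e' → e = e')
    (h2 : ∀ e, Pres e → S (G.src e) → S (G.dst e)) :
    ∀ {p q : List (Fin m)} {u v : Fin n}, S u → G.IsWalk u v p → G.IsWalk u v q →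
      (∀ e ∈ p, Pres e) → (∀ e ∈ q, Pres e) → p = q
  | [], q, u, v, _, hp, hq, _, _ => by
    cases hp
    exact (hG _ _ hq).symm
  | e :: p, [], u, v, _, hp, hq, _, _ => by
    cases hq
    exact hG _ _ hp
  | e :: p, e' :: q, u, v, hu, hp, hq, hep, heq => by
    have he := hep e (by simp)
    have he' := heq e' (by simp)
    have hS : S (G.src e) := hp.1 ▸ hu
    obtain rfl := h1 e e' he he' hS (hp.1.trans hq.1.symm)
    rw [IsWalk.unique hG h1 h2 (h2 e he hS) hp.2 hq.2 (fun a ha => hep a (by simp [ha]))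
      (fun a ha => heq a (by simp [ha]))]

/-- Incidence of the arc `e` with the vertex `v`. -/
def inc (G : Network n m) (v : Fin n) (e : Fin m) : ℝ :=
  (if G.dst e = v then 1 else 0) - (if G.src e = v then 1 else 0)

theorem IsWalk.sum_inc (w : Fin n) : ∀ {p : List (Fin m)} {u v : Fin n}, G.IsWalk u v p →
    (p.map (G.inc w)).sum = (if v = w then 1 else 0) - (if u = w then 1 else 0)
  | [], u, v, h => by cases h; simp
  | e :: p, u, v, h => by
    rw [List.map_cons, List.sum_cons, IsWalk.sum_inc w h.2, inc, h.1]
    ring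

end Network

/-! ## Sums -/

theorem sum_eq_add_sub {ι : Type*} [Fintype ι] [DecidableEq ι] (i : ι) {f g : ι → ℝ}
    (h : ∀ j, j ≠ i → g j = f j) : ∑ j, g j = ∑ j, f j + (g i - f i) := by
  rw [← Finset.add_sum_erase _ g (Finset.mem_univ i), ← Finset.add_sum_erase _ f (Finset.mem_univ i),
    Finset.sum_congr rfl fun j hj => h j (Finset.ne_of_mem_erase hj)]
  ring

theorem sum_mem_mul {ι : Type*} [Fintype ι] [DecidableEq ι] {p : List ι} (hp : p.Nodup)
    (δ : ℝ) (c : ι → ℝ) : ∑ e, (if e ∈ p then δ else 0) * c e = δ * (p.map c).sum := by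
  rw [← List.sum_toFinset _ hp, Finset.mul_sum, ← Finset.sum_filter_add_sum_filter_not _ (· ∈ p)]
  rw [Finset.sum_congr rfl (g := fun e => δ * c e) (by intro e he; simp_all)]
  rw [Finset.sum_eq_zero (s := Finset.filter (fun e => ¬ e ∈ p) _) (by intro e he; simp_all)]
  rw [add_zero]
  congr 1
  ext; simp

theorem sum_list_mul {ι κ : Type*} [Fintype ι] [DecidableEq ι] (C : List κ) (a : κ → ι) (δ : κ → ℝ)
    (c : ι → ℝ) : ∑ e, (C.map fun w => if a w = e then δ w else 0).sum * c e =
      (C.map fun w => δ w * c (a w)).sum := by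
  induction C with
  | nil => simp
  | cons w C ih => simp [add_mul, Finset.sum_add_distrib, ih]

theorem sum_map_eq_zero_of_notMem {ι κ : Type*} [DecidableEq ι] {C : List κ} {a : κ → ι} {e : ι}
    (h : e ∉ C.map a) (δ : κ → ℝ) : (C.map fun w => if a w = e then δ w else 0).sum = 0 := by
  apply List.sum_eq_zero
  intro r hr
  obtain ⟨w, hw, rfl⟩ := List.mem_map.1 hr
  rw [if_neg]
  rintro rfl
  exact h (List.mem_map_of_mem hw)

theorem sum_map_eq_of_nodup {ι κ : Type*} [DecidableEq ι] {a : κ → ι} (δ : κ → ℝ) :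
    ∀ {C : List κ}, (C.map a).Nodup → ∀ w ∈ C,
      (C.map fun v => if a v = a w then δ v else 0).sum = δ w
  | [], _, w, hw => by simp at hw
  | v :: C, h, w, hw => by
    rw [List.map_cons, List.nodup_cons] at h
    rw [List.map_cons, List.sum_cons]
    rcases List.mem_cons.1 hw with rfl | hw
    · rw [if_pos rfl, sum_map_eq_zero_of_notMem h.1, add_zero]
    · rw [sum_map_eq_of_nodup δ h.2 w hw, if_neg, zero_add]
      intro he
      exact h.1 (he ▸ List.mem_map_of_mem hw)

end Transship

namespace Transship

variable {n m : ℕ} {G : Network n m} {b : Fin n → ℝ} {s : St n m}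

/-! ## Invariants of the state -/

/-- The part of the invariant that does not depend on the progress of the algorithm: flow
conservation, and consistency of the finished paths. -/
structure Core (G : Network n m) (b : Fin n → ℝ) (s : St n m) : Prop where
  flow_nonneg : ∀ a, 0 ≤ s.flow a
  dem_nonneg : ∀ t, 0 ≤ s.dem t
  conserve : ∀ v, s.flow (.inr v) + ∑ e, s.flow (.inl e) * G.inc v e =
    ∑ t, if s.loc t = some v then s.dem t else 0
  walk : ∀ t, 0 < s.dem t → ∃ v, s.loc t = some v ∧ G.IsWalk v t (s.trail t)
  source : ∀ v, s.flow (.inr v) +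
    (s.paths.map fun P => if P.source = v then P.value else 0).sum = max (b v) 0
  sink : ∀ t, s.dem t +
    (s.paths.map fun P => if P.sink = t then P.value else 0).sum = max (-b t) 0
  paths_walk : ∀ P ∈ s.paths, G.IsWalk P.source P.sink P.arcs
  paths_pos : ∀ P ∈ s.paths, 0 < P.value
  pairs : (s.paths.map fun P => (P.source, P.sink)).Nodup
  total : ∀ e, s.total e = (s.paths.map fun P => if e ∈ P.arcs then P.value else 0).sum

/-- No further path from the source of `P` to the sink of `P` can arise. -/
def Separated (G : Network n m) (s : St n m) (P : RoutedPath n m) : Prop :=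
  s.flow (.inr P.source) = 0 ∨
  ∀ v q, s.loc P.sink = some v → G.IsWalk P.source v q → ∃ e ∈ q, s.flow (.inl e) = 0

/-- The invariant behind "at most one path for each source-sink pair". It persists because arcs with
flow zero stay at zero and sinks move only along present arcs. -/
def NoReturn (G : Network n m) (s : St n m) : Prop :=
  ∀ P ∈ s.paths, s.dem P.sink = 0 ∨ Separated G s P

/-- Demand that has been moved along the arc `e`. -/
noncomputable def St.routed (s : St n m) (e : Fin m) : ℝ :=
  s.total e + ∑ t, if e ∈ s.trail t then s.dem t else 0

/-- The (sub-)sink of `t` is moved backward along `e`. -/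
noncomputable def St.moveIn (s : St n m) (G : Network n m) (t : Fin n) (e : Fin m) : St n m :=
  { s with
    flow := Function.update s.flow (.inl e) (s.flow (.inl e) - s.dem t)
    loc := Function.update s.loc t (some (G.src e))
    trail := Function.update s.trail t (e :: s.trail t) }

/-- Flow value `δ` is moved from the (sub-)sink of `t` along the path `q` to `u` and then to the
super-source. -/
noncomputable def St.routeVia (s : St n m) (u t : Fin n) (q : List (Fin m)) (δ : ℝ) : St n m :=
  { s with
    flow := Sum.elim (fun e => s.flow (.inl e) - if e ∈ q then δ else 0)
      (fun v => s.flow (.inr v) - if v = u then δ else 0)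
    dem := Function.update s.dem t (s.dem t - δ)
    paths := ⟨u, t, q ++ s.trail t, δ⟩ :: s.paths
    total := fun e => s.total e + if e ∈ q ++ s.trail t then δ else 0 }

/-- The (sub-)sink of `t` disappears. -/
noncomputable def St.clear (s : St n m) (t : Fin n) : St n m :=
  { s with
    loc := Function.update s.loc t none
    dem := Function.update s.dem t 0 }

theorem Core.moveIn (h : Core G b s) {t : Fin n} {e : Fin m}
    (hd : 0 < s.dem t) (hl : s.loc t = some (G.dst e)) (hf : s.dem t ≤ s.flow (.inl e)) :
    Core G b (s.moveIn G t e) where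
  flow_nonneg a := by
    by_cases ha : a = .inl e
    · subst ha; simpa [St.moveIn] using hf
    · simpa [St.moveIn, ha] using h.flow_nonneg a
  dem_nonneg := h.dem_nonneg
  conserve v := by
    have h1 := h.conserve v
    rw [sum_eq_add_sub e (f := fun e => s.flow (.inl e) * G.inc v e)
        (g := fun a => (s.moveIn G t e).flow (.inl a) * G.inc v a)
        (fun j hj => by simp [St.moveIn, hj]),
      sum_eq_add_sub t (f := fun t => if s.loc t = some v then s.dem t else 0)
        (g := fun r => if (s.moveIn G t e).loc r = some v then (s.moveIn G t e).dem r else 0)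
        (fun j hj => by simp [St.moveIn, hj])]
    have h3 : (s.moveIn G t e).flow (.inr v) = s.flow (.inr v) := by simp [St.moveIn]
    rw [h3, ← h1]
    simp only [St.moveIn, Function.update_self, hl, Option.some.injEq, Network.inc]
    split_ifs <;> ring
  walk r hr := by
    by_cases hrt : r = t
    · subst hrt
      obtain ⟨v, h1, h2⟩ := h.walk r hd
      obtain rfl : G.dst e = v := by simpa [hl] using h1
      exact ⟨G.src e, by simp [St.moveIn], by simpa [St.moveIn] using ⟨rfl, h2⟩⟩
    · simpa [St.moveIn, hrt] using h.walk r hr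
  source v := by simpa [St.moveIn] using h.source v
  sink := h.sink
  paths_walk := h.paths_walk
  paths_pos := h.paths_pos
  pairs := h.pairs
  total := h.total

/-- Conservation is kept because the incidences along `q` telescope to its end vertices, and the
loss at `u` is compensated by the dummy arc. The hypothesis `hnew` is what keeps the pairs distinct;
it will come from `NoReturn`. -/
theorem Core.routeVia (hG : G.Acyclic) (h : Core G b s) {u v t : Fin n} {q : List (Fin m)} {δ : ℝ}
    (hl : s.loc t = some v) (hq : G.IsWalk u v q) (hδ : 0 < δ) (hd : δ ≤ s.dem t)
    (hu : δ ≤ s.flow (.inr u)) (he : ∀ e ∈ q, δ ≤ s.flow (.inl e))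
    (hnew : ∀ P ∈ s.paths, P.sink = t → P.source ≠ u) : Core G b (s.routeVia u t q δ) where
  flow_nonneg a := by
    rcases a with e | v
    · simp only [St.routeVia, Sum.elim_inl]
      split_ifs with h1
      · simpa using he e h1
      · simpa using h.flow_nonneg _
    · simp only [St.routeVia, Sum.elim_inr]
      split_ifs with h1
      · subst h1; simpa using hu
      · simpa using h.flow_nonneg _
  dem_nonneg r := by
    by_cases hrt : r = t
    · subst hrt; simpa [St.routeVia] using hd
    · simpa [St.routeVia, hrt] using h.dem_nonneg r
  conserve w := by
    have h1 := h.conserve w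
    rw [sum_eq_add_sub t (f := fun t => if s.loc t = some w then s.dem t else 0)
        (g := fun r => if (s.routeVia u t q δ).loc r = some w then
          (s.routeVia u t q δ).dem r else 0)
        (fun j hj => by simp [St.routeVia, hj]), ← h1]
    have h2 : ∑ e, (s.routeVia u t q δ).flow (.inl e) * G.inc w e =
        ∑ e, s.flow (.inl e) * G.inc w e - ∑ e, (if e ∈ q then δ else 0) * G.inc w e := by
      rw [← Finset.sum_sub_distrib]
      exact Finset.sum_congr rfl fun e _ => by simp only [St.routeVia, Sum.elim_inl]; ring
    rw [h2, sum_mem_mul (hq.arcs_nodup hG), hq.sum_inc]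
    simp only [St.routeVia, Sum.elim_inr, Function.update_self, hl, Option.some.injEq, eq_comm (a := w)]
    split_ifs <;> ring
  walk r hr := by
    by_cases hrt : r = t
    · subst hrt; exact h.walk r (hδ.trans_le hd)
    · exact h.walk r (by simpa [St.routeVia, hrt] using hr)
  source w := by
    rw [← h.source w]
    simp only [St.routeVia, Sum.elim_inr, List.map_cons, List.sum_cons, eq_comm (a := w)]
    ring
  sink r := by
    rw [← h.sink r]
    by_cases hrt : r = t
    · subst hrt
      simp only [St.routeVia, Function.update_self, List.map_cons, List.sum_cons, if_true]
      ring
    · simp [St.routeVia, hrt, Ne.symm hrt]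
  paths_walk P hP := by
    rcases List.mem_cons.1 hP with rfl | hP
    · obtain ⟨v', h1, h2⟩ := h.walk t (hδ.trans_le hd)
      obtain rfl : v = v' := by simpa [hl] using h1
      exact hq.append h2
    · exact h.paths_walk P hP
  paths_pos P hP := by
    rcases List.mem_cons.1 hP with rfl | hP
    · exact hδ
    · exact h.paths_pos P hP
  pairs := by
    refine List.nodup_cons.2 ⟨fun hm => ?_, h.pairs⟩
    obtain ⟨P, hP, he⟩ := List.mem_map.1 hm
    simp only [Prod.mk.injEq] at he
    exact hnew P hP he.2 he.1
  total e := by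
    simp only [St.routeVia, List.map_cons, List.sum_cons, h.total]
    ring

theorem Core.clear (h : Core G b s) {t : Fin n} (ht : s.dem t = 0) : Core G b (s.clear t) := by
  have hd : (s.clear t).dem = s.dem := by simp [St.clear, ← ht]
  refine { h with dem_nonneg := hd ▸ h.dem_nonneg, sink := hd ▸ h.sink, conserve := ?_, walk := ?_ }
  · intro v
    refine (h.conserve v).trans ?_
    refine Finset.sum_congr rfl fun r _ => ?_
    rw [hd]
    by_cases hr : r = t
    · subst hr; simp [ht]
    · simp [St.clear, hr]
  · intro r hr
    rw [hd] at hr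
    have : r ≠ t := by rintro rfl; exact hr.ne' ht
    simpa [St.clear, this] using h.walk r hr

theorem routed_moveIn (hG : G.Acyclic) (h : Core G b s) {t : Fin n} {e : Fin m}
    (hd : 0 < s.dem t) (hl : s.loc t = some (G.dst e)) (a : Fin m) :
    (s.moveIn G t e).routed a = s.routed a + if a = e then s.dem t else 0 := by
  obtain ⟨v, h1, h2⟩ := h.walk t hd
  obtain rfl : G.dst e = v := by simpa [hl] using h1
  have h3 := h2.notMem hG
  rw [St.routed, St.routed, sum_eq_add_sub t (f := fun t => if a ∈ s.trail t then s.dem t else 0)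
        (g := fun r => if a ∈ (s.moveIn G t e).trail r then (s.moveIn G t e).dem r else 0)
        (fun j hj => by simp [St.moveIn, hj])]
  simp only [St.moveIn, Function.update_self, List.mem_cons]
  by_cases hae : a = e
  · subst hae; simp [h3, add_assoc]
  · simp [hae]

theorem flow_moveIn (t : Fin n) (e : Fin m) (a : ExtArc n m) :
    (s.moveIn G t e).flow a = s.flow a - if a = .inl e then s.dem t else 0 := by
  by_cases hae : a = .inl e
  · subst hae; simp [St.moveIn]
  · simp [St.moveIn, hae]

/-- On the trail, the amount `δ` merely changes from pending demand to output flow. Only the arcs of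
`q` gain, and these are not on the trail because the concatenated walk repeats no arc. -/
theorem routed_routeVia (hG : G.Acyclic) (h : Core G b s) {u v t : Fin n} {q : List (Fin m)} {δ : ℝ}
    (hl : s.loc t = some v) (hq : G.IsWalk u v q) (hd : 0 < s.dem t) (a : Fin m) :
    (s.routeVia u t q δ).routed a = s.routed a + if a ∈ q then δ else 0 := by
  obtain ⟨v', h1, h2⟩ := h.walk t hd
  obtain rfl : v = v' := by simpa [hl] using h1
  have h3 : a ∈ q → a ∉ s.trail t := fun h4 h5 =>
    (List.nodup_append.1 ((hq.append h2).arcs_nodup hG)).2.2 a h4 a h5 rfl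
  rw [St.routed, St.routed, sum_eq_add_sub t (f := fun t => if a ∈ s.trail t then s.dem t else 0)
        (g := fun r => if a ∈ (s.routeVia u t q δ).trail r then (s.routeVia u t q δ).dem r else 0)
        (fun j hj => by simp [St.routeVia, hj])]
  simp only [St.routeVia, Function.update_self, List.mem_append]
  by_cases h4 : a ∈ q
  · simp [h4, h3 h4]; ring
  · by_cases h5 : a ∈ s.trail t
    · simp [h4, h5]; ring
    · simp [h4, h5]

theorem routed_clear {t : Fin n} (ht : s.dem t = 0) (a : Fin m) :
    (s.clear t).routed a = s.routed a := by
  have hd : (s.clear t).dem = s.dem := by simp [St.clear, ← ht]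
  rw [St.routed, hd]
  rfl

/-- The separation property survives if arcs disappear and the sink stays or is moved
backward along a present arc. -/
theorem Separated.mono {s' : St n m} {P : RoutedPath n m} (h : Separated G s P)
    (hf : ∀ a, s.flow a = 0 → s'.flow a = 0)
    (hl : ∀ v, s'.loc P.sink = some v → s.loc P.sink = some v ∨
      ∃ e, G.src e = v ∧ s.loc P.sink = some (G.dst e) ∧ s.flow (.inl e) ≠ 0) :
    Separated G s' P := by
  rcases h with h | h
  · exact .inl (hf _ h)
  · refine .inr fun v q hv hq => ?_
    rcases hl v hv with h1 | ⟨e, he, h1, h2⟩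
    · obtain ⟨e, he, h2⟩ := h v q h1 hq
      exact ⟨e, he, hf _ h2⟩
    -- A walk to the new position, prolonged by `e`, is a walk to the old one. Its absent arc is not
    -- `e`, which is present.
    · obtain ⟨e', he', h3⟩ := h _ (q ++ [e]) h1 (hq.append ⟨he, rfl⟩)
      rcases List.mem_append.1 he' with h4 | h4
      · exact ⟨e', h4, hf _ h3⟩
      · rw [List.mem_singleton] at h4
        subst h4
        exact absurd h3 h2

end Transship

namespace Transship

variable {n m : ℕ} {G : Network n m} {b : Fin n → ℝ} {s : St n m}

/-! ## Moving a sink -/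

namespace Runs

variable {β : Type} {c : ℕ} {g : Unit → Alg n m β} {Q : β → St n m → Prop}

theorem wrFlow_bind {a : ExtArc n m} {r : ℝ}
    (h : Runs (g ()) c { s with flow := Function.update s.flow a r } Q) :
    Runs (wrFlow a r >>= g) (c + 1) s Q := wr_bind (fun _ => rfl) h

theorem wrLoc_bind {t : Fin n} {v : Option (Fin n)}
    (h : Runs (g ()) c { s with loc := Function.update s.loc t v } Q) :
    Runs (wrLoc t v >>= g) (c + 1) s Q := wr_bind (fun _ => rfl) h

theorem wrDem_bind {t : Fin n} {r : ℝ}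
    (h : Runs (g ()) c { s with dem := Function.update s.dem t r } Q) :
    Runs (wrDem t r >>= g) (c + 1) s Q := wr_bind (fun _ => rfl) h

theorem emit {u t : Fin n} {p : List (Fin m)} {d : ℝ} (hp : p.Nodup) (hn : p.length ≤ n) :
    Runs (emit u t p d) (2 * n + 1) s fun _ s' => s' =
      { s with
        paths := ⟨u, t, p, d⟩ :: s.paths
        total := fun e => s.total e + if e ∈ p then d else 0 } := by
  refine bind (c₂ := 1) (forEach (k := 1) (fun l _ s' => ∃ q, p = q ++ l ∧
    s' = { s with total := fun e => s.total e + if e ∈ q then d else 0 }) ?_ p () s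
    ⟨[], rfl, by simp⟩) ?_ (by omega)
  · rintro e l _ _ ⟨q, hq, rfl⟩
    refine wr (s' := { s with total := fun e' => s.total e' + if e' ∈ q ++ [e] then d else 0 })
      (fun k => ?_) ⟨q ++ [e], by simp [hq], rfl⟩
    simp only [St.mem, Memory.mk.injEq, true_and]
    ext e'
    by_cases h : e' = e
    · subst h
      have : e' ∉ q := fun h' => by
        rw [hq] at hp
        exact (List.nodup_append.1 hp).2.2 e' h' e' (by simp) rfl
      simp [this]
    · simp [h]
  · rintro _ _ ⟨q, hq, rfl⟩
    rw [List.append_nil] at hq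
    subst hq
    exact wr (fun _ => rfl) rfl

theorem finish {t : Fin n} : Runs (finish t) 2 s fun _ s' => s' = s.clear t :=
  wrLoc_bind (c := 1) (wr (c := 0) (fun _ => rfl) rfl)

end Runs

/-- The (sub-)sink of `t` is moved backward along `a`. -/
noncomputable def St.moved (s : St n m) (G : Network n m) (t : Fin n) : ExtArc n m → St n m
  | .inl e => s.moveIn G t e
  | .inr u => (s.routeVia u t [] (s.dem t)).clear t

theorem Runs.moveSink {t : Fin n} (a : ExtArc n m) (ht : (s.trail t).Nodup)
    (hn : (s.trail t).length ≤ n) :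
    Runs (moveSink G t a) (2 * n + 7) s fun _ s' => s' = s.moved G t a := by
  refine rd_bind_eq _ (fun _ => rfl) <| rd_bind_eq _ (fun _ => rfl) <| wrFlow_bind ?_
  rcases a with e | u
  · exact (wrLoc_bind (c := 1) (wr (c := 0) (fun _ => rfl) rfl)).le (by omega)
  · refine rd_bind_eq _ (fun _ => rfl) <| bind (emit ht hn) ?_ (le_refl (2 * n + 1 + 2))
    rintro _ _ rfl
    refine finish.mono le_rfl ?_
    rintro _ _ rfl
    simp only [St.moved, St.clear, St.routeVia, St.mk.injEq, true_and]
    refine ⟨?_, by simp, rfl, rfl⟩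
    ext (e | v)
    · simp
    · by_cases hv : v = u
      · subst hv; simp
      · simp [hv]

/-! ### The potential, and single moves of a sink -/

/-- Number of present arcs, plus the number of moves that the sinks can still make. -/
noncomputable def St.potential (s : St n m) : ℕ :=
  (Finset.univ.filter fun a => 0 < s.flow a).card +
    -- The trail of an active sink has fewer than `n` arcs, so truncation never occurs for it and
    -- the summand stays positive until the sink reaches the super-source.
    ∑ t, if 0 < s.dem t then n + 1 - (s.trail t).length else 0

theorem potential_le (s : St n m) : s.potential ≤ (n + m) + n * (n + 1) := by
  refine Nat.add_le_add ?_ ?_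
  · refine (Finset.card_le_univ _).trans ?_
    simp [add_comm]
  · refine (Finset.sum_le_card_nsmul _ _ (n + 1) fun t _ => ?_).trans (by simp)
    split_ifs <;> omega

theorem potential_lt {s s' : St n m} (hf : ∀ a, 0 < s'.flow a → 0 < s.flow a)
    (hd : ∀ t, (if 0 < s'.dem t then n + 1 - (s'.trail t).length else 0) ≤
      if 0 < s.dem t then n + 1 - (s.trail t).length else 0)
    (h : (∃ a, 0 < s.flow a ∧ ¬ 0 < s'.flow a) ∨
      ∃ t, (if 0 < s'.dem t then n + 1 - (s'.trail t).length else 0) <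
        if 0 < s.dem t then n + 1 - (s.trail t).length else 0) : s'.potential < s.potential := by
  have h1 : (Finset.univ.filter fun a => 0 < s'.flow a) ⊆
      Finset.univ.filter fun a => 0 < s.flow a := fun a => by simpa using hf a
  rcases h with ⟨a, h2, h3⟩ | ⟨t, h2⟩
  · refine Nat.add_lt_add_of_lt_of_le (Finset.card_lt_card ?_) (Finset.sum_le_sum fun t _ => hd t)
    exact (Finset.ssubset_iff_of_subset h1).2 ⟨a, by simpa using h2, by simpa using h3⟩
  · exact Nat.add_lt_add_of_le_of_lt (Finset.card_le_card h1)
      (Finset.sum_lt_sum (fun t _ => hd t) ⟨t, Finset.mem_univ _, h2⟩)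

theorem potential_le_of_le {s s' : St n m} (hf : ∀ a, 0 < s'.flow a → 0 < s.flow a)
    (hd : ∀ t, (if 0 < s'.dem t then n + 1 - (s'.trail t).length else 0) ≤
      if 0 < s.dem t then n + 1 - (s.trail t).length else 0) : s'.potential ≤ s.potential :=
  Nat.add_le_add (Finset.card_le_card fun a => by simpa using hf a)
    (Finset.sum_le_sum fun t _ => hd t)

theorem Core.trail_nodup (hG : G.Acyclic) (h : Core G b s) {t : Fin n} (hd : 0 < s.dem t) :
    (s.trail t).Nodup ∧ (s.trail t).length < n := by
  obtain ⟨v, _, h2⟩ := h.walk t hd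
  exact ⟨h2.arcs_nodup hG, h2.length_lt hG⟩

/-- Under the separation property, the super-source has no finished path to `t` from a source
from which a present walk leads to the current position of `t`. -/
theorem NoReturn.source_ne (hN : NoReturn G s) {u v t : Fin n} {q : List (Fin m)}
    (hd : 0 < s.dem t) (hl : s.loc t = some v) (hq : G.IsWalk u v q) (hu : 0 < s.flow (.inr u))
    (he : ∀ e ∈ q, 0 < s.flow (.inl e)) : ∀ P ∈ s.paths, P.sink = t → P.source ≠ u := by
  rintro P hP rfl rfl
  rcases hN P hP with h | h | h
  · exact hd.ne' h
  · exact hu.ne' h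
  · obtain ⟨e, h1, h2⟩ := h v q hl hq
    exact (he e h1).ne' h2

/-- A move of the sink of `t` along the arc `a` is possible. -/
structure Movable (G : Network n m) (s : St n m) (t : Fin n) (a : ExtArc n m) : Prop where
  pos : 0 < s.dem t
  loc : s.loc t = some (G.head a)
  le : s.dem t ≤ s.flow a

section Movable

variable {t : Fin n} {a : ExtArc n m}

theorem Movable.flow_le (h : Movable G s t a) (c : ExtArc n m) :
    (s.moved G t a).flow c ≤ s.flow c := by
  have := h.pos
  rcases a with e | u
  · simp only [St.moved, flow_moveIn]
    split_ifs <;> linarith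
  · rcases c with e | v <;> simp only [St.moved, St.clear, St.routeVia, Sum.elim_inl, Sum.elim_inr]
    · simp
    · split_ifs <;> linarith

theorem Movable.flow_eq (c : ExtArc n m) :
    (s.moved G t a).flow c = s.flow c - if c = a then s.dem t else 0 := by
  rcases a with e | u
  · simp only [St.moved, flow_moveIn]
  · rcases c with e | v <;> simp [St.moved, St.clear, St.routeVia]

theorem Movable.core (hG : G.Acyclic) (hC : Core G b s) (hN : NoReturn G s)
    (h : Movable G s t a) : Core G b (s.moved G t a) := by
  rcases a with e | u
  · exact hC.moveIn h.pos h.loc h.le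
  · refine (hC.routeVia (q := []) hG h.loc rfl h.pos le_rfl h.le (by simp) ?_).clear (by simp [St.routeVia])
    exact hN.source_ne (q := []) h.pos h.loc rfl (h.pos.trans_le h.le) (by simp)

/-- A move to the super-source outputs a path but finishes the sink, so all paths to this sink
become harmless. Every other move is covered by the monotonicity of separation. -/
theorem Movable.noReturn (hN : NoReturn G s)
    (h : Movable G s t a) : NoReturn G (s.moved G t a) := by
  have hz : ∀ c, s.flow c = 0 → (s.moved G t a).flow c = 0 := by
    intro c hc
    rw [Movable.flow_eq, hc]
    split_ifs with h1
    · subst h1; exact absurd (h.pos.trans_le h.le) (by simp [hc])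
    · simp
  rcases a with e | u
  · intro P hP
    refine (hN P hP).imp id fun h1 => h1.mono hz fun v hv => ?_
    by_cases ht : P.sink = t
    · subst ht
      refine .inr ⟨e, by simpa [St.moved, St.moveIn] using hv, h.loc, ?_⟩
      exact (h.pos.trans_le h.le).ne'
    · exact .inl (by simpa [St.moved, St.moveIn, ht] using hv)
  · intro P hP
    by_cases ht : P.sink = t
    · exact .inl (by simp [ht, St.moved, St.clear])
    · rcases List.mem_cons.1 hP with rfl | hP
      · exact absurd rfl ht
      · refine (hN P hP).imp (fun h1 => ?_) fun h1 => h1.mono hz fun v hv => ?_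
        · simpa [St.moved, St.clear, St.routeVia, ht] using h1
        · exact .inl (by simpa [St.moved, St.clear, St.routeVia, ht] using hv)

/-- The quantity on which the lower bound rests: a move turns remaining flow into routed demand. -/
theorem Movable.routed (hG : G.Acyclic) (hC : Core G b s) (h : Movable G s t a) (e : Fin m) :
    (s.moved G t a).routed e + (s.moved G t a).flow (.inl e) = s.routed e + s.flow (.inl e) := by
  rw [Movable.flow_eq]
  rcases a with e' | u
  · rw [St.moved, routed_moveIn hG hC h.pos h.loc]
    simp
  · rw [St.moved, routed_clear (by simp [St.routeVia]),
      routed_routeVia (u := u) (q := []) hG hC h.loc rfl h.pos]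
    simp

theorem Movable.potential (hG : G.Acyclic) (hC : Core G b s) (h : Movable G s t a) :
    (s.moved G t a).potential < s.potential := by
  have h1 := (hC.trail_nodup hG h.pos).2
  have h2 := h.pos
  refine potential_lt (fun c hc => hc.trans_le (h.flow_le c)) (fun r => ?_) (.inr ⟨t, ?_⟩)
  · rcases a with e | u
    · by_cases hr : r = t
      · subst hr; simp [St.moved, St.moveIn, h2]; omega
      · simp [St.moved, St.moveIn, hr]
    · by_cases hr : r = t
      · subst hr; simp [St.moved, St.clear, St.routeVia]
      · simp [St.moved, St.clear, St.routeVia, hr]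
  · rcases a with e | u
    · simp [St.moved, St.moveIn, h2]; omega
    · simp [St.moved, St.clear, St.routeVia, h2]; omega

end Movable

end Transship

namespace Transship

variable {n m : ℕ} {G : Network n m} {b : Fin n → ℝ} {s : St n m}

/-! ## Labels -/

/-- The present arcs that leave `v`. -/
noncomputable def outArcs (G : Network n m) (s : St n m) (v : Fin n) : Finset (Fin m) :=
  Finset.univ.filter fun e => G.src e = v ∧ 0 < s.flow (.inl e)

theorem mem_outArcs {v : Fin n} {e : Fin m} :
    e ∈ outArcs G s v ↔ G.src e = v ∧ 0 < s.flow (.inl e) := by simp [outArcs]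

/-- What the labels mean: out-degrees, and the vertices from which a vertex of out-degree at least
two can be reached. -/
structure IsLabels (G : Network n m) (s : St n m) (lab : Labels n) : Prop where
  deg : ∀ v, lab.deg v = (outArcs G s v).card
  branching_of_deg : ∀ v, 2 ≤ lab.deg v → lab.branching v = true
  branching_src : ∀ e, 0 < s.flow (.inl e) → lab.branching (G.dst e) = true →
    lab.branching (G.src e) = true
  -- Closed sets replace reachability here: the set explored by a backward search is such a set `S`,
  -- which immediately shows that the arcs of a backward path are singular.
  not_branching : ∀ S : Fin n → Prop, (∀ v, S v → lab.deg v ≤ 1) →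
    (∀ e, 0 < s.flow (.inl e) → S (G.src e) → S (G.dst e)) →
    ∀ v, S v → lab.branching v = false

/-- Marked vertices are not in a set of vertices of out-degree at most one that is closed under
following arcs. -/
def Sound (G : Network n m) (s : St n m) (deg : Fin n → ℕ) (br : Fin n → Bool) : Prop :=
  ∀ S : Fin n → Prop, (∀ v, S v → deg v ≤ 1) →
    (∀ e, 0 < s.flow (.inl e) → S (G.src e) → S (G.dst e)) → ∀ v, S v → br v = false

theorem mem_arcs (e : Fin m) : e ∈ (arcs : List (Fin m)) := List.mem_finRange e

theorem mem_verts (v : Fin n) : v ∈ (verts : List (Fin n)) := List.mem_finRange v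

theorem mem_extArcs (a : ExtArc n m) : a ∈ (extArcs : List (ExtArc n m)) := by
  rcases a with e | v <;> simp [extArcs, mem_arcs, mem_verts]

theorem length_arcs : (arcs : List (Fin m)).length = m := List.length_finRange

theorem length_verts : (verts : List (Fin n)).length = n := List.length_finRange

theorem length_extArcs : (extArcs : List (ExtArc n m)).length = n + m := by
  simp [extArcs, length_arcs, length_verts, add_comm]

theorem Runs.degrees : Runs (Transship.forEach (fun deg e => do
    let f ← Transship.rd fun s => s.flow (.inl e)
    return if 0 < f then Function.update deg (G.src e) (deg (G.src e) + 1) else deg)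
    arcs (fun _ => 0)) (m * 2) s fun deg s' => s' = s ∧ ∀ v, deg v = (outArcs G s v).card := by
  have := Runs.forEach (k := 1) (body := fun (deg : Fin n → ℕ) e => do
    let f ← Transship.rd fun s : Memory n m => s.flow (.inl e)
    return if 0 < f then Function.update deg (G.src e) (deg (G.src e) + 1) else deg)
    (fun l deg s' => s' = s ∧ l.Nodup ∧ ∀ v, deg v = ((outArcs G s v).filter (· ∉ l)).card) ?_
    arcs (fun _ => 0) s ⟨rfl, List.nodup_finRange m, by simp [mem_arcs]⟩
  · rw [length_arcs] at this
    refine this.mono le_rfl ?_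
    rintro deg s' ⟨rfl, _, h⟩
    exact ⟨rfl, by simpa using h⟩
  · rintro e l deg s ⟨rfl, hl, hd⟩
    refine rd_bind_eq (c := 0) _ (fun _ => rfl) <| pure ⟨rfl, hl.of_cons, fun v => ?_⟩
    have hel := (List.nodup_cons.1 hl).1
    have h1 : (outArcs G s v).filter (· ∉ l) = if G.src e = v ∧ 0 < s.flow (.inl e) then
        insert e ((outArcs G s v).filter (· ∉ e :: l)) else
        (outArcs G s v).filter (· ∉ e :: l) := by
      ext e'
      split_ifs with h <;> by_cases he : e' = e
      · subst he; simp [mem_outArcs, h, hel]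
      · simp [he]
      · subst he; simp [mem_outArcs, h]
      · simp [he]
    rw [h1]
    split_ifs with h2 h3 h3
    · rw [Finset.card_insert_of_notMem (by simp), ← h3.1, Function.update_self, hd]
    · rw [Function.update_of_ne (by rintro rfl; exact h3 ⟨rfl, h2⟩), hd]
    · exact absurd h3.2 h2
    · exact hd v

/-- One pass over the arcs. -/
theorem Runs.propagate {deg : Fin n → ℕ} {br : Fin n → Bool} (hs : Sound G s deg br) :
    Runs (Transship.forEach (fun br e => do
      let f ← Transship.rd fun s => s.flow (.inl e)
      return if 0 < f ∧ br (G.dst e) then Function.update br (G.src e) true else br) arcs br)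
      (m * 2) s fun br' s' => s' = s ∧ Sound G s deg br' ∧ (∀ v, br v = true → br' v = true) ∧
        (∀ e, 0 < s.flow (.inl e) → br (G.dst e) = true → br' (G.src e) = true) ∧
        ((∀ e, 0 < s.flow (.inl e) → br (G.dst e) = true → br (G.src e) = true) →
          br' = br) := by
  have := Runs.forEach (k := 1) (body := fun (br : Fin n → Bool) e => do
    let f ← Transship.rd fun s : Memory n m => s.flow (.inl e)
    return if 0 < f ∧ br (G.dst e) then Function.update br (G.src e) true else br)
    (fun l br' s' => s' = s ∧ Sound G s deg br' ∧ (∀ v, br v = true → br' v = true) ∧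
        (∀ e, e ∉ l → 0 < s.flow (.inl e) → br (G.dst e) = true → br' (G.src e) = true) ∧
        ((∀ e, 0 < s.flow (.inl e) → br (G.dst e) = true → br (G.src e) = true) →
          br' = br)) ?_
    arcs br s ⟨rfl, hs, fun _ h => h, fun e h => absurd (mem_arcs e) h, fun _ => rfl⟩
  · rw [length_arcs] at this
    refine this.mono le_rfl ?_
    rintro br' s' ⟨rfl, h1, h2, h3, h4⟩
    exact ⟨rfl, h1, h2, fun e => h3 e (by simp), h4⟩
  · rintro e l br' s ⟨rfl, h1, h2, h3, hc⟩
    refine rd_bind_eq (c := 0) _ (fun _ => rfl) <| pure ⟨rfl, ?_, ?_, ?_, ?_⟩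
    · intro S hS1 hS2 v hv
      split_ifs with h
      · have hne : v ≠ G.src e := by
          rintro rfl
          have := h1 S hS1 hS2 _ (hS2 e h.1 hv)
          simp [h.2] at this
        rw [Function.update_of_ne hne]
        exact h1 S hS1 hS2 v hv
      · exact h1 S hS1 hS2 v hv
    · intro v hv
      split_ifs
      · by_cases hne : v = G.src e
        · simp [hne]
        · rw [Function.update_of_ne hne]; exact h2 v hv
      · exact h2 v hv
    · intro e' he' h4 h5
      by_cases hee : e' = e
      · subst hee
        rw [if_pos ⟨h4, h2 _ h5⟩, Function.update_self]
      · have h6 := h3 e' (by simp [hee, he']) h4 h5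
        split_ifs
        · by_cases hne : G.src e' = G.src e
          · simp [hne]
          · rw [Function.update_of_ne hne]; exact h6
        · exact h6
    · intro h4
      rw [hc h4]
      split_ifs with h5
      · rw [← h4 e h5.1 h5.2, Function.update_eq_self]
      · rfl

/-- Marks are propagated backward in `n` passes. A pass that changes anything marks a new vertex,
and a pass that changes nothing certifies that the marks are closed, so `n` passes suffice. -/
theorem Runs.computeLabels : Runs (computeLabels G) (2 * m + 3 * n + n * (2 * m + 1)) s
    fun lab s' => s' = s ∧ IsLabels G s lab := by
  refine bind degrees (c₂ := n + n * (m * 2 + 1)) ?_ (by ring_nf; omega)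
  rintro deg s ⟨rfl, hdeg⟩
  have h0 := Runs.forEach (k := 0) (body := fun (br : Fin n → Bool) v => 
    (Pure.pure (Function.update br v (decide (2 ≤ deg v))) : Alg n m _))
    (fun l br s' => s' = s ∧ ∀ v, br v = true ∧ 2 ≤ deg v ∨ br v = false ∧ (v ∈ l ∨ deg v ≤ 1)) ?_
    verts (fun _ => false) s ⟨rfl, fun v => by simp [mem_verts]⟩
  · rw [length_verts] at h0
    refine bind h0 (c₂ := n * (m * 2 + 1)) ?_ (by ring_nf; omega)
    rintro br s ⟨rfl, hbr⟩
    have h1 := Runs.forEach (k := m * 2) (body := fun br (_ : Fin n) =>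
      Transship.forEach (fun br e => do
      let f ← Transship.rd fun s => s.flow (.inl e)
      return if 0 < f ∧ br (G.dst e) then Function.update br (G.src e) true else br) arcs br)
      (fun l br' s' => s' = s ∧ Sound G s deg br' ∧ (∀ v, br v = true → br' v = true) ∧
        ((∀ e, 0 < s.flow (.inl e) → br' (G.dst e) = true → br' (G.src e) = true) ∨
          -- Until closure is reached, every completed pass has contributed at least one marked
          -- vertex. After the last pass this would mean that all vertices are marked, and then
          -- closure is trivial.
          n ≤ l.length + (Finset.univ.filter fun v => br' v = true).card))
      ?_ verts br s ⟨rfl, ?_, fun _ h => h, .inr ?_⟩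
    · rw [length_verts] at h1
      refine bind (c₂ := 0) h1 ?_ (by ring_nf; omega)
      rintro br' s ⟨rfl, h2, h3, h4⟩
      refine pure ⟨rfl, hdeg, fun v hv => h3 v ?_, ?_, h2⟩
      · rcases hbr v with h | h
        · exact h.1
        · simp at h; dsimp only at hv; omega
      · rcases h4 with h4 | h4
        · exact h4
        · have h5 : (Finset.univ.filter fun v => br' v = true) = Finset.univ :=
            Finset.eq_univ_of_card _ (le_antisymm (Finset.card_le_univ _) (by simpa using h4))
          intro e _ _
          have := Finset.mem_univ (G.src e)
          rw [← h5] at this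
          simpa using this
    · rintro v l br' s ⟨rfl, h2, h3, h4⟩
      refine (propagate h2).mono le_rfl ?_
      rintro br'' s ⟨rfl, h5, h6, h7, h8⟩
      refine ⟨rfl, h5, fun v hv => h6 v (h3 v hv), ?_⟩
      by_cases heq : br'' = br'
      · subst heq; exact .inl h7
      · right
        rcases h4 with h4 | h4
        · exact absurd (h8 h4) heq
        · have h9 : (Finset.univ.filter fun v => br' v = true) ⊂
              Finset.univ.filter fun v => br'' v = true := by
            obtain ⟨v, hv⟩ := Function.ne_iff.1 heq
            refine (Finset.ssubset_iff_of_subset fun v => by simpa using h6 v).2 ⟨v, ?_⟩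
            have := h6 v
            cases h11 : br' v <;> cases h10 : br'' v <;> simp_all
          have := Finset.card_lt_card h9
          simp only [List.length_cons] at h4
          omega
    · intro S hS1 _ v hv
      rcases hbr v with h | h
      · exact absurd (hS1 v hv) (by omega)
      · exact h.1
    · rw [length_verts]; omega
  · rintro v l br s ⟨rfl, h⟩
    refine pure ⟨rfl, fun u => ?_⟩
    by_cases hu : u = v
    · subst hu
      simp
      omega
    · simpa [hu] using h u

end Transship

namespace Transship

variable {n m : ℕ} {G : Network n m} {b : Fin n → ℝ} {s : St n m}

/-! ## Backward search -/

theorem IsLabels.src_inj {lab : Labels n} (h : IsLabels G s lab) {v : Fin n} (hv : lab.deg v ≤ 1)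
    {e e' : Fin m} (he : 0 < s.flow (.inl e)) (he' : 0 < s.flow (.inl e')) (h1 : G.src e = v)
    (h2 : G.src e' = v) : e = e' := by
  rw [h.deg, Finset.card_le_one] at hv
  exact hv e (mem_outArcs.2 ⟨h1, he⟩) e' (mem_outArcs.2 ⟨h2, he'⟩)

theorem IsLabels.deg_pos {lab : Labels n} (h : IsLabels G s lab) {e : Fin m}
    (he : 0 < s.flow (.inl e)) : 0 < lab.deg (G.src e) := by
  rw [h.deg, Finset.card_pos]
  exact ⟨e, mem_outArcs.2 ⟨rfl, he⟩⟩

/-- The present arcs into `v` except for `a'`. -/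
noncomputable def inList (G : Network n m) (s : St n m) (a' : Fin m) (v : Fin n) :
    List (ExtArc n m) :=
  extArcs.filter fun a => decide (G.head a = v ∧ 0 < s.flow a ∧ a ≠ .inl a')

theorem mem_inList {a' : Fin m} {v : Fin n} {a : ExtArc n m} :
    a ∈ inList G s a' v ↔ G.head a = v ∧ 0 < s.flow a ∧ a ≠ .inl a' := by
  simp [inList, mem_extArcs]

theorem nodup_extArcs : (extArcs : List (ExtArc n m)).Nodup := by
  refine List.nodup_append.2 ⟨(List.nodup_finRange m).map Sum.inl_injective,
    (List.nodup_finRange n).map Sum.inr_injective, ?_⟩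
  rintro a ha c hc rfl
  obtain ⟨e, _, rfl⟩ := List.mem_map.1 ha
  simp at hc

/-- Heads of the backward paths on the stack. -/
def heads (st : List (List (Fin m))) : List (Fin m) := st.filterMap List.head?

theorem Runs.expand {a' : Fin m} {v : Fin n} {p : List (Fin m)} {c : SearchState n m} :
    Runs (expand G a' v p c) (2 * (n + m)) s fun c' s' => s' = s ∧
      c'.mark = Function.update c.mark v true ∧
      (∀ a, a ∈ c'.explored ↔ a ∈ c.explored ∨ a ∈ inList G s a' v) ∧
      (∀ q, q ∈ c'.stack ↔ q ∈ c.stack ∨ ∃ e, .inl e ∈ inList G s a' v ∧ q = e :: p) ∧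
      ((heads c.stack).Nodup → (∀ e ∈ heads c.stack, .inl e ∉ inList G s a' v) →
        (heads c'.stack).Nodup) ∧
      (c.explored.Nodup → (∀ a ∈ c.explored, a ∉ inList G s a' v) → c'.explored.Nodup) := by
  refine (collect_bind (c := n + m)
    (fun a => decide (G.head a = v ∧ 0 < s.flow a ∧ a ≠ .inl a')) (fun _ _ => rfl) ?_).le
    (show _ ≤ _ by rw [length_extArcs]; omega)
  have hl : (inList G s a' v).length ≤ n + m := by
    rw [← length_extArcs]
    exact List.length_filter_le _ _
  have hn : (inList G s a' v).Nodup := nodup_extArcs.filter _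
  refine (forEach (k := 0) (fun l (c' : SearchState n m) s' => s' = s ∧
    c'.mark = Function.update c.mark v true ∧ ∃ d, inList G s a' v = d ++ l ∧
      (∀ a, a ∈ c'.explored ↔ a ∈ c.explored ∨ a ∈ d) ∧
      (∀ q, q ∈ c'.stack ↔ q ∈ c.stack ∨ ∃ e, .inl e ∈ d ∧ q = e :: p) ∧
      ((heads c.stack).Nodup → (∀ e ∈ heads c.stack, .inl e ∉ inList G s a' v) →
        (heads c'.stack).Nodup ∧ ∀ e, e ∈ heads c'.stack ↔ e ∈ heads c.stack ∨ .inl e ∈ d) ∧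
      (c.explored.Nodup → (∀ a ∈ c.explored, a ∉ inList G s a' v) → c'.explored.Nodup))
    ?_ (inList G s a' v) { c with mark := Function.update c.mark v true } s
    ⟨rfl, rfl, [], rfl, by simp, by simp, fun h _ => ⟨h, by simp⟩, fun h _ => h⟩).mono (by omega) ?_
  · rintro a l c' s ⟨rfl, h1, d, h2, h3, h4, h5, h6⟩
    rw [h2] at hn
    have had : a ∉ d := fun h => (List.nodup_append.1 hn).2.2 a h a (by simp) rfl
    refine pure ⟨rfl, ?_, d ++ [a], by simp [h2], ?_, ?_, ?_, ?_⟩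
    · rcases a with e | u <;> exact h1
    · rcases a with e | u <;> intro c₁ <;> simp only [List.mem_cons, h3, List.mem_append,
        List.not_mem_nil, or_false] <;> rw [or_comm, or_assoc]
    · rcases a with e | u
      · intro q
        simp only [List.mem_cons, h4, List.mem_append, List.not_mem_nil, or_false]
        constructor
        · rintro (rfl | h | ⟨e', h, rfl⟩)
          · exact .inr ⟨e, .inr rfl, rfl⟩
          · exact .inl h
          · exact .inr ⟨e', .inl h, rfl⟩
        · rintro (h | ⟨e', h | h, rfl⟩)
          · exact .inr (.inl h)
          · exact .inr (.inr ⟨e', h, rfl⟩)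
          · simp at h; subst h; exact .inl rfl
      · intro q
        simp [h4]
    · intro h6 h7
      obtain ⟨h8, h9⟩ := h5 h6 h7
      rcases a with e | u
      · have h10 : heads ((e :: p) :: c'.stack) = e :: heads c'.stack := rfl
        simp only [h10, List.nodup_cons, h9, List.mem_cons, List.mem_append, List.not_mem_nil,
          or_false]
        refine ⟨⟨?_, h8⟩, ?_⟩
        · rintro (h | h)
          · exact h7 e h (by simp [h2])
          · exact had h
        · intro e'
          simp only [Sum.inl.injEq]
          tauto
      · refine ⟨h8, fun e => ?_⟩
        simp [h9]
    · intro h7 h8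
      have h9 : (a :: c'.explored).Nodup := by
        refine List.nodup_cons.2 ⟨fun h9 => ?_, h6 h7 h8⟩
        rcases (h3 a).1 h9 with h9 | h9
        · exact h8 a h9 (by simp [h2])
        · exact had h9
      rcases a with e | u <;> exact h9
  · rintro c' s ⟨rfl, h1, d, h2, h3, h4, h5, h6⟩
    rw [List.append_nil] at h2
    subst h2
    exact ⟨rfl, h1, h3, h4, fun h h' => (h5 h h').1, h6⟩

/-- A singular digraph rooted at `w`, for the junction vertex `w` reached along `a'`. -/
structure IsSingular (G : Network n m) (s : St n m) (lab : Labels n) (w : Fin n) (a' : Fin m)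
    (mark : Fin n → Bool) : Prop where
  root : mark w = true
  deg_le : ∀ v, mark v = true → lab.deg v ≤ 1
  src_mark : ∀ e, mark (G.dst e) = true → 0 < s.flow (.inl e) → e ≠ a' → mark (G.src e) = true
  out : ∀ v, mark v = true → v ≠ w →
    ∃ e, G.src e = v ∧ 0 < s.flow (.inl e) ∧ e ≠ a' ∧ mark (G.dst e) = true

/-- A vertex `w` without outgoing arcs, and a present arc `a'` that enters it. -/
structure IsJunction (G : Network n m) (s : St n m) (lab : Labels n) (w : Fin n) (a' : Fin m) :
    Prop where
  deg : lab.deg w = 0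
  dst : G.dst a' = w
  pos : 0 < s.flow (.inl a')

/-- Invariant of the backward search. -/
structure SearchInv (G : Network n m) (s : St n m) (lab : Labels n) (w : Fin n) (a' : Fin m)
    (c : SearchState n m) : Prop where
  root : c.mark w = true
  deg_le : ∀ v, c.mark v = true → lab.deg v ≤ 1
  explored : ∀ a, a ∈ c.explored ↔ c.mark (G.head a) = true ∧ 0 < s.flow a ∧ a ≠ .inl a'
  src_mark : ∀ e, .inl e ∈ c.explored → c.mark (G.src e) = true ∨ e ∈ heads c.stack
  -- The outgoing arc by which a marked vertex was found is no longer on the stack. As out-degrees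
  -- are at most one, this excludes that a vertex is found twice.
  out : ∀ v, c.mark v = true → v ≠ w →
    ∃ e, G.src e = v ∧ .inl e ∈ c.explored ∧ e ∉ heads c.stack
  stack : ∀ q ∈ c.stack, ∃ e p, q = e :: p ∧ G.IsWalk (G.src e) w (e :: p) ∧
    ∀ e' ∈ e :: p, .inl e' ∈ c.explored
  nodup : (heads c.stack).Nodup
  explored_nodup : c.explored.Nodup

/-- The nonfunnel vertex found by the backward search, and the path to the junction. -/
structure IsBackPath (G : Network n m) (s : St n m) (lab : Labels n) (w : Fin n) (a' : Fin m)
    (v : Fin n) (p : List (Fin m)) : Prop where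
  ne_nil : p ≠ []
  walk : G.IsWalk v w p
  deg : 2 ≤ lab.deg v
  pos : ∀ e ∈ p, 0 < s.flow (.inl e)
  ne : ∀ e ∈ p, e ≠ a'
  singular : ∀ e ∈ p, lab.branching (G.dst e) = false

/-- The search keeps no test for visited vertices. None is needed: the marked vertices other than
`w` have exactly one present outgoing arc, so the explored arcs form an in-tree and the vertex taken
from the stack is always new. -/
theorem SearchInv.expand {lab : Labels n} {w : Fin n} {a' : Fin m} {c c' : SearchState n m}
    {e : Fin m} {p : List (Fin m)} {st : List (List (Fin m))}
    (hL : IsLabels G s lab) (hw : IsJunction G s lab w a')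
    (h : SearchInv G s lab w a' c) (hst : c.stack = (e :: p) :: st)
    (hd : ¬ 2 ≤ lab.deg (G.src e)) (h1 : c'.mark = Function.update c.mark (G.src e) true)
    (h2 : ∀ a, a ∈ c'.explored ↔ a ∈ c.explored ∨ a ∈ inList G s a' (G.src e))
    (h3 : ∀ q, q ∈ c'.stack ↔ q ∈ st ∨ ∃ e', .inl e' ∈ inList G s a' (G.src e) ∧
      q = e' :: e :: p)
    (h4 : (heads st).Nodup → (∀ e' ∈ heads st, .inl e' ∉ inList G s a' (G.src e)) →
        (heads c'.stack).Nodup)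
    (h5 : c.explored.Nodup → (∀ a ∈ c.explored, a ∉ inList G s a' (G.src e)) →
        c'.explored.Nodup) :
    SearchInv G s lab w a' c' ∧ c.mark (G.src e) = false := by
  have hh : heads c.stack = e :: heads st := by rw [hst]; rfl
  have hn := h.nodup
  rw [hh, List.nodup_cons] at hn
  have hmem : ∀ e' ∈ heads c.stack, .inl e' ∈ c.explored := by
    intro e' he'
    obtain ⟨q, hq, h5⟩ := List.mem_filterMap.1 he'
    obtain ⟨e'', p', rfl, _, h6⟩ := h.stack q hq
    obtain rfl : e'' = e' := by simpa using h5
    exact h6 _ (by simp)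
  have he := (h.explored _).1 (hmem e (by simp [hh]))
  have hew : G.src e ≠ w := fun h5 => by
    have := hL.deg_pos he.2.1
    rw [h5, hw.deg] at this
    omega
  -- If this vertex were marked, its recorded outgoing arc would be `e` by the degree bound, but `e`
  -- is still on the stack.
  have hmark : c.mark (G.src e) = false := by
    by_contra hm
    obtain ⟨e', h5, h6, h7⟩ := h.out _ (by simpa using hm) hew
    have := hL.src_inj (by omega) he.2.1 ((h.explored _).1 h6).2.1 rfl h5
    subst this
    exact h7 (by simp [hh])
  have hmark' : ∀ v, c'.mark v = true ↔ c.mark v = true ∨ v = G.src e := by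
    intro v
    rw [h1]
    by_cases hv : v = G.src e
    · simp [hv]
    · simp [hv]
  have hheads : ∀ e', e' ∈ heads c'.stack ↔
      e' ∈ heads st ∨ .inl e' ∈ inList G s a' (G.src e) := by
    intro e'
    simp only [heads, List.mem_filterMap, h3]
    constructor
    · rintro ⟨q, hq | ⟨e'', h5, rfl⟩, h6⟩
      · exact .inl ⟨q, hq, h6⟩
      · obtain rfl : e'' = e' := by simpa using h6
        exact .inr h5
    · rintro (⟨q, hq, h6⟩ | h5)
      · exact ⟨q, .inl hq, h6⟩
      · exact ⟨_, .inr ⟨e', h5, rfl⟩, rfl⟩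
  have hdisj : ∀ a ∈ c.explored, a ∉ inList G s a' (G.src e) := by
    intro a h5 h6
    have h7 := ((h.explored a).1 h5).1
    rw [(mem_inList.1 h6).1, hmark] at h7
    simp at h7
  refine ⟨⟨(hmark' w).2 (.inl h.root), ?_, ?_, ?_, ?_, ?_, ?_, h5 h.explored_nodup hdisj⟩, hmark⟩
  · intro v hv
    rcases (hmark' v).1 hv with hv | rfl
    · exact h.deg_le v hv
    · omega
  · intro a
    rw [h2, h.explored, mem_inList, hmark']
    tauto
  · intro e' he'
    rw [hmark', hheads]
    rcases (h2 _).1 he' with h5 | h5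
    · rcases h.src_mark e' h5 with h6 | h6
      · exact .inl (.inl h6)
      · rw [hh] at h6
        rcases List.mem_cons.1 h6 with rfl | h6
        · exact .inl (.inr rfl)
        · exact .inr (.inl h6)
    · exact .inr (.inr h5)
  · intro v hv hvw
    rcases (hmark' v).1 hv with hv | rfl
    · obtain ⟨e', h5, h6, h7⟩ := h.out v hv hvw
      refine ⟨e', h5, (h2 _).2 (.inl h6), fun h8 => ?_⟩
      rcases (hheads e').1 h8 with h8 | h8
      · exact h7 (by simp [hh, h8])
      · exact hdisj _ h6 h8
    · have h5 := hmem e (by simp [hh])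
      refine ⟨e, rfl, (h2 _).2 (.inl h5), fun h8 => ?_⟩
      rcases (hheads e).1 h8 with h8 | h8
      · exact hn.1 h8
      · exact hdisj _ h5 h8
  · intro q hq
    rcases (h3 q).1 hq with h5 | ⟨e', h5, rfl⟩
    · obtain ⟨e', p', h6, h7, h8⟩ := h.stack q (by simp [hst, h5])
      exact ⟨e', p', h6, h7, fun a ha => (h2 _).2 (.inl (h8 a ha))⟩
    · obtain ⟨e'', p', h6, h7, h8⟩ := h.stack (e :: p) (by simp [hst])
      obtain ⟨rfl, rfl⟩ := List.cons.inj h6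
      refine ⟨e', e :: p, rfl, ⟨rfl, ?_⟩, fun a ha => (h2 _).2 ?_⟩
      · rw [show G.dst e' = G.src e from (mem_inList.1 h5).1]
        exact h7
      · rcases List.mem_cons.1 ha with rfl | ha
        · exact .inr h5
        · exact .inl (h8 a ha)
  · exact h4 hn.2 fun e' he' => hdisj _ (hmem e' (by simp [hh, he']))

/-- The number of unmarked vertices decreases in every continuing round, because only unmarked
vertices are expanded. -/
theorem Runs.backwardSearch {lab : Labels n} {w : Fin n} {a' : Fin m} (hL : IsLabels G s lab)
    (hw : IsJunction G s lab w a') :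
    Runs (backwardSearch G lab w a') (2 * (n + m) + (n + 1) * (2 * (n + m) + 1)) s fun r s' =>
      s' = s ∧ match r with
      | .path p => ∃ v, IsBackPath G s lab w a' v p
      | .digraph mark E => IsSingular G s lab w a' mark ∧
        E.length ≤ n + m ∧ ∀ a, a ∈ E ↔ mark (G.head a) = true ∧ 0 < s.flow a ∧ a ≠ .inl a' := by
  refine bind expand (c₂ := (n + 1) * (2 * (n + m) + 1)) ?_ (by omega)
  rintro c s ⟨rfl, h1, h2, h3, h4, h4'⟩
  have hmark' : ∀ v, c.mark v = true ↔ v = w := by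
    intro v
    rw [h1]
    by_cases hv : v = w
    · simp [hv]
    · simp [hv]
  refine loop (fun c s' => s' = s ∧ SearchInv G s lab w a' c)
    (fun c _ => (Finset.univ.filter fun v => c.mark v = false).card) n ?_ ⟨rfl, ?_⟩
    ((Finset.card_le_univ _).trans (by simp))
  · rintro c s ⟨rfl, hI⟩
    rcases hst : c.stack with _ | ⟨_ | ⟨e, p⟩, st⟩
    · refine pure ⟨rfl, ⟨hI.root, hI.deg_le, ?_, ?_⟩, ?_, hI.explored⟩
      · intro e h1 h2 h3
        have := hI.src_mark e ((hI.explored _).2 ⟨h1, h2, by simpa using h3⟩)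
        simpa [hst, heads] using this
      · intro v h1 h2
        obtain ⟨e, h3, h4, _⟩ := hI.out v h1 h2
        have h5 := (hI.explored _).1 h4
        exact ⟨e, h3, h5.2.1, by simpa using h5.2.2, h5.1⟩
      · simpa [add_comm] using hI.explored_nodup.length_le_card
    · obtain ⟨e, p, h, _⟩ := hI.stack [] (by simp [hst])
      simp at h
    · dsimp only
      split_ifs with hd
      · obtain ⟨e', p', h1, h2, h3⟩ := hI.stack (e :: p) (by simp [hst])
        obtain ⟨rfl, rfl⟩ := List.cons.inj h1
        refine pure ⟨rfl, G.src e, by simp, h2, hd, fun a ha => ((hI.explored _).1 (h3 a ha)).2.1,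
          fun a ha => by simpa using ((hI.explored _).1 (h3 a ha)).2.2, fun a ha => ?_⟩
        -- The marked vertices have out-degree at most one and are closed under following present
        -- arcs: `w` has none, and the only arc leaving another marked vertex is explored, so its
        -- head is marked.
        refine hL.not_branching (fun v => c.mark v = true) hI.deg_le (fun e he hm => ?_) _
          ((hI.explored _).1 (h3 a ha)).1
        have hne : G.src e ≠ w := fun h => by
          have := hL.deg_pos he
          rw [h, hw.deg] at this
          omega
        obtain ⟨e', h4, h5, _⟩ := hI.out _ hm hne
        have h5 := (hI.explored _).1 h5
        rw [hL.src_inj (hI.deg_le _ hm) he h5.2.1 rfl h4]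
        exact h5.1
      · refine bind expand (c₂ := 0) ?_ le_rfl
        rintro c' s ⟨rfl, h1, h2, h3, h4, h4'⟩
        obtain ⟨h5, h6⟩ := hI.expand hL hw hst hd h1 h2 h3 h4 h4'
        refine pure ⟨⟨rfl, h5⟩, Finset.card_lt_card ?_⟩
        refine (Finset.ssubset_iff_of_subset fun v hv => ?_).2 ⟨G.src e, by simpa using h6, ?_⟩
        · simp only [Finset.mem_filter_univ, h1] at hv ⊢
          by_cases hv' : v = G.src e
          · rw [hv']; exact h6
          · simpa [hv'] using hv
        · simp [h1]
  · refine ⟨(hmark' w).2 rfl, ?_, ?_, ?_, ?_, ?_, h4 List.nodup_nil (by simp [heads]),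
      h4' List.nodup_nil (by simp)⟩
    · intro v hv
      rw [(hmark' v).1 hv, hw.deg]
      omega
    · intro a
      rw [h2, hmark', mem_inList]
      simp
    · intro e he
      right
      refine List.mem_filterMap.2 ⟨[e], (h3 _).2 (.inr ⟨e, ?_, rfl⟩), rfl⟩
      simpa using (h2 _).1 he
    · intro v hv hv'
      exact absurd ((hmark' v).1 hv) hv'
    · intro q hq
      rcases (h3 q).1 hq with h | ⟨e, he, rfl⟩
      · simp at h
      · refine ⟨e, [], rfl, ⟨rfl, (mem_inList.1 he).1⟩, ?_⟩
        rintro e' he'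
        rw [List.mem_singleton] at he'
        subst he'
        exact (h2 _).2 (.inr he)

end Transship

namespace Transship

variable {n m : ℕ} {G : Network n m} {b : Fin n → ℝ} {s : St n m}

/-! ## Alternating cycles -/

/-- The vertex that is reached by a step. -/
def WalkStep.finish (G : Network n m) (w : WalkStep n m) : Fin n :=
  if w.forward then G.dst w.arc else G.src w.arc

/-- The steps in the list `C`, most recent step first, form an alternating walk from `v` to `u`. -/
def AltWalk (G : Network n m) : Fin n → Fin n → List (WalkStep n m) → Prop
  | u, v, [] => u = v
  | u, v, w :: l => w.finish G = u ∧ (w.start = if w.forward then G.src w.arc else G.dst w.arc) ∧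
    AltWalk G w.start v l

theorem AltWalk.append_left : ∀ {C : List (WalkStep n m)} {w : WalkStep n m}
    {l : List (WalkStep n m)} {u v : Fin n}, AltWalk G u v (C ++ w :: l) →
    AltWalk G u w.start (C ++ [w])
  | [], _, _, _, _, h => ⟨h.1, h.2.1, rfl⟩
  | _ :: _, _, _, _, _, h => ⟨h.1, h.2.1, h.2.2.append_left⟩

theorem AltWalk.finish_mem : ∀ {C : List (WalkStep n m)} {u v : Fin n}, AltWalk G u v C →
    ∀ w ∈ C, w.finish G = u ∨ w.finish G ∈ C.map WalkStep.start
  | [], _, _, _, w, hw => by simp at hw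
  | x :: C, u, v, h, w, hw => by
    rcases List.mem_cons.1 hw with rfl | hw
    · exact .inl h.1
    · rcases h.2.2.finish_mem w hw with h1 | h1
      · exact .inr (by simp [h1])
      · exact .inr (List.mem_cons_of_mem _ h1)

theorem AltWalk.isWalk : ∀ {C : List (WalkStep n m)} {u v : Fin n}, AltWalk G u v C →
    (∀ w ∈ C, w.forward = true) → G.IsWalk v u (C.map WalkStep.arc).reverse
  | [], _, _, h, _ => by cases h; rfl
  | w :: C, u, v, h, hf => by
    have hw := hf w (by simp)
    have h1 := h.2.2.isWalk fun w' h' => hf w' (by simp [h'])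
    rw [List.map_cons, List.reverse_cons]
    refine h1.append ⟨?_, ?_⟩
    · rw [h.2.1, if_pos hw]
    · have := h.1
      rwa [WalkStep.finish, if_pos hw] at this

theorem AltWalk.start_eq : ∀ {C : List (WalkStep n m)} {u v : Fin n}, AltWalk G u v C →
    ∀ w ∈ C, w.start = if w.forward then G.src w.arc else G.dst w.arc
  | x :: C, u, v, h, w, hw => by
    rcases List.mem_cons.1 hw with rfl | hw
    · exact h.2.1
    · exact h.2.2.start_eq w hw

/-- The sign of a step. -/
def WalkStep.sign (w : WalkStep n m) : ℝ := if w.forward then 1 else -1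

theorem AltWalk.sum_inc (x : Fin n) : ∀ {C : List (WalkStep n m)} {u v : Fin n}, AltWalk G u v C →
    (C.map fun w => w.sign * G.inc x w.arc).sum =
      (if u = x then 1 else 0) - (if v = x then 1 else 0)
  | [], _, _, h => by cases h; simp
  | w :: C, u, v, h => by
    rw [List.map_cons, List.sum_cons, h.2.2.sum_inc, h.2.1, ← h.1, WalkStep.sign, WalkStep.finish,
      Network.inc]
    split_ifs <;> ring

/-- Singularity of the backward arcs protects the lower bound; a backward step ensures that the
augmentation is the minimum of a nonempty set; distinct arcs ensure that each flow value is changed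
once. -/
structure IsNiceCycle (G : Network n m) (s : St n m) (lab : Labels n) (C : List (WalkStep n m)) :
    Prop where
  closed : ∃ u, AltWalk G u u C
  nodup : (C.map WalkStep.arc).Nodup
  pos : ∀ w ∈ C, 0 < s.flow (.inl w.arc)
  singular : ∀ w ∈ C, w.forward = false → lab.branching (G.dst w.arc) = false
  backward : ∃ w ∈ C, w.forward = false
  length_le : C.length ≤ n

structure WalkInv (G : Network n m) (s : St n m) (lab : Labels n) (c : WalkState n m) :
    Prop where
  walk : ∃ v, AltWalk G c.cur v c.walk
  starts : (c.cur :: c.walk.map WalkStep.start).Nodup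
  nodup : (c.walk.map WalkStep.arc).Nodup
  pos : ∀ w ∈ c.walk, 0 < s.flow (.inl w.arc)
  singular : ∀ w ∈ c.walk, w.forward = false → lab.branching (G.dst w.arc) = false

theorem WalkInv.length_lt {lab : Labels n} {c : WalkState n m} (h : WalkInv G s lab c) :
    c.walk.length < n := by
  have h1 := h.starts.length_le_card
  rw [List.length_cons, List.length_map, Fintype.card_fin] at h1
  exact h1

theorem Runs.closeCycle (u : Fin n) : ∀ l : List (WalkStep n m),
    Runs (closeCycle u l) l.length s fun r s' => s' = s ∧ match r with
      | none => ∀ w ∈ l, w.start ≠ u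
      | some C => ∃ C' w l', C = C' ++ [w] ∧ w.start = u ∧ l = C' ++ w :: l'
  | [] => pure ⟨rfl, by simp⟩
  | w :: l => by
    refine tick_bind (c := l.length) ?_
    split_ifs with h
    · exact pure ⟨rfl, [], w, l, rfl, h, rfl⟩
    · refine bind (closeCycle u l) (c₂ := 0) ?_ le_rfl
      rintro (_ | C) s ⟨rfl, h1⟩
      · refine pure ⟨rfl, ?_⟩
        simpa using ⟨h, h1⟩
      · obtain ⟨C', w', l', rfl, h2, rfl⟩ := h1
        exact pure ⟨rfl, w :: C', w', l', rfl, h2, rfl⟩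

/-- A step that used `e` earlier has the current vertex as one of its ends. It did not start there,
since starts are distinct from the current vertex, so it finished there. Then it is the last step,
which `hl` excludes, or a later step starts at the current vertex. -/
theorem WalkInv.notMem {lab : Labels n} {c : WalkState n m} {e : Fin m} {fwd : Bool}
    (h : WalkInv G s lab c)
    (hc : c.cur = if fwd then G.src e else G.dst e)
    (hl : ∀ w ∈ c.walk.head?, w.arc ≠ e) : e ∉ c.walk.map WalkStep.arc := by
  intro he
  obtain ⟨w, hw, rfl⟩ := List.mem_map.1 he
  obtain ⟨v, hv⟩ := h.walk
  have h1 := hv.start_eq w hw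
  have hst := h.starts
  have h2 : w.start ≠ c.cur := fun h2 =>
    (List.nodup_cons.1 hst).1 (h2 ▸ List.mem_map_of_mem hw)
  have h3 : w.finish G = c.cur := by
    rw [WalkStep.finish, hc]
    rw [h1, hc] at h2
    cases hf : w.forward <;> cases fwd <;> simp_all
  rcases hwalk : c.walk with _ | ⟨x, l⟩
  · simp [hwalk] at hw
  · rw [hwalk] at hv hw hst
    rcases List.mem_cons.1 hw with rfl | hw
    · exact hl w (by simp [hwalk]) rfl
    · have h4 := hv.2.2.finish_mem w hw
      rw [h3] at h4
      refine (List.nodup_cons.1 hst).1 ?_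
      rcases h4 with h4 | h4
      · simp [h4]
      · exact List.mem_cons_of_mem _ h4

/-- If the new vertex was left before, the steps since then close up and inherit all properties of
the walk. -/
theorem Runs.extend (hG : G.Acyclic) {lab : Labels n} {c : WalkState n m} {e : Fin m} {fwd : Bool}
    (h : WalkInv G s lab c) (hc : c.cur = if fwd then G.src e else G.dst e)
    (hl : ∀ w ∈ c.walk.head?, w.arc ≠ e) (he : 0 < s.flow (.inl e))
    (hs : fwd = false → lab.branching (G.dst e) = false) :
    Runs (extend G c e fwd) n s fun r s' => s' = s ∧ match r with
      | .inl c' => WalkInv G s lab c' ∧ c'.walk = ⟨c.cur, e, fwd⟩ :: c.walk ∧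
        c'.cur = if fwd then G.dst e else G.src e
      | .inr F => ∃ C, F = .cycle C ∧ IsNiceCycle G s lab C := by
  have hlen := h.length_lt
  have hn := h.notMem hc hl
  obtain ⟨v, hv⟩ := h.walk
  set u := if fwd then G.dst e else G.src e with hu
  have hw : AltWalk G u v (⟨c.cur, e, fwd⟩ :: c.walk) := ⟨rfl, hc, hv⟩
  have hnod : ((⟨c.cur, e, fwd⟩ :: c.walk : List (WalkStep n m)).map WalkStep.arc).Nodup :=
    List.nodup_cons.2 ⟨hn, h.nodup⟩
  have hpos : ∀ w ∈ (⟨c.cur, e, fwd⟩ :: c.walk : List (WalkStep n m)),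
      0 < s.flow (.inl w.arc) := by
    intro w hw
    rcases List.mem_cons.1 hw with rfl | hw
    · exact he
    · exact h.pos w hw
  have hsing : ∀ w ∈ (⟨c.cur, e, fwd⟩ :: c.walk : List (WalkStep n m)),
      w.forward = false → lab.branching (G.dst w.arc) = false := by
    intro w hw
    rcases List.mem_cons.1 hw with rfl | hw
    · exact hs
    · exact h.singular w hw
  refine bind (closeCycle u (⟨c.cur, e, fwd⟩ :: c.walk)) (c₂ := 0) ?_
    (by rw [List.length_cons]; omega)
  rintro (_ | C) s ⟨rfl, h1⟩
  · refine pure ⟨rfl, ⟨⟨v, hw⟩, ?_, hnod, hpos, hsing⟩, rfl, rfl⟩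
    refine List.nodup_cons.2 ⟨fun h2 => ?_, h.starts⟩
    obtain ⟨w, hw, h3⟩ := List.mem_map.1 h2
    exact h1 w hw h3
  · obtain ⟨C', w, l, rfl, h2, h3⟩ := h1
    have hsub : ∀ x ∈ C' ++ [w], x ∈ (⟨c.cur, e, fwd⟩ :: c.walk : List (WalkStep n m)) := by
      intro x hx
      rw [h3]
      simp only [List.mem_append, List.mem_cons, List.not_mem_nil, or_false] at hx ⊢
      tauto
    rw [h3] at hw
    have hcl := hw.append_left
    rw [h2] at hcl
    have hsl : List.Sublist (C' ++ [w]) (⟨c.cur, e, fwd⟩ :: c.walk : List (WalkStep n m)) := by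
      rw [h3]
      exact List.Sublist.append_left (by simp) _
    refine pure ⟨rfl, _, rfl, ⟨u, hcl⟩, hnod.sublist (hsl.map _), fun x hx => hpos x (hsub x hx),
      fun x hx => hsing x (hsub x hx), ?_, ?_⟩
    -- A closed walk with forward steps only would be a directed cycle.
    · by_contra hb
      push Not at hb
      have := hG _ _ (hcl.isWalk fun x hx => by simpa using hb x hx)
      simp at this
    · refine hsl.length_le.trans ?_
      rw [List.length_cons]
      omega

/-- What the search for a nice cycle finds. -/
def FoundSpec (G : Network n m) (s : St n m) (lab : Labels n) : Found n m → Prop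
  | .cycle C => IsNiceCycle G s lab C
  | .digraph w a' mark E => IsJunction G s lab w a' ∧ IsSingular G s lab w a' mark ∧
    E.length ≤ n + m ∧ ∀ a, a ∈ E ↔ mark (G.head a) = true ∧ 0 < s.flow a ∧ a ≠ .inl a'

theorem Runs.followBack (hG : G.Acyclic) {lab : Labels n} {c : WalkState n m} {v : Fin n}
    {a' : Fin m} {p : List (Fin m)} (h : WalkInv G s lab c)
    (hp : IsBackPath G s lab c.cur a' v p) (hl : ∀ w ∈ c.walk.head?, w.arc = a') :
    Runs (do
      let p' ← Transship.forEach (fun q e => return e :: q) p []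
      Transship.forEach (fun (r : WalkState n m ⊕ Found n m) e =>
          match r with
          | .inl c => Transship.extend G c e false
          | .inr C => return .inr C) p' (.inl c)) (n + n * (n + 1)) s fun r s' => s' = s ∧
      match r with
      | .inl c' => WalkInv G s lab c' ∧ c.walk.length < c'.walk.length ∧ 2 ≤ lab.deg c'.cur
      | .inr F => FoundSpec G s lab F := by
  have hlen := (hp.walk.length_lt hG).le
  have hnod := hp.walk.arcs_nodup hG
  have h0 := forEach (k := 0) (body := fun (q : List (Fin m)) (e : Fin m) =>
    (Pure.pure (e :: q) : Alg n m _)) (fun l q s' => s' = s ∧ p.reverse = l.reverse ++ q) ?_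
    p [] s ⟨rfl, by simp⟩
  · refine bind h0 (c₂ := n * (n + 1)) ?_ (by omega)
    rintro _ s ⟨rfl, rfl⟩
    have h1 := forEach (k := n) (body := fun (r : WalkState n m ⊕ Found n m) e =>
          match r with
          | .inl c => Transship.extend G c e false
          | .inr C => Pure.pure (.inr C))
      (fun l r s' => s' = s ∧ match r with
        | .inl c' => WalkInv G s lab c' ∧ G.IsWalk v c'.cur l.reverse ∧ (∀ e ∈ l, e ∈ p) ∧
          l.Nodup ∧ (∀ w ∈ c'.walk.head?, w.arc ∉ l) ∧
          -- Records progress: the walk is strictly longer unless no arc of the nonempty path has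
          -- been processed yet.
          (l = p.reverse ∧ c.walk.length = c'.walk.length ∨ c.walk.length < c'.walk.length)
        | .inr F => FoundSpec G s lab F) ?_ p.reverse (.inl c) s
      ⟨rfl, h, by simpa using hp.walk, by simp, by simpa using hnod, ?_, .inl ⟨rfl, rfl⟩⟩
    · refine h1.mono ?_ ?_
      · rw [List.length_reverse]
        exact Nat.mul_le_mul_right _ hlen
      · rintro (c' | F) s ⟨rfl, h2⟩
        · obtain ⟨h3, h4, -, -, -, h5⟩ := h2
          refine ⟨rfl, h3, ?_, ?_⟩
          · rcases h5 with h5 | h5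
            · exact absurd h5.1.symm (by simpa using hp.ne_nil)
            · exact h5
          · have : v = c'.cur := h4
            exact this ▸ hp.deg
        · exact ⟨rfl, h2⟩
    · rintro e l (c' | F) s ⟨rfl, h2⟩
      · obtain ⟨h3, h4, h5, h6, h7, h8⟩ := h2
        rw [List.reverse_cons] at h4
        obtain ⟨x, h9, h10, h11⟩ := h4.split
        have hep := h5 e (by simp)
        refine (extend hG h3 (fwd := false) (by simpa using h11.symm) (fun w hw he => ?_)
          (hp.pos e hep) fun _ => hp.singular e hep).mono le_rfl ?_
        · exact h7 w hw (by simp [he])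
        · rintro (c'' | F) s ⟨rfl, h12⟩
          · obtain ⟨h13, h14, h15⟩ := h12
            refine ⟨rfl, h13, ?_, fun a ha => h5 a (by simp [ha]), h6.of_cons, ?_, ?_⟩
            · rw [h15]
              simpa [h10] using h9
            · rw [h14]
              simpa using (List.nodup_cons.1 h6).1
            · right
              rw [h14, List.length_cons]
              rcases h8 with h8 | h8 <;> omega
          · obtain ⟨C, rfl, h13⟩ := h12
            exact ⟨rfl, h13⟩
      · exact pure ⟨rfl, h2⟩
    · intro w hw hm
      rw [hl w hw] at hm
      exact hp.ne a' (by simpa using hm) rfl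
  · rintro e l q s ⟨rfl, h1⟩
    exact pure ⟨rfl, by simp [h1]⟩

/-- A bound on the number of steps of a round of the search for a nice cycle. -/
def costRound (N : ℕ) : ℕ := 2 * N + (N + 1) * (2 * N + 1) + N + N * (N + 1)

/-- The walk repeats no vertex, so it has fewer than `n` steps, and every continuing round lengthens
it. -/
theorem Runs.findCycle (hG : G.Acyclic) {lab : Labels n} (hL : IsLabels G s lab)
    (χ : ℕ → Bool) {v : Fin n} (hv : 0 < lab.deg v) :
    Runs (findCycle G χ lab v) ((n + 1) * (m + costRound (n + m) + 1)) s fun r s' =>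
      s' = s ∧ FoundSpec G s lab r := by
  -- After a backward path the walk is at a vertex of out-degree at least two, so a second outgoing
  -- arc exists. Hence being stuck means that the last step was forward, into a vertex without
  -- outgoing arcs.
  refine loop (fun c s' => s' = s ∧ WalkInv G s lab c ∧ (c.walk = [] ∧ 0 < lab.deg c.cur ∨
      ∃ w l, c.walk = w :: l ∧ (w.forward = true ∨ 2 ≤ lab.deg c.cur)))
    (fun c _ => n - c.walk.length) n ?_ ⟨rfl, ⟨⟨v, rfl⟩, by simp, by simp, by simp, by simp⟩,
      .inl ⟨rfl, hv⟩⟩ (by omega)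
  rintro c s ⟨rfl, hI, hturn⟩
  have hlen := hI.length_lt
  refine (collect_bind (c := costRound (n + m)) (fun e => decide
      (G.src e = c.cur ∧ 0 < s.flow (.inl e) ∧ c.walk.head?.map WalkStep.arc ≠ some e))
    (fun _ _ => rfl) ?_).le (by rw [length_arcs])
  have hll := List.length_filter_le (fun e => decide
      (G.src e = c.cur ∧ 0 < s.flow (.inl e) ∧ c.walk.head?.map WalkStep.arc ≠ some e)) arcs
  rw [length_arcs] at hll
  rcases hl : arcs.filter fun e => decide (G.src e = c.cur ∧ 0 < s.flow (.inl e) ∧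
      c.walk.head?.map WalkStep.arc ≠ some e) with _ | ⟨e, l⟩
  · have hnone : ∀ e, G.src e = c.cur → 0 < s.flow (.inl e) →
        c.walk.head?.map WalkStep.arc = some e := by
      intro e h1 h2
      by_contra h3
      have := List.filter_eq_nil_iff.1 hl e (mem_arcs e)
      simp only [decide_eq_true_eq] at this
      exact this ⟨h1, h2, h3⟩
    rcases hturn with ⟨h1, h2⟩ | ⟨w, l, h1, h2⟩
    · exfalso
      rw [hL.deg, Finset.card_pos] at h2
      obtain ⟨e, he⟩ := h2
      obtain ⟨h3, h4⟩ := mem_outArcs.1 he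
      have := hnone e h3 h4
      simp [h1] at this
    · have hwm : w ∈ c.walk := by simp [h1]
      have hlast : c.walk.head?.map WalkStep.arc = some w.arc := by simp [h1]
      have hle : lab.deg c.cur ≤ 1 := by
        rw [hL.deg, Finset.card_le_one]
        intro e he e' he'
        obtain ⟨h3, h4⟩ := mem_outArcs.1 he
        obtain ⟨h5, h6⟩ := mem_outArcs.1 he'
        simpa using (hnone e h3 h4).symm.trans (hnone e' h5 h6)
      have hf : w.forward = true := by
        rcases h2 with h2 | h2
        · exact h2
        · omega
      have hdst : G.dst w.arc = c.cur := by
        obtain ⟨v, hv⟩ := hI.walk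
        rw [h1] at hv
        have := hv.1
        rwa [WalkStep.finish, if_pos hf] at this
      have hJ : IsJunction G s lab c.cur w.arc := by
        refine ⟨?_, hdst, hI.pos w hwm⟩
        rw [hL.deg, Finset.card_eq_zero, Finset.eq_empty_iff_forall_notMem]
        intro e he
        obtain ⟨h3, h4⟩ := mem_outArcs.1 he
        have := hnone e h3 h4
        rw [hlast] at this
        obtain rfl : w.arc = e := by simpa using this
        exact G.src_ne_dst hG w.arc (h3.trans hdst.symm)
      rw [hlast]
      refine bind (backwardSearch hL hJ) (c₂ := (n + m) + (n + m) * (n + m + 1)) ?_ ?_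
      · rintro (p | ⟨mark, E⟩) s ⟨rfl, h3⟩
        · obtain ⟨v, h3⟩ := h3
          refine ((followBack hG hI h3 (by simp [h1])).mono ?_ ?_)
          · nlinarith
          · rintro (c' | F) s ⟨rfl, h4⟩
            · obtain ⟨h5, h6, h7⟩ := h4
              have := h5.length_lt
              refine ⟨⟨rfl, h5, .inr ?_⟩, by omega⟩
              rcases hw : c'.walk with _ | ⟨x, l⟩
              · simp [hw] at h6
              · exact ⟨x, l, rfl, .inr h7⟩
            · exact ⟨rfl, h4⟩
        · exact pure ⟨rfl, hJ, h3⟩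
      · unfold costRound
        nlinarith
  · have hmem : ∀ x ∈ e :: l, G.src x = c.cur ∧ 0 < s.flow (.inl x) ∧
        c.walk.head?.map WalkStep.arc ≠ some x := by
      intro x hx
      rw [← hl] at hx
      simpa using (List.mem_filter.1 hx).2
    rw [hl] at hll
    refine (pick_bind (by simp) (c := n) fun x hx => ?_).le
      (by unfold costRound; nlinarith)
    obtain ⟨h1, h2, h3⟩ := hmem x hx
    refine (extend hG hI (fwd := true) (by simpa using h1.symm) ?_ h2 (by simp)).mono le_rfl ?_
    · intro w hw he
      rw [Option.mem_def] at hw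
      simp [hw, he] at h3
    · rintro (c' | F) s ⟨rfl, h4⟩
      · obtain ⟨h5, h6, h7⟩ := h4
        have := h5.length_lt
        have h8 : c'.walk.length = c.walk.length + 1 := by rw [h6, List.length_cons]
        exact ⟨⟨rfl, h5, .inr ⟨_, _, h6, .inl rfl⟩⟩, by omega⟩
      · obtain ⟨C, rfl, h5⟩ := h4
        exact ⟨rfl, h5⟩

end Transship

namespace Transship

variable {n m : ℕ} {G : Network n m} {b : Fin n → ℝ} {x : Fin m → ℝ} {s s₀ : St n m}
  {lab : Labels n}

/-! ## Invariants of the iterations -/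

/-- The (sub-)sink of `t` is at the head of `a`, and its demand is smaller than the flow on `a`. -/
structure Irregular (G : Network n m) (s : St n m) (t : Fin n) (a : ExtArc n m) : Prop where
  pos : 0 < s.dem t
  loc : s.loc t = some (G.head a)
  lt : s.dem t < s.flow a

/-- The invariant at the beginning of an iteration. -/
structure StartInv (G : Network n m) (b : Fin n → ℝ) (x : Fin m → ℝ) (s : St n m) : Prop where
  core : Core G b s
  noReturn : NoReturn G s
  -- Equality would allow a move under either moving rule.
  ne : ∀ t a, 0 < s.dem t → s.loc t = some (G.head a) → s.flow a ≠ s.dem t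
  irr_out : ∀ t a, Irregular G s t a → ∀ e, G.src e = G.head a → s.flow (.inl e) = 0
  irr_unique : ∀ t a t' a', Irregular G s t a → Irregular G s t' a' → G.head a = G.head a' → t = t'
  -- The first alternative holds until `e` becomes singular; the second one is permanent.
  low : ∀ e, x e ≤ s.routed e + s.flow (.inl e) ∨ x e - maxDemand b < s.routed e

/-- The invariant during an iteration that started in the state `s₀` with the labels `lab`. -/
structure MidInv (G : Network n m) (b : Fin n → ℝ) (x : Fin m → ℝ) (s₀ : St n m) (lab : Labels n)
    (s : St n m) : Prop where
  core : Core G b s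
  noReturn : NoReturn G s
  -- Since no arc appears, the degree bounds given by the labels stay valid throughout the
  -- iteration.
  supp : ∀ a, 0 < s.flow a → 0 < s₀.flow a
  irr_out : ∀ t a, lab.branching (G.head a) = false → Irregular G s t a →
    ∀ e, G.src e = G.head a → s.flow (.inl e) = 0
  irr_unique : ∀ t a t' a', lab.branching (G.head a) = false → Irregular G s t a →
    Irregular G s t' a' → G.head a = G.head a' → t = t'
  -- Singular arcs already satisfy the permanent alternative, so decreasing their flow does no harm.
  low : ∀ e, lab.branching (G.dst e) = true ∧ x e ≤ s.routed e + s.flow (.inl e) ∨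
    x e - maxDemand b < s.routed e

theorem abs_le_maxDemand {t : Fin n} (ht : b t < 0) : -b t ≤ maxDemand b := by
  rw [← abs_of_neg ht]
  exact le_ciSup (f := fun t : {t : Fin n // b t < 0} => |b t|) (Set.finite_range _).bddAbove ⟨t, ht⟩

theorem Core.dem_le (h : Core G b s) {t : Fin n} (ht : 0 < s.dem t) :
    b t < 0 ∧ s.dem t ≤ maxDemand b := by
  have h1 := h.sink t
  have h2 : 0 ≤ (s.paths.map fun P => if P.sink = t then P.value else 0).sum := by
    refine List.sum_nonneg fun r hr => ?_
    obtain ⟨P, hP, rfl⟩ := List.mem_map.1 hr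
    split_ifs
    · exact (h.paths_pos P hP).le
    · exact le_rfl
  have h3 : b t < 0 := by
    by_contra hb
    rw [max_eq_right (by linarith)] at h1
    linarith
  rw [max_eq_left (by linarith)] at h1
  exact ⟨h3, by linarith [abs_le_maxDemand h3]⟩

/-- The total flow into a vertex, in the form used by `Core.conserve`. -/
theorem sum_inc_eq (f : Fin m → ℝ) (v : Fin n) : ∑ e, f e * G.inc v e =
    (∑ e with G.dst e = v, f e) - ∑ e with G.src e = v, f e := by
  rw [Finset.sum_filter, Finset.sum_filter, ← Finset.sum_sub_distrib]
  refine Finset.sum_congr rfl fun e _ => ?_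
  rw [Network.inc]
  split_ifs <;> ring

noncomputable def outflow (G : Network n m) (s : St n m) (v : Fin n) : ℝ :=
  ∑ e with G.src e = v, s.flow (.inl e)

noncomputable def demandAt (s : St n m) (v : Fin n) : ℝ :=
  ∑ t, if s.loc t = some v then s.dem t else 0

theorem Core.inflow (h : Core G b s) (v : Fin n) :
    s.flow (.inr v) + ∑ e with G.dst e = v, s.flow (.inl e) = outflow G s v + demandAt s v := by
  have := h.conserve v
  rw [sum_inc_eq] at this
  unfold outflow demandAt
  linarith

theorem Core.outflow_nonneg (h : Core G b s) (v : Fin n) : 0 ≤ outflow G s v :=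
  Finset.sum_nonneg fun _ _ => h.flow_nonneg _

theorem Core.demandAt_nonneg (h : Core G b s) (v : Fin n) : 0 ≤ demandAt s v :=
  Finset.sum_nonneg fun t _ => by split_ifs; exacts [h.dem_nonneg t, le_rfl]

theorem Core.flow_le (h : Core G b s) (a : ExtArc n m) :
    s.flow a ≤ outflow G s (G.head a) + demandAt s (G.head a) := by
  rw [← h.inflow]
  have h1 := fun v : Fin n => Finset.sum_nonneg (s := Finset.univ.filter fun e => G.dst e = v)
    (f := fun e => s.flow (.inl e)) fun e _ => h.flow_nonneg _
  rcases a with e | v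
  · have h2 := Finset.single_le_sum (s := Finset.univ.filter fun e' => G.dst e' = G.dst e)
      (f := fun e => s.flow (.inl e)) (fun e _ => h.flow_nonneg _) (a := e) (by simp)
    have := h.flow_nonneg (.inr (G.dst e))
    show s.flow (.inl e) ≤ s.flow (.inr (G.dst e)) + _
    exact h2.trans (le_add_of_nonneg_left this)
  · exact le_add_of_nonneg_right (h1 v)

theorem outflow_eq_zero {v : Fin n} (h : ∀ e, G.src e = v → s.flow (.inl e) = 0) :
    outflow G s v = 0 := Finset.sum_eq_zero fun e he => h e (by simpa using he)

theorem Core.exists_sink (h : Core G b s) {v : Fin n} (hv : 0 < demandAt s v) :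
    ∃ t, s.loc t = some v ∧ 0 < s.dem t := by
  by_contra hne
  push Not at hne
  refine hv.ne' (Finset.sum_eq_zero fun t _ => ?_)
  split_ifs with h1
  · exact le_antisymm (hne t h1) (h.dem_nonneg t)
  · rfl

theorem demandAt_eq {v t : Fin n} (ht : s.loc t = some v)
    (h : ∀ r, s.loc r = some v → 0 < s.dem r → r = t) (h0 : ∀ r, 0 ≤ s.dem r) :
    demandAt s v = s.dem t := by
  rw [demandAt, Finset.sum_eq_single t, if_pos ht]
  · intro r _ hr
    split_ifs with h1
    · by_contra h2
      exact hr (h r h1 ((h0 r).lt_of_ne' h2))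
    · rfl
  · simp

/-- If no flow leaves the head of the present arc `a`, or if there is a sink at the head, then some
sink at the head has larger demand than the flow on `a`. -/
theorem StartInv.exists_lt (h : StartInv G b x s) {a : ExtArc n m} (ha : 0 < s.flow a)
    (hs : outflow G s (G.head a) = 0 ∨ 0 < demandAt s (G.head a)) :
    ∃ t, s.loc t = some (G.head a) ∧ 0 < s.dem t ∧ s.flow a < s.dem t := by
  have hle := h.core.flow_le a
  have hd : 0 < demandAt s (G.head a) := by
    rcases hs with h1 | h1
    · linarith
    · exact h1
  obtain ⟨t, h1, h2⟩ := h.core.exists_sink hd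
  by_contra hne
  push Not at hne
  -- If no demand exceeded the flow on `a`, all sinks at its head would be irregular. Then there is
  -- just one, no flow leaves, and by conservation the flow on `a` is at most this demand.
  have hirr : ∀ r, s.loc r = some (G.head a) → 0 < s.dem r → Irregular G s r a :=
    fun r h3 h4 => ⟨h4, h3, (hne r h3 h4).lt_of_ne (h.ne r a h4 h3).symm⟩
  have h3 := demandAt_eq h1 (fun r h4 h5 =>
    h.irr_unique _ _ _ _ (hirr r h4 h5) (hirr t h1 h2) rfl) h.core.dem_nonneg
  rw [h3, outflow_eq_zero (h.irr_out t a (hirr t h1 h2))] at hle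
  have := (hirr t h1 h2).lt
  linarith

/-- At the beginning of an iteration, the flow on singular arcs is smaller than the maximum
demand. -/
theorem StartInv.flow_lt (hG : G.Acyclic) (h : StartInv G b x s) (hL : IsLabels G s lab)
    {e : Fin m} (hb : lab.branching (G.dst e) = false) (he : 0 < s.flow (.inl e)) :
    s.flow (.inl e) < maxDemand b := by
  by_contra hlt
  push Not at hlt
  -- A singular arc with flow at least `d_max` enters a vertex that has no demand and has outgoing
  -- flow, on a single arc. That arc is again singular and carries at least as much.
  refine G.not_of_propagates hG (P := fun e => lab.branching (G.dst e) = false ∧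
    0 < s.flow (.inl e) ∧ maxDemand b ≤ s.flow (.inl e)) ?_ e ⟨hb, he, hlt⟩
  rintro e ⟨h1, h2, h3⟩
  by_cases hs : 0 < demandAt s (G.dst e) ∨ outflow G s (G.dst e) = 0
  · obtain ⟨t, h4, h5, h6⟩ := h.exists_lt (a := .inl e) h2 hs.symm
    have := (h.core.dem_le h5).2
    linarith
  · push Not at hs
    have hle := h.core.flow_le (.inl e)
    have hd : lab.deg (G.dst e) ≤ 1 := by
      by_contra hd
      have := hL.branching_of_deg (G.dst e) (by omega)
      simp [h1] at this
    have hout : ∃ e', G.src e' = G.dst e ∧ 0 < s.flow (.inl e') := by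
      by_contra hne
      push Not at hne
      exact hs.2 (outflow_eq_zero fun e' he' => le_antisymm (hne e' he') (h.core.flow_nonneg _))
    obtain ⟨e', h4, h5⟩ := hout
    have h6 : outflow G s (G.dst e) = s.flow (.inl e') := by
      rw [outflow, Finset.sum_eq_single e']
      · intro e'' h7 h8
        by_contra h9
        exact h8 (hL.src_inj hd ((h.core.flow_nonneg _).lt_of_ne' h9) h5 (by simpa using h7) h4)
      · simp [h4]
    refine ⟨e', h4, ?_, h5, ?_⟩
    · by_contra hb
      have := hL.branching_src e' h5 (by simpa using hb)
      rw [h4, h1] at this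
      simp at this
    · change s.flow (.inl e) ≤ outflow G s (G.dst e) + demandAt s (G.dst e) at hle
      linarith

/-- The place where singular arcs switch to the permanent lower bound, by the bound on their flow;
for an absent arc, positivity of `d_max` is enough. -/
theorem StartInv.mid (hG : G.Acyclic) (hb : ∃ t, b t < 0) (h : StartInv G b x s)
    (hL : IsLabels G s lab) : MidInv G b x s lab s where
  core := h.core
  noReturn := h.noReturn
  supp _ h := h
  irr_out t a _ := h.irr_out t a
  irr_unique t a t' a' _ := h.irr_unique t a t' a'
  low e := by
    rcases h.low e with h1 | h1
    · by_cases hbr : lab.branching (G.dst e) = true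
      · exact .inl ⟨hbr, h1⟩
      · right
        rcases (h.core.flow_nonneg (.inl e)).eq_or_lt with h2 | h2
        · obtain ⟨t, ht⟩ := hb
          have := abs_le_maxDemand ht
          linarith
        · have := h.flow_lt hG hL (by simpa using hbr) h2
          linarith
    · exact .inr h1

/-! ### The moving rules at the end of an iteration -/

/-- The moving rule at the end of an iteration allows to move the sink of `t` along `a`. -/
def Candidate (G : Network n m) (lab : Labels n) (s : St n m) (t : Fin n) (a : ExtArc n m) :
    Prop :=
  0 < s.dem t ∧ s.loc t = some (G.head a) ∧
    if lab.singular G a then s.flow a = s.dem t else s.dem t ≤ s.flow a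

theorem Candidate.movable {t : Fin n} {a : ExtArc n m} (h : Candidate G lab s t a) :
    Movable G s t a := by
  obtain ⟨h1, h2, h3⟩ := h
  refine ⟨h1, h2, ?_⟩
  split_ifs at h3
  exacts [h3.ge, h3]

theorem Candidate.eq {t : Fin n} {a : ExtArc n m} (h : Candidate G lab s t a)
    (hb : lab.branching (G.head a) = false) : s.flow a = s.dem t := by
  have := h.2.2
  rwa [if_pos (by simp [Labels.singular, hb])] at this

/-- When no move is possible, no sink is irregular for a non-singular arc, so the restriction to
singular arcs can be dropped. -/
theorem MidInv.start (h : MidInv G b x s₀ lab s) (hn : ∀ t a, ¬ Candidate G lab s t a) :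
    StartInv G b x s := by
  have hlt : ∀ t a, lab.branching (G.head a) = true → ¬ Irregular G s t a := fun t a hb hi =>
    hn t a ⟨hi.pos, hi.loc, by rw [if_neg (by simp [Labels.singular, hb])]; exact hi.lt.le⟩
  refine ⟨h.core, h.noReturn, ?_, ?_, ?_, fun e => (h.low e).imp And.right id⟩
  · intro t a h1 h2 h3
    refine hn t a ⟨h1, h2, ?_⟩
    split_ifs
    exacts [h3, h3.ge]
  · intro t a hi
    rcases hb : lab.branching (G.head a) with _ | _
    · exact h.irr_out t a hb hi
    · exact absurd hi (hlt t a hb)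
  · intro t a t' a' hi
    rcases hb : lab.branching (G.head a) with _ | _
    · exact h.irr_unique t a t' a' hb hi
    · exact absurd hi (hlt t a hb)

theorem moved_loc_dem {t r : Fin n} {a : ExtArc n m} (hr : 0 < (s.moved G t a).dem r) :
    (r ≠ t ∧ (s.moved G t a).dem r = s.dem r ∧ (s.moved G t a).loc r = s.loc r) ∨
    r = t ∧ ∃ e, a = .inl e ∧ (s.moved G t a).dem t = s.dem t ∧
      (s.moved G t a).loc t = some (G.src e) := by
  by_cases hrt : r = t
  · subst hrt
    rcases a with e | u
    · exact .inr ⟨rfl, e, rfl, rfl, by simp [St.moved, St.moveIn]⟩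
    · simp [St.moved, St.clear] at hr
  · left
    rcases a with e | u
    · simp [St.moved, St.moveIn, hrt]
    · simp [St.moved, St.clear, St.routeVia, hrt]

/-- Only the moved sink can become irregular, at its new vertex. If arcs into that vertex are
singular, the arc of the move is singular too and was moved along with equality, so it vanishes. -/
theorem MidInv.moved (hG : G.Acyclic) (hL : IsLabels G s₀ lab) (h : MidInv G b x s₀ lab s)
    {t : Fin n} {a : ExtArc n m} (hc : Candidate G lab s t a) :
    MidInv G b x s₀ lab (s.moved G t a) := by
  have hm := hc.movable
  have hcore := hm.core hG h.core h.noReturn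
  have hle := hm.flow_le
  have hz : ∀ c, s.flow c = 0 → (s.moved G t a).flow c = 0 := fun c hc =>
    le_antisymm (hc ▸ hle c) (hcore.flow_nonneg c)
  -- After the move nothing leaves the new vertex. Before the move it had no irregular sink, because
  -- the arc of the move was leaving it.
  have key : ∀ e, a = .inl e → lab.branching (G.src e) = false →
      (∀ e', G.src e' = G.src e → (s.moved G t a).flow (.inl e') = 0) ∧
      ∀ r c, G.head c = G.src e → ¬ Irregular G s r c := by
    rintro e rfl hb
    have hpos := hm.pos.trans_le hm.le
    have hb' : lab.branching (G.dst e) = false := by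
      by_contra h1
      have := hL.branching_src e (h.supp _ hpos) (by simpa using h1)
      simp [hb] at this
    have hd : lab.deg (G.src e) ≤ 1 := by
      by_contra hd
      have := hL.branching_of_deg (G.src e) (by omega)
      simp [hb] at this
    refine ⟨fun e' he' => ?_, fun r c hrc hi => ?_⟩
    · by_cases hee : e' = e
      · subst hee
        rw [Movable.flow_eq, if_pos rfl, hc.eq hb', sub_self]
      · refine hz _ (le_antisymm (not_lt.1 fun h1 => ?_) (h.core.flow_nonneg _))
        exact hee (hL.src_inj hd (h.supp _ h1) (h.supp _ hpos) he' rfl)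
    · exact hpos.ne' (h.irr_out r c (by rwa [hrc]) hi e hrc.symm)
  have hirr : ∀ r c, Irregular G (s.moved G t a) r c → Irregular G s r c ∨
      r = t ∧ ∃ e, a = .inl e ∧ G.head c = G.src e := by
    intro r c hi
    rcases moved_loc_dem hi.pos with ⟨-, h1, h2⟩ | ⟨rfl, e, rfl, h1, h2⟩
    · exact .inl ⟨h1 ▸ hi.pos, h2 ▸ hi.loc, h1 ▸ hi.lt.trans_le (hle c)⟩
    · refine .inr ⟨rfl, e, rfl, ?_⟩
      simpa [h2] using hi.loc.symm
  refine ⟨hcore, hm.noReturn h.noReturn, fun c hcp => h.supp c (hcp.trans_le (hle c)), ?_, ?_, ?_⟩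
  · intro r c hb hi e he
    rcases hirr r c hi with h1 | ⟨rfl, e', h1, h2⟩
    · exact hz _ (h.irr_out r c hb h1 e he)
    · exact (key e' h1 (h2 ▸ hb)).1 e (he.trans h2)
  · intro r c r' c' hb hi hi' hcc
    rcases hirr r c hi with h1 | ⟨rfl, e', h1, h2⟩ <;>
      rcases hirr r' c' hi' with h3 | ⟨rfl, e'', h3, h4⟩
    · exact h.irr_unique r c r' c' hb h1 h3 hcc
    · exact absurd h1 ((key e'' h3 (by rw [← h4, ← hcc, hb])).2 r c (hcc.trans h4))
    · exact absurd h3 ((key e' h1 (by rw [← h2, hb])).2 r' c' (hcc.symm.trans h2))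
    · rfl
  · intro e
    have h1 := hm.routed hG h.core e
    have h2 := hle (.inl e)
    rcases h.low e with ⟨h3, h4⟩ | h3
    · exact .inl ⟨h3, by linarith⟩
    · exact .inr (by linarith)

theorem length_sinkArcPairs :
    (sinkArcPairs : List (Fin n × ExtArc n m)).length = n * (n + m) := by
  exact (List.length_product _ _).trans (by rw [length_verts, length_extArcs])

/-- A bound on the number of steps of a round of the moving phase. -/
def costMove (N : ℕ) : ℕ := 2 * (N * N) + 4 * N + 7

/-- The last clause is needed for augmentations that remove no arc but create a possible move. -/
theorem Runs.moveSinks (hG : G.Acyclic) (χ : ℕ → Bool) (hL : IsLabels G s₀ lab)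
    (h : MidInv G b x s₀ lab s) :
    Runs (moveSinks G χ lab) (((n + m) + n * (n + 1) + 1) * (costMove (n + m) + 1)) s
      fun _ s' => StartInv G b x s' ∧ s'.potential ≤ s.potential ∧
        ((∃ t a, Candidate G lab s t a) → s'.potential < s.potential) := by
  refine loop (fun _ s' => MidInv G b x s₀ lab s' ∧ (s' = s ∨ s'.potential < s.potential))
    (fun _ s => s.potential) _ ?_ ⟨h, .inl rfl⟩ (potential_le s)
  rintro - s' ⟨hM, hs⟩
  have hmem : ∀ q : Fin n × ExtArc n m, q ∈ sinkArcPairs.filter (fun q => decide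
      (0 < s'.dem q.1 ∧ s'.loc q.1 = some (G.head q.2) ∧
        if lab.singular G q.2 then s'.flow q.2 = s'.dem q.1 else s'.dem q.1 ≤ s'.flow q.2)) ↔
      Candidate G lab s' q.1 q.2 := by
    intro q
    rw [List.mem_filter, decide_eq_true_eq]
    exact and_iff_right (List.mem_product.2 ⟨mem_verts _, mem_extArcs _⟩)
  refine (collect_bind (c := n * (n + m) + (n + m + (n + m + (2 * n + 7)))) (fun q => decide
      (0 < s'.dem q.1 ∧ s'.loc q.1 = some (G.head q.2) ∧
        if lab.singular G q.2 then s'.flow q.2 = s'.dem q.1 else s'.dem q.1 ≤ s'.flow q.2))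
      (fun _ _ => rfl) ?_).le
      (by rw [length_sinkArcPairs]; unfold costMove; nlinarith)
  have hlen := List.length_filter_le (fun q => decide
      (0 < s'.dem q.1 ∧ s'.loc q.1 = some (G.head q.2) ∧
        if lab.singular G q.2 then s'.flow q.2 = s'.dem q.1 else s'.dem q.1 ≤ s'.flow q.2))
      (sinkArcPairs : List (Fin n × ExtArc n m))
  rw [length_sinkArcPairs] at hlen
  rcases hl : (sinkArcPairs : List (Fin n × ExtArc n m)).filter _ with _ | ⟨q₀, l⟩
  · rw [hl] at hmem
    have hn : ∀ t a, ¬ Candidate G lab s' t a := fun t a hc => by simpa using (hmem (t, a)).2 hc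
    refine pure ⟨hM.start hn, ?_, ?_⟩
    · rcases hs with rfl | hs
      exacts [le_rfl, hs.le]
    · rintro ⟨t, a, hc⟩
      rcases hs with rfl | hs
      exacts [absurd hc (hn t a), hs]
  · rw [hl] at hmem hlen
    refine (pick_bind (by simp) (c := n + m + (n + m + (2 * n + 7))) fun q hq => ?_).le (by omega)
    have hq := (hmem q).1 hq
    refine (collect_bind (c := n + m + (2 * n + 7)) (fun a => decide
        (s'.loc q.1 = some (G.head a) ∧ lab.singular G a ∧ s'.flow a = s'.dem q.1))
      (fun _ _ => rfl) ?_).le (by rw [length_extArcs])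
    have hlen' := List.length_filter_le (fun a => decide
        (s'.loc q.1 = some (G.head a) ∧ lab.singular G a ∧ s'.flow a = s'.dem q.1))
      (extArcs : List (ExtArc n m))
    rw [length_extArcs] at hlen'
    have hfin : ∀ a, Candidate G lab s' q.1 a → Runs
        (do Transship.moveSink G q.1 a; return (Sum.inl () : Unit ⊕ Unit))
        (2 * n + 7) s' fun r s'' => r = Sum.inl () ∧
          (MidInv G b x s₀ lab s'' ∧ (s'' = s ∨ s''.potential < s.potential)) ∧
            s''.potential < s'.potential := by
      intro a hc
      have ht := hM.core.trail_nodup hG hc.1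
      refine bind (moveSink a ht.1 ht.2.le) (c₂ := 0) ?_ le_rfl
      rintro _ _ rfl
      have hp := hc.movable.potential hG hM.core
      refine pure ⟨rfl, ⟨hM.moved hG hL hc, .inr ?_⟩, hp⟩
      rcases hs with rfl | hs
      exacts [hp, hp.trans hs]
    rcases hl' : (extArcs : List (ExtArc n m)).filter _ with _ | ⟨a₀, l'⟩
    · refine mono (c := n + m + (2 * n + 7)) (hfin q.2 hq) (by omega) ?_
      rintro _ s'' ⟨rfl, h1⟩
      exact h1
    · rw [hl'] at hlen'
      refine mono (c := n + m + (2 * n + 7)) (pick_bind (l := a₀ :: l') (by simp) (g := fun a => do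
        Transship.moveSink G q.1 a; return (Sum.inl () : Unit ⊕ Unit))
        (c := 2 * n + 7) fun a ha => hfin a ?_) (by omega) ?_
      · rw [← hl', List.mem_filter, decide_eq_true_eq] at ha
        obtain ⟨-, h1, h2, h3⟩ := ha
        exact ⟨hq.1, h1, by rw [if_pos h2]; exact h3⟩
      · rintro _ s'' ⟨rfl, h1⟩
        exact h1

end Transship

namespace Transship

variable {n m : ℕ} {G : Network n m} {b : Fin n → ℝ} {x : Fin m → ℝ} {s s₀ : St n m}
  {lab : Labels n}

/-! ## Augmentation along a nice alternating cycle -/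

/-- `o` is the minimum of the set of the real numbers with the property `P`. -/
def IsMinOf (P : ℝ → Prop) (o : Option ℝ) : Prop :=
  (∀ q, o = some q → P q) ∧ ∀ r, P r → ∃ q, o = some q ∧ q ≤ r

theorem IsMinOf.minWith {P : ℝ → Prop} {o : Option ℝ} (h : IsMinOf P o) (r : ℝ) :
    IsMinOf (fun q => P q ∨ q = r) (minWith o r) := by
  rcases o with _ | q
  · refine ⟨fun q hq => .inr (by simpa [Transship.minWith] using hq.symm), ?_⟩
    rintro q (hq | rfl)
    · obtain ⟨_, h1, _⟩ := h.2 q hq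
      simp at h1
    · exact ⟨q, rfl, le_rfl⟩
  · refine ⟨fun q' hq' => ?_, ?_⟩
    · obtain rfl : min q r = q' := by simpa [Transship.minWith] using hq'
      rcases min_choice q r with h1 | h1 <;> rw [h1]
      · exact .inl (h.1 q rfl)
      · exact .inr rfl
    · rintro q' (hq' | rfl)
      · obtain ⟨q'', h1, h2⟩ := h.2 q' hq'
        obtain rfl : q = q'' := by simpa using h1
        exact ⟨_, rfl, (min_le_left _ _).trans h2⟩
      · exact ⟨_, rfl, min_le_right _ _⟩

theorem IsMinOf.congr {P P' : ℝ → Prop} {o : Option ℝ} (h : IsMinOf P o) (hP : ∀ r, P r ↔ P' r) :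
    IsMinOf P' o := by
  rwa [show P' = P from funext fun r => propext (hP r).symm]

/-- The flow is changed by `ε` on the arcs of the cycle `C`. -/
noncomputable def St.augmented (s : St n m) (C : List (WalkStep n m)) (ε : ℝ) : St n m :=
  { s with
    flow := Sum.elim
      (fun e => s.flow (.inl e) + (C.map fun w => if w.arc = e then w.sign * ε else 0).sum)
      (fun v => s.flow (.inr v)) }

/-- The upper bounds on the augmentation that come from the step `w`. -/
def StepBound (G : Network n m) (s : St n m) (w : WalkStep n m) (T : Fin n → Prop) (r : ℝ) :
    Prop :=
  w.forward = false ∧ r = s.flow (.inl w.arc) ∨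
  w.forward = true ∧ ∃ t, T t ∧ s.loc t = some (G.dst w.arc) ∧
    s.flow (.inl w.arc) < s.dem t ∧ r = s.dem t - s.flow (.inl w.arc)

theorem Runs.augmentBound (C : List (WalkStep n m)) :
    Runs (Transship.forEach (fun o w => do
    let f ← Transship.rd fun s => s.flow (.inl w.arc)
    if w.forward then
      Transship.forEach (fun o t => do
        let d ← Transship.rd fun s => s.dem t
        let v ← Transship.rd fun s => s.loc t
        return if v = some (G.dst w.arc) ∧ f < d then minWith o (d - f) else o) verts o
    else return minWith o f) C none) (C.length * (n * 3 + 2)) s fun o s' => s' = s ∧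
      IsMinOf (fun r => ∃ w ∈ C, StepBound G s w (fun _ => True) r) o := by
  refine (forEach (k := n * 3 + 1) (fun l o s' => s' = s ∧ ∃ d, C = d ++ l ∧
    IsMinOf (fun r => ∃ w ∈ d, StepBound G s w (fun _ => True) r) o) ?_ C none s
    ⟨rfl, [], rfl, by simp [IsMinOf]⟩).mono le_rfl ?_
  · rintro w l o s ⟨rfl, d, rfl, ho⟩
    refine rd_bind_eq _ (fun _ => rfl) ?_
    rcases hw : w.forward with _ | _
    · refine pure ⟨rfl, d ++ [w], by simp, (ho.minWith _).congr fun r => ?_⟩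
      simp [StepBound, hw, or_and_right, exists_or]
    · simp only [if_true]
      have h1 := forEach (k := 2) (body := fun (o : Option ℝ) t => do
        let d ← Transship.rd fun s : Memory n m => s.dem t
        let v ← Transship.rd fun s : Memory n m => s.loc t
        return if v = some (G.dst w.arc) ∧ s.flow (.inl w.arc) < d then
          minWith o (d - s.flow (.inl w.arc)) else o)
        (fun l o s' => s' = s ∧ ∃ d', verts = d' ++ l ∧ IsMinOf (fun r =>
          (∃ w ∈ d, StepBound G s w (fun _ => True) r) ∨ StepBound G s w (fun t => t ∈ d') r) o)
        ?_ verts o s ⟨rfl, [], rfl, ho.congr fun r => by simp [StepBound, hw]⟩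
      · rw [length_verts] at h1
        refine h1.mono le_rfl ?_
        rintro o s ⟨rfl, d', h2, h3⟩
        rw [List.append_nil] at h2
        subst h2
        refine ⟨rfl, d ++ [w], by simp, h3.congr fun r => ?_⟩
        simp [or_and_right, exists_or, mem_verts]
      · rintro t l o s ⟨rfl, d', h2, h3⟩
        refine rd_bind_eq _ (fun _ => rfl) <| rd_bind_eq (c := 0) _ (fun _ => rfl) <|
          pure ⟨rfl, d' ++ [t], by simp [h2], ?_⟩
        split_ifs with h4
        · refine (h3.minWith _).congr fun r => ?_
          rw [or_assoc]
          refine or_congr_right ?_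
          simp only [StepBound, hw, true_and, Bool.true_eq_false, false_and, false_or,
            List.mem_append, List.mem_singleton, or_and_right, exists_or, exists_eq_left]
          exact or_congr_right ⟨fun h => ⟨h4.1, h4.2, h⟩, fun h => h.2.2⟩
        · refine h3.congr fun r => or_congr_right ?_
          simp only [StepBound, hw, true_and, Bool.true_eq_false, false_and, false_or,
            List.mem_append, List.mem_singleton, or_and_right, exists_or, exists_eq_left]
          exact (or_iff_left fun h => h4 ⟨h.1, h.2.1⟩).symm
  · rintro o s ⟨rfl, d, hd, ho⟩
    rw [List.append_nil] at hd
    subst hd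
    exact ⟨rfl, ho⟩

/-- A bound on the number of steps of an augmentation. -/
def costAugment (N : ℕ) : ℕ := N * (N * 3 + 5)

theorem Runs.augment {C : List (WalkStep n m)} (hC : IsNiceCycle G s lab C) :
    Runs (augment G C) (costAugment n) s fun _ s' => ∃ ε,
      IsMinOf (fun r => ∃ w ∈ C, StepBound G s w (fun _ => True) r) (some ε) ∧
      s' = s.augmented C ε := by
  have hlen := hC.length_le
  refine bind (augmentBound C) (c₂ := C.length * 3) ?_ (by unfold costAugment; nlinarith)
  rintro (_ | ε) s ⟨rfl, ho⟩
  -- The minimum exists, since a backward arc contributes its flow.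
  · obtain ⟨w, hw, hf⟩ := hC.backward
    obtain ⟨q, hq, _⟩ := ho.2 _ ⟨w, hw, .inl ⟨hf, rfl⟩⟩
    simp at hq
  · refine (forEach (k := 2) (fun l _ s' => ∃ d, C = d ++ l ∧ s' = s.augmented d ε) ?_ C () s
      ⟨[], rfl, ?_⟩).mono le_rfl ?_
    · rintro w l _ _ ⟨d, h1, rfl⟩
      refine rd_bind_eq (s.flow (.inl w.arc) +
        (d.map fun w' => if w'.arc = w.arc then w'.sign * ε else 0).sum) (fun _ => rfl) <|
        wr (c := 0) (s' := s.augmented (d ++ [w]) ε) ?_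
        ⟨d ++ [w], by simp [h1], rfl⟩
      intro k
      simp only [St.mem, St.augmented, Memory.mk.injEq, true_and, and_true]
      ext (e | v)
      · by_cases he : e = w.arc
        · subst he
          rcases hw : w.forward <;> simp [WalkStep.sign, hw] <;> ring
        · simp [he, Ne.symm he]
      · simp
    · have h1 : (s.augmented [] ε).flow = s.flow := by ext (e | v) <;> simp [St.augmented]
      exact (congrArg (fun f => ({ s with flow := f } : St n m)) h1).symm
    · rintro _ _ ⟨d, h1, rfl⟩
      rw [List.append_nil] at h1
      subst h1
      exact ⟨ε, ho, rfl⟩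

theorem augmented_flow {C : List (WalkStep n m)} (hC : (C.map WalkStep.arc).Nodup) (ε : ℝ)
    (a : ExtArc n m) : (s.augmented C ε).flow a = s.flow a ∨
      ∃ w ∈ C, a = .inl w.arc ∧ (s.augmented C ε).flow a = s.flow a + w.sign * ε := by
  rcases a with e | v
  · by_cases he : e ∈ C.map WalkStep.arc
    · obtain ⟨w, hw, rfl⟩ := List.mem_map.1 he
      refine .inr ⟨w, hw, rfl, ?_⟩
      simp only [St.augmented, Sum.elim_inl]
      rw [sum_map_eq_of_nodup (fun w => w.sign * ε) hC w hw]
    · left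
      simp only [St.augmented, Sum.elim_inl]
      rw [sum_map_eq_zero_of_notMem he (fun w => w.sign * ε), add_zero]
  · exact .inl rfl

theorem augmented_flow_of_mem {C : List (WalkStep n m)} (hC : (C.map WalkStep.arc).Nodup) (ε : ℝ)
    {w : WalkStep n m} (hw : w ∈ C) :
    (s.augmented C ε).flow (.inl w.arc) = s.flow (.inl w.arc) + w.sign * ε := by
  simp only [St.augmented, Sum.elim_inl]
  rw [sum_map_eq_of_nodup (fun w => w.sign * ε) hC w hw]

/-- No sink becomes irregular: an increase stops at the first demand reached from below, and a
decrease cannot push a flow above a demand. The step attaining the minimum either loses its arc or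
enables a move. -/
theorem MidInv.augmented (hS : StartInv G b x s)
    (h : MidInv G b x s lab s) {C : List (WalkStep n m)} (hC : IsNiceCycle G s lab C) {ε : ℝ}
    (hε : IsMinOf (fun r => ∃ w ∈ C, StepBound G s w (fun _ => True) r) (some ε)) :
    MidInv G b x s lab (s.augmented C ε) ∧ ((s.augmented C ε).potential < s.potential ∨
      (s.augmented C ε).potential ≤ s.potential ∧
      ∃ t a, Candidate G lab (s.augmented C ε) t a) := by
  have hcand := hε.1 ε rfl
  have hpos : 0 < ε := by
    obtain ⟨w, hw, ⟨_, rfl⟩ | ⟨_, t, _, _, h1, rfl⟩⟩ := hcand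
    · exact hC.pos w hw
    · linarith
  have hmin : ∀ w ∈ C, ∀ r, StepBound G s w (fun _ => True) r → ε ≤ r := by
    intro w hw r hr
    obtain ⟨q, h1, h2⟩ := hε.2 r ⟨w, hw, hr⟩
    obtain rfl : ε = q := by simpa using h1
    exact h2
  have hfwd : ∀ w ∈ C, w.forward = true → ∀ t, s.loc t = some (G.dst w.arc) →
      s.flow (.inl w.arc) < s.dem t → (s.augmented C ε).flow (.inl w.arc) ≤ s.dem t := by
    intro w hw hf t h1 h2
    have := hmin w hw _ (.inr ⟨hf, t, trivial, h1, h2, rfl⟩)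
    rw [augmented_flow_of_mem hC.nodup ε hw, WalkStep.sign, if_pos hf]
    linarith
  have hnn : ∀ a, 0 ≤ (s.augmented C ε).flow a := by
    intro a
    rcases augmented_flow hC.nodup ε a with h1 | ⟨w, hw, rfl, h1⟩
    · rw [h1]; exact h.core.flow_nonneg a
    · have h2 := hC.pos w hw
      rw [h1, WalkStep.sign]
      split_ifs with hf
      · linarith
      · have := hmin w hw _ (.inl ⟨by simpa using hf, rfl⟩)
        linarith
  have hz : ∀ a, s.flow a = 0 → (s.augmented C ε).flow a = 0 := by
    intro a ha
    rcases augmented_flow hC.nodup ε a with h1 | ⟨w, hw, rfl, h1⟩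
    · rw [h1, ha]
    · exact absurd ha (hC.pos w hw).ne'
  have hsupp : ∀ a, 0 < (s.augmented C ε).flow a → 0 < s.flow a := fun a ha =>
    (h.core.flow_nonneg a).lt_of_ne' fun h1 => ha.ne' (hz a h1)
  have hirr : ∀ t a, Irregular G (s.augmented C ε) t a → Irregular G s t a := by
    rintro t a ⟨h1, h2, h3⟩
    refine ⟨h1, h2, ?_⟩
    rcases augmented_flow hC.nodup ε a with h4 | ⟨w, hw, rfl, h4⟩
    · rwa [h4] at h3
    · rcases hf : w.forward with _ | _
      · rw [h4, WalkStep.sign, hf] at h3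
        have h5 : (s.augmented C ε).dem t = s.dem t := rfl
        simp only [Bool.false_eq_true, if_false] at h3
        linarith
      · by_contra h5
        have h6 := hfwd w hw hf t h2 (lt_of_le_of_ne (not_lt.1 h5) (hS.ne t _ h1 h2))
        exact absurd h3 (not_lt.2 h6)
  refine ⟨⟨?_, ?_, hsupp, ?_, ?_, ?_⟩, ?_⟩
  · refine { h.core with flow_nonneg := hnn, conserve := fun v => ?_ }
    refine Eq.trans ?_ (h.core.conserve v)
    obtain ⟨u, hu⟩ := hC.closed
    have h1 := sum_list_mul C WalkStep.arc (fun w => w.sign * ε) (G.inc v)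
    have h2 := hu.sum_inc v
    have h3 : (C.map fun w => w.sign * ε * G.inc v w.arc).sum = 0 := by
      rw [sub_self] at h2
      rw [show (fun w : WalkStep n m => w.sign * ε * G.inc v w.arc) =
        fun w => ε * (w.sign * G.inc v w.arc) from funext fun w => by ring, List.sum_map_mul_left,
        h2, mul_zero]
    rw [h3] at h1
    simp only [St.augmented, Sum.elim_inl, Sum.elim_inr, add_mul, Finset.sum_add_distrib, h1,
      add_zero]
  · intro P hP
    exact (h.noReturn P hP).imp id fun h1 => h1.mono hz fun v hv => .inl hv
  · intro t a hb hi e he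
    exact hz _ (h.irr_out t a hb (hirr t a hi) e he)
  · intro t a t' a' hb hi hi'
    exact h.irr_unique t a t' a' hb (hirr t a hi) (hirr t' a' hi')
  · intro e
    refine (h.low e).imp (fun h1 => ⟨h1.1, ?_⟩) id
    refine h1.2.trans (add_le_add le_rfl ?_)
    rcases augmented_flow hC.nodup ε (.inl e) with h2 | ⟨w, hw, h3, h2⟩
    · rw [h2]
    · obtain rfl : e = w.arc := by simpa using h3
      rcases hf : w.forward with _ | _
      · have := hC.singular w hw hf
        simp [this] at h1
      · rw [h2, WalkStep.sign, hf]
        simp [hpos.le]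
  · have hle : (s.augmented C ε).potential ≤ s.potential :=
      potential_le_of_le hsupp fun _ => le_rfl
    obtain ⟨w, hw, ⟨hf, h1⟩ | ⟨hf, t, -, h1, h2, h3⟩⟩ := hcand
    · left
      refine potential_lt hsupp (fun _ => le_rfl) (.inl ⟨.inl w.arc, hC.pos w hw, ?_⟩)
      rw [augmented_flow_of_mem hC.nodup ε hw, WalkStep.sign, hf]
      simp [h1]
    · right
      have h4 : (s.augmented C ε).flow (.inl w.arc) = s.dem t := by
        rw [augmented_flow_of_mem hC.nodup ε hw, WalkStep.sign, hf]
        simp [h3]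
      refine ⟨hle, t, .inl w.arc, (h.core.flow_nonneg _).trans_lt h2, h1, ?_⟩
      split_ifs
      exacts [h4, h4.ge]

end Transship

namespace Transship

variable {n m : ℕ} {G : Network n m} {b : Fin n → ℝ} {x : Fin m → ℝ} {s s₀ V : St n m}
  {lab : Labels n} {w : Fin n} {a' : Fin m} {mark : Fin n → Bool} {t : Fin n}

/-! ## Routing in the singular digraph -/

theorem IsJunction.flow_eq_zero (hw : IsJunction G s lab w a') (hL : IsLabels G s lab)
    (hC : Core G b s) {e : Fin m} (he : G.src e = w) : s.flow (.inl e) = 0 := by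
  by_contra h
  have := hL.deg_pos ((hC.flow_nonneg (.inl e)).lt_of_ne' h)
  rw [he, hw.deg] at this
  omega

/-- The outgoing arc inside the digraph is the only one. So walks cannot leave the digraph, and they
are unique there. -/
theorem IsSingular.dst_mark (hS : IsSingular G s lab w a' mark) (hL : IsLabels G s lab)
    (hw : IsJunction G s lab w a') {e : Fin m} (he : 0 < s.flow (.inl e))
    (hm : mark (G.src e) = true) : mark (G.dst e) = true ∧ e ≠ a' := by
  have hne : G.src e ≠ w := fun h => by
    have := hL.deg_pos he
    rw [h, hw.deg] at this
    omega
  obtain ⟨e', h1, h2, h3, h4⟩ := hS.out _ hm hne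
  obtain rfl := hL.src_inj (hS.deg_le _ hm) he h2 rfl h1
  exact ⟨h4, h3⟩

/-- Some present arc other than `a'` enters a vertex with sufficient outflow and demand. -/
theorem Core.exists_in (h : Core G b s) (hw : G.dst a' = w) {u : Fin n}
    (hu : (if u = w then s.flow (.inl a') else 0) < outflow G s u + demandAt s u) :
    ∃ a : ExtArc n m, G.head a = u ∧ 0 < s.flow a ∧ a ≠ .inl a' := by
  by_contra hne
  push Not at hne
  have h0 : ∀ a, G.head a = u → a ≠ .inl a' → s.flow a = 0 := fun a h1 h2 =>
    le_antisymm (not_lt.1 fun h3 => h2 (hne a h1 h3)) (h.flow_nonneg a)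
  rw [← h.inflow, h0 (.inr u) rfl (by simp), zero_add] at hu
  by_cases huw : u = w
  · rw [if_pos huw, Finset.sum_eq_single a'] at hu
    · exact lt_irrefl _ hu
    · intro e he hea
      exact h0 (.inl e) (Finset.mem_filter.1 he).2 (by simpa using hea)
    · simp [hw, huw]
  · rw [if_neg huw, Finset.sum_eq_zero] at hu
    · exact lt_irrefl _ hu
    · intro e he
      refine h0 (.inl e) (Finset.mem_filter.1 he).2 ?_
      rintro h1
      obtain rfl : e = a' := by simpa using h1
      exact huw ((by simpa using he : G.dst e = u).symm.trans hw)

theorem Core.flow_add_le (h : Core G b s) {a : ExtArc n m} {e : Fin m} (ha : a ≠ .inl e)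
    (hae : G.head a = G.dst e) :
    s.flow a + s.flow (.inl e) ≤ outflow G s (G.dst e) + demandAt s (G.dst e) := by
  rw [← h.inflow]
  rcases a with e' | v
  · have h1 := Finset.add_le_sum (s := Finset.univ.filter fun e' => G.dst e' = G.dst e)
      (f := fun e => s.flow (.inl e)) (fun e _ => h.flow_nonneg _) (i := e') (j := e)
      (Finset.mem_filter.2 ⟨Finset.mem_univ _, hae⟩) (by simp) (by simpa using ha)
    exact h1.trans (le_add_of_nonneg_left (h.flow_nonneg _))
  · obtain rfl : v = G.dst e := hae
    refine add_le_add le_rfl ?_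
    exact Finset.single_le_sum (s := Finset.univ.filter fun e' => G.dst e' = G.dst e)
      (f := fun e => s.flow (.inl e)) (fun e _ => h.flow_nonneg _) (a := e) (by simp)

/-- Invariant of the routing in the singular digraph, where `s₀` is the state at the beginning of
the iteration and `t` is the sink to be split. -/
structure RouteInv (G : Network n m) (b : Fin n → ℝ) (s₀ : St n m) (w : Fin n) (a' : Fin m)
    (mark : Fin n → Bool) (t : Fin n) (V : St n m) : Prop where
  core : Core G b V
  flow_le : ∀ a, V.flow a ≤ s₀.flow a
  unmarked : ∀ a, mark (G.head a) = false → V.flow a = s₀.flow a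
  junction : V.flow (.inl a') = s₀.flow (.inl a')
  loc : ∀ r, 0 < V.dem r → V.loc r = s₀.loc r
  trail : V.trail = s₀.trail
  dem_le : ∀ r, V.dem r ≤ s₀.dem r
  dem_unmarked : ∀ r v, s₀.loc r = some v → mark v = false → V.dem r = s₀.dem r
  split_loc : V.loc t = some w
  split_dem : s₀.flow (.inl a') ≤ V.dem t
  routed : ∀ e, V.routed e + V.flow (.inl e) = s₀.routed e + s₀.flow (.inl e)

theorem RouteInv.supp (h : RouteInv G b s₀ w a' mark t V) {a : ExtArc n m} (ha : 0 < V.flow a) :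
    0 < s₀.flow a := ha.trans_le (h.flow_le a)

/-- The state in which the demand of the (sub-)sink of `q` is `r`. -/
noncomputable def St.setDem (s : St n m) (q : Fin n) (r : ℝ) : St n m :=
  { s with dem := Function.update s.dem q r }

/-- The flow value `δ` has been routed, but the demand has not been updated. -/
noncomputable def St.sent (s : St n m) (u q : Fin n) (p : List (Fin m)) (δ : ℝ) : St n m :=
  { s.routeVia u q p δ with dem := s.dem }

/-- The routing loop leaves the stored demand untouched. The invariants therefore speak of the state
with demand `c + r`, where `c` is kept back and `r` is still to be routed; sending `δ` there is an
ordinary routing step. -/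
theorem setDem_sent (s : St n m) (u q : Fin n) (p : List (Fin m)) (δ c r : ℝ) :
    (s.sent u q p δ).setDem q (c + (r - δ)) = (s.setDem q (c + r)).routeVia u q p δ := by
  simp only [St.setDem, St.sent, St.routeVia, Function.update_idem, Function.update_self,
    add_sub_assoc]
  rfl

theorem Core.demandAt_ge (h : Core G b s) {v q : Fin n} (hq : s.loc q = some v) :
    s.dem q ≤ demandAt s v := by
  have := Finset.single_le_sum (s := Finset.univ)
    (f := fun t => if s.loc t = some v then s.dem t else 0)
    (fun t _ => by split_ifs; exacts [h.dem_nonneg t, le_rfl]) (Finset.mem_univ q)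
  rwa [if_pos hq] at this

theorem Core.demandAt_ge_add (h : Core G b s) {v q t : Fin n} (hq : s.loc q = some v)
    (ht : s.loc t = some v) (hqt : q ≠ t) : s.dem q + s.dem t ≤ demandAt s v := by
  have := Finset.add_le_sum (s := Finset.univ)
    (f := fun t => if s.loc t = some v then s.dem t else 0)
    (fun t _ => by split_ifs; exacts [h.dem_nonneg t, le_rfl]) (Finset.mem_univ q)
    (Finset.mem_univ t) hqt
  rwa [if_pos hq, if_pos ht] at this

theorem RouteInv.routeVia (hG : G.Acyclic) (h : RouteInv G b s₀ w a' mark t V) {u v q : Fin n}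
    {p : List (Fin m)} {δ : ℝ} (hl : V.loc q = some v) (hv : mark v = true) (hu : mark u = true)
    (hp : G.IsWalk u v p) (hδ : 0 < δ) (hd : δ ≤ V.dem q)
    (hd' : q = t → s₀.flow (.inl a') ≤ V.dem q - δ) (hfu : δ ≤ V.flow (.inr u))
    (hfe : ∀ e ∈ p, δ ≤ V.flow (.inl e)) (hpm : ∀ e ∈ p, mark (G.dst e) = true ∧ e ≠ a')
    (hnew : ∀ P ∈ V.paths, P.sink = q → P.source ≠ u) :
    RouteInv G b s₀ w a' mark t (V.routeVia u q p δ) := by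
  have hle : ∀ a, (V.routeVia u q p δ).flow a ≤ V.flow a := by
    rintro (e | y) <;> simp only [St.routeVia, Sum.elim_inl, Sum.elim_inr] <;> split_ifs <;>
      linarith
  have hdle : ∀ r, (V.routeVia u q p δ).dem r ≤ V.dem r := by
    intro r
    by_cases hr : r = q
    · subst hr; simp [St.routeVia, hδ.le]
    · simp [St.routeVia, hr]
  refine ⟨h.core.routeVia hG hl hp hδ hd hfu hfe hnew, fun a => (hle a).trans (h.flow_le a), ?_, ?_,
    fun r hr => h.loc r (hr.trans_le (hdle r)), h.trail, fun r => (hdle r).trans (h.dem_le r), ?_,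
    h.split_loc, ?_, ?_⟩
  · intro a ha
    rw [← h.unmarked a ha]
    rcases a with e | y
    · have : e ∉ p := fun he => by
        have h1 := (hpm e he).1
        rw [show G.dst e = G.head (.inl e) from rfl, ha] at h1
        simp at h1
      simp [St.routeVia, this]
    · have : y ≠ u := by
        rintro rfl
        rw [show G.head (.inr y) = y from rfl, hu] at ha
        simp at ha
      simp [St.routeVia, this]
  · have : a' ∉ p := fun he => (hpm a' he).2 rfl
    simpa [St.routeVia, this] using h.junction
  · intro r y hr hy
    have : r ≠ q := by
      rintro rfl
      have h1 := h.loc r (hδ.trans_le hd)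
      rw [hl, hr, Option.some.injEq] at h1
      rw [h1, hy] at hv
      simp at hv
    simpa [St.routeVia, this] using h.dem_unmarked r y hr hy
  · by_cases htq : t = q
    · subst htq; simpa [St.routeVia] using hd' rfl
    · simpa [St.routeVia, htq] using h.split_dem
  · intro e
    rw [routed_routeVia hG h.core hl hp (hδ.trans_le hd), ← h.routed e]
    simp only [St.routeVia, Sum.elim_inl]
    ring

theorem RouteInv.clear (h : RouteInv G b s₀ w a' mark t V) {r : Fin n} (hrt : r ≠ t)
    (hr : V.dem r = 0) : RouteInv G b s₀ w a' mark t (V.clear r) := by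
  have hd : (V.clear r).dem = V.dem := by simp [St.clear, ← hr]
  refine ⟨h.core.clear hr, h.flow_le, h.unmarked, h.junction, fun q hq => ?_, h.trail, ?_, ?_, ?_, ?_,
    fun e => ?_⟩
  · rw [hd] at hq
    have : q ≠ r := by rintro rfl; exact hq.ne' hr
    simpa [St.clear, this] using h.loc q hq
  · rw [hd]; exact h.dem_le
  · rw [hd]; exact h.dem_unmarked
  · simpa [St.clear, hrt.symm] using h.split_loc
  · rw [hd]; exact h.split_dem
  · rw [routed_clear hr]; exact h.routed e

/-- A bound on the number of steps of `traceBack`. -/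
def costTrace (N : ℕ) : ℕ := (N + 1) * (2 * N + 1)

/-- The trace never gets stuck by `hin`, stays among marked vertices by `hsrc`, and has bounded
length by acyclicity. -/
theorem Runs.traceBack (hG : G.Acyclic) (χ : ℕ → Bool) {v : Fin n} {p : List (Fin m)}
    (hv : mark v = true)
    (hsrc : ∀ e, mark (G.dst e) = true → 0 < s.flow (.inl e) → e ≠ a' → mark (G.src e) = true)
    (hin : ∀ u, mark u = true → u = v ∨ (∃ e, G.src e = u ∧ 0 < s.flow (.inl e)) →
      ∃ a : ExtArc n m, G.head a = u ∧ 0 < s.flow a ∧ a ≠ .inl a') :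
    Runs (traceBack G χ a' v p) (costTrace (n + m)) s fun c s' => s' = s ∧ c.2.2 = c.2.1 ++ p ∧
      G.IsWalk c.1 v c.2.1 ∧ mark c.1 = true ∧ 0 < s.flow (.inr c.1) ∧
      ∀ e ∈ c.2.1, 0 < s.flow (.inl e) ∧ mark (G.dst e) = true ∧ e ≠ a' := by
  refine (loop (k := 2 * (n + m)) (fun (c : Fin n × List (Fin m) × List (Fin m)) s' => s' = s ∧
      c.2.2 = c.2.1 ++ p ∧ G.IsWalk c.1 v c.2.1 ∧ mark c.1 = true ∧
      (∀ e ∈ c.2.1, 0 < s.flow (.inl e) ∧ mark (G.dst e) = true ∧ e ≠ a') ∧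
      (c.1 = v ∨ ∃ e, G.src e = c.1 ∧ 0 < s.flow (.inl e)))
    (fun c _ => n - c.2.1.length) n (x := (v, [], p)) ?_ ⟨rfl, rfl, rfl, hv, by simp, .inl rfl⟩ (by simp)).le
    (by unfold costTrace; exact Nat.mul_le_mul (by omega) le_rfl)
  rintro ⟨u, p₁, p₂⟩ s ⟨rfl, h1, h2, h3, h4, h5⟩
  dsimp only at h1 h2 h3 h4 h5
  refine (collect_bind (c := n + m) (fun a => decide
    (G.head a = u ∧ 0 < s.flow a ∧ a ≠ .inl a')) (fun _ _ => rfl) ?_).le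
    (by rw [length_extArcs]; omega)
  have hlen := List.length_filter_le (fun a => decide
    (G.head a = u ∧ 0 < s.flow a ∧ a ≠ .inl a')) (extArcs : List (ExtArc n m))
  rw [length_extArcs] at hlen
  obtain ⟨a₀, ha₀⟩ := hin u h3 h5
  refine (pick_bind (c := 0) (List.ne_nil_of_mem (a := a₀)
    (List.mem_filter.2 ⟨mem_extArcs _, by simpa using ha₀⟩)) fun a ha => ?_).le hlen
  rw [List.mem_filter, decide_eq_true_eq] at ha
  obtain ⟨-, rfl, ha1, ha2⟩ := ha
  rcases a with e | y
  · have h6 : G.IsWalk (G.src e) v (e :: p₁) := ⟨rfl, h2⟩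
    have := h6.length_lt hG
    rw [List.length_cons] at this
    have hea : e ≠ a' := by simpa using ha2
    refine pure ⟨⟨rfl, by simp [h1], h6, hsrc e h3 ha1 hea, ?_, .inr ⟨e, rfl, ha1⟩⟩, ?_⟩
    · intro e' he'
      rcases List.mem_cons.1 he' with rfl | he'
      · exact ⟨ha1, h3, hea⟩
      · exact h4 e' he'
    · simp only [List.length_cons]
      omega
  · exact pure ⟨rfl, h1, h2, h3, ha1, h4⟩

theorem Runs.minFlow (p : List (Fin m)) (r : ℝ) :
    Runs (Transship.forEach (fun δ e => do
      let f ← Transship.rd fun s => s.flow (.inl e)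
      return min δ f) p r) (p.length * 2) s fun δ s' => s' = s ∧ δ ≤ r ∧
      (∀ e ∈ p, δ ≤ s.flow (.inl e)) ∧ (δ = r ∨ ∃ e ∈ p, δ = s.flow (.inl e)) := by
  refine (forEach (k := 1) (fun l (δ : ℝ) s' => s' = s ∧ ∃ d, p = d ++ l ∧ δ ≤ r ∧
      (∀ e ∈ d, δ ≤ s.flow (.inl e)) ∧ (δ = r ∨ ∃ e ∈ d, δ = s.flow (.inl e))) ?_ p r s
      ⟨rfl, [], rfl, le_rfl, by simp, .inl rfl⟩).mono le_rfl ?_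
  · rintro e l δ s ⟨rfl, d, rfl, h1, h2, h3⟩
    refine rd_bind_eq (c := 0) _ (fun _ => rfl) <| pure ⟨rfl, d ++ [e], by simp,
      (min_le_left _ _).trans h1, ?_, ?_⟩
    · intro e' he'
      rcases List.mem_append.1 he' with he' | he'
      · exact (min_le_left _ _).trans (h2 e' he')
      · rw [List.mem_singleton] at he'
        subst he'
        exact min_le_right _ _
    · rcases min_choice δ (s.flow (.inl e)) with h4 | h4 <;> rw [h4]
      · refine h3.imp id ?_
        rintro ⟨e', he', h5⟩
        exact ⟨e', by simp [he'], h5⟩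
      · exact .inr ⟨e, by simp, rfl⟩
  · rintro δ s ⟨rfl, d, hd, h⟩
    rw [List.append_nil] at hd
    subst hd
    exact ⟨rfl, h⟩

theorem Runs.send_bind {β : Type} {u q : Fin n} {p : List (Fin m)} {f δ : ℝ} {c : ℕ}
    {g : Unit → Alg n m β} {Q : β → St n m → Prop} (hf : s.flow (.inr u) = f)
    (hp : (p ++ s.trail q).Nodup) (hn : (p ++ s.trail q).length ≤ n)
    (h : Runs (g ()) c (s.sent u q p δ) Q) :
    Runs (do
        wrFlow (.inr u) (f - δ)
        Transship.forEach (fun _ e => do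
          let f ← Transship.rd fun s => s.flow (.inl e)
          wrFlow (.inl e) (f - δ)) p ()
        Transship.emit u q (p ++ s.trail q) δ
        g ()) (5 * n + 2 + c) s Q := by
  have hlen : p.length ≤ n := by
    rw [List.length_append] at hn
    omega
  refine (wrFlow_bind (c := p.length * 3 + (2 * n + 1 + c)) ?_).le (by omega)
  refine bind (forEach (k := 2) (fun l _ s' => ∃ d, p = d ++ l ∧ s' = { s with
      flow := Sum.elim (fun e => s.flow (.inl e) - if e ∈ d then δ else 0)
        (fun v => s.flow (.inr v) - if v = u then δ else 0) }) ?_ p () _ ⟨[], rfl, ?_⟩)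
    (c₂ := 2 * n + 1 + c) ?_ le_rfl
  · rintro e l _ _ ⟨d, rfl, rfl⟩
    have hed : e ∉ d := fun h => by
      rw [List.append_assoc] at hp
      exact (List.nodup_append.1 hp).2.2 e h e (by simp) rfl
    refine rd_bind_eq (s.flow (.inl e)) (fun _ => by simp [St.mem, hed]) <| wr (c := 0)
      (s' := { s with
        flow := Sum.elim (fun e' => s.flow (.inl e') - if e' ∈ d ++ [e] then δ else 0)
          (fun v => s.flow (.inr v) - if v = u then δ else 0) }) ?_ ⟨d ++ [e], by simp, rfl⟩
    intro k
    simp only [St.mem, Memory.mk.injEq, true_and, and_true]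
    ext (e' | v)
    · by_cases he : e' = e
      · subst he; simp
      · simp [he]
    · simp
  · simp only [St.mk.injEq, and_true]
    ext (e | v)
    · simp
    · by_cases hv : v = u
      · subst hv; simp [hf]
      · simp [hv]
  · rintro _ _ ⟨d, hd, rfl⟩
    rw [List.append_nil] at hd
    subst hd
    refine bind (emit hp hn) ?_ le_rfl
    rintro _ _ rfl
    exact h

end Transship

namespace Transship

variable {n m : ℕ} {G : Network n m} {b : Fin n → ℝ} {x : Fin m → ℝ} {s s₀ V : St n m}
  {lab : Labels n} {w : Fin n} {a' : Fin m} {mark : Fin n → Bool} {t : Fin n}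

/-! ### Routing the demand of one sink in the singular digraph -/

theorem present_card_lt {s' : St n m} (hle : ∀ a, 0 < s'.flow a → 0 < s.flow a) {a : ExtArc n m}
    (h : 0 < s.flow a) (h' : s'.flow a = 0) :
    (Finset.univ.filter fun a => 0 < s'.flow a).card <
      (Finset.univ.filter fun a => 0 < s.flow a).card := by
  refine Finset.card_lt_card ((Finset.ssubset_iff_of_subset fun a => by simpa using hle a).2 ⟨a, ?_⟩)
  simpa using ⟨h, h'.le⟩

/-- A vertex of the singular digraph from which demand is to be routed is entered by a present
arc. -/
theorem RouteInv.exists_in (h : RouteInv G b s₀ w a' mark t V) (hL : IsLabels G s₀ lab)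
    (hw : IsJunction G s₀ lab w a') (hC : Core G b s₀) {q v : Fin n} {r : ℝ} (hr : 0 < r)
    (hq : V.loc q = some v) (hd : V.dem q = (if q = t then s₀.flow (.inl a') else 0) + r)
    {u : Fin n} (hu : u = v ∨ ∃ e, G.src e = u ∧ 0 < V.flow (.inl e)) :
    ∃ a : ExtArc n m, G.head a = u ∧ 0 < V.flow a ∧ a ≠ .inl a' := by
  refine h.core.exists_in hw.dst ?_
  have h0 := h.core.outflow_nonneg u
  have h1 := h.core.demandAt_nonneg u
  have hf := hw.pos
  rcases hu with rfl | ⟨e, rfl, he⟩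
  · rw [h.junction]
    by_cases hqt : q = t
    · subst hqt
      have h2 := h.core.demandAt_ge hq
      rw [hd, if_pos rfl] at h2
      split_ifs <;> linarith
    · rw [if_neg hqt] at hd
      split_ifs with huw
      · subst huw
        -- At `w`, the sink `t` alone accounts for the flow on `a'`; the demand of `q` needs a
        -- further entering arc.
        have h2 := h.core.demandAt_ge_add hq h.split_loc hqt
        have h3 := h.split_dem
        linarith
      · have h2 := h.core.demandAt_ge hq
        linarith
  · rw [if_neg]
    · have h2 := Finset.single_le_sum (s := Finset.univ.filter fun e' => G.src e' = G.src e)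
        (f := fun e => V.flow (.inl e)) (fun e _ => h.core.flow_nonneg _) (a := e) (by simp)
      have h3 : V.flow (.inl e) ≤ outflow G V (G.src e) := h2
      linarith
    · intro h2
      exact (h.supp he).ne' (hw.flow_eq_zero hL hC h2)

/-- A bound on the number of steps of `routeDemand`. -/
def costRoute (N : ℕ) : ℕ := (N + 2) * (costTrace N + 7 * N + 6)

theorem sent_flow_le {u q : Fin n} {p : List (Fin m)} {δ : ℝ} (hδ : 0 ≤ δ) (a : ExtArc n m) :
    (s.sent u q p δ).flow a ≤ s.flow a := by
  rcases a with e | y <;> simp only [St.sent, St.routeVia, Sum.elim_inl, Sum.elim_inr] <;>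
    split_ifs <;> linarith

/-- Each round routes all that remains or saturates an arc, possibly a dummy arc. Hence the measure
is the number of present arcs, plus one while demand remains. Separation is claimed only while
demand remains, as the last path need not saturate anything. -/
theorem Runs.routeDemand (hG : G.Acyclic) (χ : ℕ → Bool) (hL : IsLabels G s₀ lab)
    (hw : IsJunction G s₀ lab w a') (hS : IsSingular G s₀ lab w a' mark) (hC : Core G b s₀)
    {q v : Fin n} {r : ℝ} {c : ℝ} (hc : c = if q = t then s₀.flow (.inl a') else 0) (hr : 0 ≤ r)
    (hI : RouteInv G b s₀ w a' mark t (s.setDem q (c + r))) (hq : s.loc q = some v)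
    (hv : mark v = true) (hsep : ∀ P ∈ s.paths, P.sink = q → Separated G s P) :
    Runs (routeDemand G χ a' q r) (costRoute (n + m)) s fun _ s' =>
      RouteInv G b s₀ w a' mark t (s'.setDem q c) ∧ s'.dem = s.dem ∧ s'.loc = s.loc ∧
      (∀ a, s'.flow a ≤ s.flow a) ∧
      ∀ P ∈ s'.paths, P ∈ s.paths ∨ P.sink = q ∧ mark P.source = true := by
  have hc0 : 0 ≤ c := by rw [hc]; split_ifs; exacts [hC.flow_nonneg _, le_rfl]
  have hcard : (Finset.univ.filter fun a => 0 < s.flow a).card + (if 0 < r then 1 else 0) ≤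
      n + m + 1 := by
    have := Finset.card_le_univ (Finset.univ.filter fun a => 0 < s.flow a)
    simp only [Fintype.card_sum, Fintype.card_fin] at this
    split_ifs <;> omega
  refine (loop (k := costTrace (n + m) + 7 * n + 5) (fun r s' => 0 ≤ r ∧
      RouteInv G b s₀ w a' mark t (s'.setDem q (c + r)) ∧ s'.dem = s.dem ∧ s'.loc = s.loc ∧
      (∀ a, s'.flow a ≤ s.flow a) ∧
      (∀ P ∈ s'.paths, P ∈ s.paths ∨ P.sink = q ∧ mark P.source = true) ∧
      (0 < r → ∀ P ∈ s'.paths, P.sink = q → Separated G s' P))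
    (fun r s => (Finset.univ.filter fun a => 0 < s.flow a).card + if 0 < r then 1 else 0)
    (n + m + 1) ?_ ⟨hr, hI, rfl, rfl, fun _ => le_rfl, fun P hP => .inl hP, fun _ => hsep⟩
    hcard).le
    (by unfold costRoute; exact Nat.mul_le_mul (by omega) (by omega))
  rintro r s₁ ⟨h1, h2, h3, h4, h5, h6, h7⟩
  split_ifs with hr
  swap
  · obtain rfl : r = 0 := le_antisymm (not_lt.1 hr) h1
    rw [add_zero] at h2
    exact pure ⟨h2, h3, h4, h5, h6⟩
  have hq₁ : s₁.loc q = some v := h4 ▸ hq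
  have hdq : (s₁.setDem q (c + r)).dem q = c + r := by simp [St.setDem]
  refine rd_bind_eq (c := costTrace (n + m) + 7 * n + 4) (some v) (fun _ => hq₁)
    (rd_bind_eq (c := costTrace (n + m) + 7 * n + 3) (s₁.trail q) (fun _ => rfl) ?_)
  refine bind (traceBack (mark := mark) (v := v) hG χ hv ?_ ?_) (c₂ := 7 * n + 3) ?_ (by omega)
  · intro e he1 he2 he3
    exact hS.src_mark e he1 (h2.supp he2) he3
  · intro u _ hu
    exact h2.exists_in hL hw hC hr hq₁ (by rw [hdq, hc]) hu
  rintro ⟨u, p, p'⟩ s₁ ⟨rfl, hp1, hp2, hp3, hp4, hp5⟩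
  dsimp only at hp1 hp2 hp3 hp4 hp5
  subst hp1
  refine rd_bind_eq (c := 7 * n + 2) (s₁.flow (.inr u)) (fun _ => rfl) ?_
  have hlen := (hp2.length_lt hG).le
  refine bind (minFlow p (min r (s₁.flow (.inr u)))) (c₂ := 5 * n + 2) ?_ (by omega)
  rintro δ s₁ ⟨rfl, hδ1, hδ2, hδ3⟩
  have hδr : δ ≤ r := hδ1.trans (min_le_left _ _)
  have hδu : δ ≤ s₁.flow (.inr u) := hδ1.trans (min_le_right _ _)
  have hδ : 0 < δ := by
    rcases hδ3 with rfl | ⟨e, he, rfl⟩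
    · exact lt_min hr hp4
    · exact (hp5 e he).1
  obtain ⟨v', hv1, hv2⟩ := h2.core.walk q (by rw [hdq]; linarith)
  obtain rfl : v = v' := by
    have : (s₁.setDem q (c + r)).loc q = some v := hq₁
    rw [this] at hv1
    simpa using hv1
  have hwalk : G.IsWalk u q (p ++ s₁.trail q) := hp2.append hv2
  have hnew : ∀ P ∈ s₁.paths, P.sink = q → P.source ≠ u := by
    rintro P hP hPq rfl
    rcases h7 hr P hP hPq with h8 | h8
    · exact hp4.ne' h8
    · obtain ⟨e, he1, he2⟩ := h8 v p (hPq ▸ hq₁) hp2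
      exact (hp5 e he1).1.ne' he2
  have hdqt : q = t → s₀.flow (.inl a') ≤ (s₁.setDem q (c + r)).dem q - δ := by
    intro hqt
    rw [hdq, hc, if_pos hqt]
    linarith
  have hV := h2.routeVia hG (δ := δ) hq₁ hv hp3 hp2 hδ (by rw [hdq]; linarith) hdqt hδu hδ2
    (fun e he => (hp5 e he).2) hnew
  rw [← setDem_sent] at hV
  have hz : ∀ a, s₁.flow a = 0 → (s₁.sent u q p δ).flow a = 0 := fun a ha =>
    le_antisymm (ha ▸ sent_flow_le hδ.le a) (hV.core.flow_nonneg a)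
  have hpos : ∀ a, 0 < (s₁.sent u q p δ).flow a → 0 < s₁.flow a := fun a ha =>
    ha.trans_le (sent_flow_le hδ.le a)
  have hsat : δ < r → (s₁.sent u q p δ).flow (.inr u) = 0 ∨
      ∃ e ∈ p, (s₁.sent u q p δ).flow (.inl e) = 0 := by
    intro hlt
    rcases hδ3 with h8 | ⟨e, he, h8⟩
    · left
      rcases min_choice r (s₁.flow (.inr u)) with h9 | h9
      · linarith
      · simp [St.sent, St.routeVia, h8.trans h9]
    · exact .inr ⟨e, he, by simp [St.sent, St.routeVia, he, h8]⟩
  refine send_bind (c := 0) (s := s₁) (u := u) (q := q) (p := p) (δ := δ)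
    (g := fun _ => Pure.pure (Sum.inl (r - δ))) rfl (hwalk.arcs_nodup hG) (hwalk.length_lt hG).le ?_
  refine pure ⟨⟨by linarith, hV, h3, h4, fun a => (sent_flow_le hδ.le a).trans (h5 a), ?_, ?_⟩, ?_⟩
  · intro P hP
    rcases List.mem_cons.1 hP with rfl | hP
    · exact .inr ⟨rfl, hp3⟩
    · exact h6 P hP
  · intro hlt P hP hPq
    rcases List.mem_cons.1 hP with rfl | hP
    · rcases hsat (by linarith) with h8 | ⟨e, he, h8⟩
      · exact .inl h8
      · refine .inr fun y p' hy hp' => ?_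
        by_contra hne
        push Not at hne
        obtain rfl : v = y := by
          have : s₁.loc q = some y := hy
          rw [hq₁] at this
          simpa using this
        -- Out-degrees in the digraph are at most one, so a present walk from `u` to `v` would have
        -- to be `p` itself, which contains a saturated arc.
        have hpp : p = p' := by
          refine hp2.unique hG (Pres := fun e => 0 < s₀.flow (.inl e))
            (S := fun y => mark y = true) (fun e e' h9 h10 h11 h12 => ?_) (fun e h9 h10 => ?_) hp3
            hp' (fun e he => h2.supp (hp5 e he).1) (fun e he => ?_)
          · exact hL.src_inj (hS.deg_le _ h11) h9 h10 rfl h12.symm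
          · exact (hS.dst_mark hL hw h9 h10).1
          · refine h2.supp (V := s₁.setDem q (c + r)) (a := .inl e) (hpos _ ?_)
            exact (hV.core.flow_nonneg (.inl e)).lt_of_ne' (hne e he)
        exact hne e (hpp ▸ he) h8
    · exact (h7 hr P hP hPq).mono hz fun y hy => .inl hy
  · have hle : (Finset.univ.filter fun a => 0 < (s₁.sent u q p δ).flow a).card ≤
        (Finset.univ.filter fun a => 0 < s₁.flow a).card :=
      Finset.card_le_card fun a => by simpa using hpos a
    split_ifs with hlt
    · refine Nat.add_lt_add_right ?_ 1
      rcases hsat (by linarith) with h8 | ⟨e, he, h8⟩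
      · exact present_card_lt hpos hp4 h8
      · exact present_card_lt hpos (hp5 e he).1 h8
    · omega

end Transship

namespace Transship

variable {n m : ℕ} {G : Network n m} {b : Fin n → ℝ} {x : Fin m → ℝ} {s s₀ V : St n m}
  {lab : Labels n} {w : Fin n} {a' : Fin m} {mark : Fin n → Bool} {t : Fin n}

/-! ## Treatment of the singular digraph -/

/-- When all demand has been routed, except for the part of the split sink that is to be moved
along `a'`, then no flow is left in the singular digraph. -/
theorem RouteInv.flow_eq_zero (hG : G.Acyclic) (h : RouteInv G b s₀ w a' mark t V)
    (hL : IsLabels G s₀ lab) (hw : IsJunction G s₀ lab w a') (hS : IsSingular G s₀ lab w a' mark)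
    (hC : Core G b s₀) (ht : V.dem t = s₀.flow (.inl a'))
    (ho : ∀ r v, r ≠ t → 0 < V.dem r → V.loc r = some v → mark v = false)
    {a : ExtArc n m} (ha : mark (G.head a) = true) (hne : a ≠ .inl a') : V.flow a = 0 := by
  have hdw : demandAt V w = s₀.flow (.inl a') := by
    rw [← ht]
    refine demandAt_eq h.split_loc (fun r h1 h2 => ?_) h.core.dem_nonneg
    by_contra h3
    have := ho r w h3 h2 h1
    rw [hS.root] at this
    simp at this
  have hd0 : ∀ u, mark u = true → u ≠ w → demandAt V u = 0 := by
    intro u hu huw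
    refine Finset.sum_eq_zero fun r _ => ?_
    split_ifs with h1
    · by_contra h2
      have hr : r ≠ t := by
        rintro rfl
        rw [h.split_loc] at h1
        exact huw (by simpa using h1.symm)
      have := ho r u hr ((h.core.dem_nonneg r).lt_of_ne' h2) h1
      rw [hu] at this
      simp at this
    · rfl
  have how : outflow G V w = 0 := outflow_eq_zero fun e he => le_antisymm
    ((hw.flow_eq_zero hL hC he) ▸ h.flow_le (.inl e)) (h.core.flow_nonneg _)
  -- At `w` the remaining demand is used up by the flow on `a'`. At the other marked vertices no
  -- demand is left, so flow that enters also leaves, which acyclicity forbids forever.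
  have step : ∀ a : ExtArc n m, mark (G.head a) = true → a ≠ .inl a' → 0 < V.flow a →
      ∃ e, G.src e = G.head a ∧ mark (G.dst e) = true ∧ e ≠ a' ∧ 0 < V.flow (.inl e) := by
    intro a ha hne hpos
    by_cases haw : G.head a = w
    · have h1 := h.core.flow_add_le hne (haw.trans hw.dst.symm)
      rw [hw.dst, how, hdw, h.junction] at h1
      linarith
    · have h1 := h.core.flow_le a
      rw [hd0 _ ha haw, add_zero] at h1
      obtain ⟨e, he, h2⟩ : ∃ e, G.src e = G.head a ∧ 0 < V.flow (.inl e) := by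
        by_contra hno
        push Not at hno
        have := outflow_eq_zero (s := V) fun e he =>
          le_antisymm (hno e he) (h.core.flow_nonneg (.inl e))
        linarith
      have h3 := hS.dst_mark hL hw (h.supp h2) (by rw [he]; exact ha)
      exact ⟨e, he, h3.1, h3.2, h2⟩
  by_contra hpos
  have hpos := (h.core.flow_nonneg a).lt_of_ne' hpos
  obtain ⟨e, -, h1⟩ := step a ha hne hpos
  refine G.not_of_propagates hG (P := fun e => mark (G.dst e) = true ∧ e ≠ a' ∧
    0 < V.flow (.inl e)) ?_ e h1
  rintro e ⟨h2, h3, h4⟩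
  exact step (.inl e) h2 (by simpa using h3) h4

/-- The state after the treatment of the singular digraph. -/
theorem RouteInv.mid (hG : G.Acyclic) (h : RouteInv G b s₀ w a' mark t V) (hL : IsLabels G s₀ lab)
    (hw : IsJunction G s₀ lab w a') (hS : IsSingular G s₀ lab w a' mark)
    (hst : StartInv G b x s₀) (hM : MidInv G b x s₀ lab s₀) (hN : NoReturn G V)
    (ht : V.dem t = s₀.flow (.inl a'))
    (ho : ∀ r v, r ≠ t → 0 < V.dem r → V.loc r = some v → mark v = false) :
    MidInv G b x s₀ lab (V.moved G t (.inl a')) ∧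
      (V.moved G t (.inl a')).potential < s₀.potential := by
  have hpos := hw.pos
  have hm : Movable G V t (.inl a') :=
    ⟨by rw [ht]; exact hpos, by rw [h.split_loc, ← hw.dst]; rfl, by rw [ht, h.junction]⟩
  have hcore := hm.core hG h.core hN
  have hle : ∀ a, (V.moved G t (.inl a')).flow a ≤ s₀.flow a := fun a =>
    (hm.flow_le a).trans (h.flow_le a)
  have ha' : (V.moved G t (.inl a')).flow (.inl a') = 0 := by
    rw [Movable.flow_eq, if_pos rfl, h.junction, ht, sub_self]
  have hz : ∀ a, mark (G.head a) = true → (V.moved G t (.inl a')).flow a = 0 := by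
    intro a ha
    by_cases hne : a = .inl a'
    · rw [hne, ha']
    · refine le_antisymm ?_ (hcore.flow_nonneg a)
      rw [← h.flow_eq_zero hG hL hw hS hst.core ht ho ha hne]
      exact hm.flow_le a
  have hz0 : ∀ a, s₀.flow a = 0 → (V.moved G t (.inl a')).flow a = 0 := fun a ha =>
    le_antisymm (ha ▸ hle a) (hcore.flow_nonneg a)
  have hirr : ∀ r c, Irregular G (V.moved G t (.inl a')) r c → Irregular G s₀ r c ∨
      r = t ∧ G.head c = G.src a' := by
    intro r c hi
    rcases moved_loc_dem hi.pos with ⟨-, h1, h2⟩ | ⟨rfl, e, he, h1, h2⟩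
    · left
      have h3 : 0 < V.dem r := h1 ▸ hi.pos
      have h4 : s₀.loc r = some (G.head c) := by rw [← h.loc r h3, ← h2, hi.loc]
      -- All arcs into marked vertices are empty by now. An irregular sink other than `t` is thus at
      -- an unmarked vertex, where its demand is unchanged, and it was irregular before.
      have hmark : mark (G.head c) = false := by
        by_contra hmk
        have := hi.lt
        rw [hz c (by simpa using hmk)] at this
        exact lt_asymm this hi.pos
      have h5 := h.dem_unmarked r _ h4 hmark
      exact ⟨h5 ▸ h3, h4, h5 ▸ h1 ▸ hi.lt.trans_le (hle c)⟩
    · obtain rfl : a' = e := by simpa using he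
      exact .inr ⟨rfl, by simpa [h2] using hi.loc.symm⟩
  -- The tail of `a'` had outgoing flow, so no sink was irregular there and the split sink is the
  -- only candidate.
  have hsrc : ∀ r c, Irregular G s₀ r c → G.head c ≠ G.src a' := fun r c hi hc =>
    hpos.ne' (hst.irr_out r c hi a' hc.symm)
  refine ⟨⟨hcore, hm.noReturn hN, fun c hc => hc.trans_le (hle c), ?_, ?_, ?_⟩, ?_⟩
  · intro r c hb hi e he
    rcases hirr r c hi with h1 | ⟨rfl, h1⟩
    · exact hz0 _ (hst.irr_out r c h1 e he)
    · by_cases hea : e = a'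
      · rw [hea, ha']
      · have hd : lab.deg (G.src a') ≤ 1 := by
          by_contra hd
          have := hL.branching_of_deg (G.src a') (by omega)
          rw [← h1, hb] at this
          simp at this
        refine hz0 _ (le_antisymm (not_lt.1 fun h2 => ?_) (hst.core.flow_nonneg _))
        exact hea (hL.src_inj hd h2 hpos (he.trans h1) rfl)
  · intro r c r' c' _ hi hi' hcc
    rcases hirr r c hi with h1 | ⟨rfl, h1⟩ <;> rcases hirr r' c' hi' with h2 | ⟨rfl, h2⟩
    · exact hst.irr_unique r c r' c' h1 h2 hcc
    · exact absurd (hcc.trans h2) (hsrc r c h1)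
    · exact absurd (hcc.symm.trans h1) (hsrc r' c' h2)
    · rfl
  · intro e
    have h1 := hm.routed hG h.core e
    have h2 := h.routed e
    have h3 := hle (.inl e)
    rcases hM.low e with ⟨h4, h5⟩ | h4
    · exact .inl ⟨h4, by linarith⟩
    · exact .inr (by linarith)
  · refine (hm.potential hG h.core).trans_le (potential_le_of_le (fun a => h.supp) fun r => ?_)
    rw [h.trail]
    have := h.dem_le r
    split_ifs with h1 h2
    · exact le_rfl
    · exact absurd (h1.trans_le this) h2
    · exact Nat.zero_le _
    · exact le_rfl

/-- A bound on the number of steps of the treatment of a singular digraph. -/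
def costProcess (N : ℕ) : ℕ :=
  1 + N + N + (N + 1) * (N + N + 1 + costRoute N + 2 + 1) + 1 + costRoute N + 1 + N * 2 +
    (2 * N + 7)

theorem RouteInv.init (hst : StartInv G b x s₀) (hl : s₀.loc t = some w)
    (hd : s₀.flow (.inl a') ≤ s₀.dem t) : RouteInv G b s₀ w a' mark t s₀ :=
  ⟨hst.core, fun _ => le_rfl, fun _ _ => rfl, rfl, fun _ _ => rfl, rfl, fun _ => le_rfl,
    fun _ _ _ _ => rfl, hl, hd, fun _ => rfl⟩

theorem setDem_self (s : St n m) (q : Fin n) : s.setDem q (s.dem q) = s := by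
  simp [St.setDem]

theorem clear_setDem (s : St n m) (q : Fin n) (r : ℝ) : (s.setDem q r).clear q = s.clear q := by
  simp [St.clear, St.setDem]

/-- Every round finishes one active sink. New paths end at a finished sink, so `NoReturn` is
restored at once. -/
theorem Runs.routeOthers (hG : G.Acyclic) (χ : ℕ → Bool) (hL : IsLabels G s₀ lab)
    (hw : IsJunction G s₀ lab w a') (hS : IsSingular G s₀ lab w a' mark) (hC : Core G b s₀)
    (hI : RouteInv G b s₀ w a' mark t s) (hN : NoReturn G s) :
    Runs (Transship.loop (fun _ => do
      let others ← Transship.collect (fun s r => decide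
        (r ≠ t ∧ 0 < s.dem r) && (s.loc r).any mark) verts
      match others with
      | [] => return .inr ()
      | _ :: _ => do
        let r ← Transship.pick χ others
        let d ← Transship.rd fun s => s.dem r
        Transship.routeDemand G χ a' r d
        Transship.finish r
        return .inl ()) ()) ((n + 1) * (n + n + 1 + costRoute (n + m) + 2 + 1)) s
      fun (_ : Unit) s' => RouteInv G b s₀ w a' mark t s' ∧ NoReturn G s' ∧ s'.dem t = s.dem t ∧
        ∀ r v, r ≠ t → 0 < s'.dem r → s'.loc r = some v → mark v = false := by
  refine loop (fun _ s' => RouteInv G b s₀ w a' mark t s' ∧ NoReturn G s' ∧ s'.dem t = s.dem t)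
    (fun _ s' => (Finset.univ.filter fun r => 0 < s'.dem r).card) n ?_ ⟨hI, hN, rfl⟩
    ((Finset.card_le_univ _).trans (by simp))
  rintro - s ⟨hI, hN, hd⟩
  refine (collect_bind (c := n + 1 + costRoute (n + m) + 2)
    (fun r => decide (r ≠ t ∧ 0 < s.dem r) && (s.loc r).any mark)
    (fun _ _ => rfl) ?_).le (by rw [length_verts]; omega)
  have hlen := List.length_filter_le
    (fun r => decide (r ≠ t ∧ 0 < s.dem r) && (s.loc r).any mark) verts
  rw [length_verts] at hlen
  have hmem : ∀ r, r ∈ verts.filter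
      (fun r => decide (r ≠ t ∧ 0 < s.dem r) && (s.loc r).any mark) ↔
      r ≠ t ∧ 0 < s.dem r ∧ ∃ v, s.loc r = some v ∧ mark v = true := by
    intro r
    simp [mem_verts, Option.any_eq_true, and_assoc]
  rcases hl : verts.filter
    (fun r => decide (r ≠ t ∧ 0 < s.dem r) && (s.loc r).any mark) with _ | ⟨r₀, l⟩
  · rw [hl] at hmem
    refine pure ⟨hI, hN, hd, fun r v h1 h2 h3 => ?_⟩
    by_contra h4
    have := (hmem r).2 ⟨h1, h2, v, h3, by simpa using h4⟩
    simp at this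
  · rw [hl] at hmem hlen
    refine (pick_bind (c := 1 + costRoute (n + m) + 2) (by simp) fun r hr => ?_).le (by omega)
    obtain ⟨h1, h2, v, h3, h4⟩ := (hmem r).1 hr
    refine rd_bind_eq (c := costRoute (n + m) + 2) (s.dem r) (fun _ => rfl) ?_ |>.le (by omega)
    refine bind (routeDemand (c := 0) (t := t) hG χ hL hw hS hC (by rw [if_neg h1]) h2.le ?_ h3
      h4 ?_) (c₂ := 2) ?_ le_rfl
    · rw [zero_add, setDem_self]
      exact hI
    · rintro P hP rfl
      exact (hN P hP).resolve_left h2.ne'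
    · rintro _ s' ⟨h5, h6, h7, h8, h9⟩
      refine bind (c₂ := 0) finish ?_ le_rfl
      rintro _ _ rfl
      have h10 := h5.clear h1 (by simp [St.setDem])
      rw [clear_setDem] at h10
      have hz : ∀ a, s.flow a = 0 → (s'.clear r).flow a = 0 := fun a ha =>
        le_antisymm (ha ▸ h8 a) (h10.core.flow_nonneg a)
      refine pure ⟨⟨h10, ?_, ?_⟩, ?_⟩
      · intro P hP
        by_cases hPr : P.sink = r
        · exact .inl (by simp [St.clear, hPr])
        · rcases h9 P hP with h11 | h11
          · refine (hN P h11).imp (fun h12 => ?_) fun h12 => h12.mono hz fun v hv => ?_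
            · simpa [St.clear, hPr, h6] using h12
            · exact .inl (by simpa [St.clear, hPr, h7] using hv)
          · exact absurd h11.1 hPr
      · rw [← hd]
        simp [St.clear, h1.symm, h6]
      · refine Finset.card_lt_card ((Finset.ssubset_iff_of_subset fun q hq => ?_).2 ⟨r, ?_⟩)
        · simp only [Finset.mem_filter_univ] at hq ⊢
          by_cases hqr : q = r
          · subst hqr; exact h2
          · simpa [St.clear, hqr, h6] using hq
        · simp only [Finset.mem_filter_univ]
          exact ⟨h2, by simp [St.clear]⟩

/-- The split sink remains active after some of its demand has been output. Its paths stay separated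
because the singular digraph is completely empty afterwards. -/
theorem Runs.processDigraph (hG : G.Acyclic) (χ : ℕ → Bool) (hL : IsLabels G s lab)
    (hw : IsJunction G s lab w a') (hS : IsSingular G s lab w a' mark) (hst : StartInv G b x s)
    (hM : MidInv G b x s lab s) {E : List (ExtArc n m)} (hlen : E.length ≤ n + m)
    (hE : ∀ a ∈ E, mark (G.head a) = true ∧ a ≠ .inl a') :
    Runs (processDigraph G χ w a' mark E) (costProcess (n + m)) s fun _ s' =>
      MidInv G b x s lab s' ∧ s'.potential < s.potential := by
  have hf := hw.pos
  refine rd_bind_eq (c := n + (n + ((n + 1) * (n + n + 1 + costRoute (n + m) + 2 + 1) +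
    (1 + (costRoute (n + m) + (1 + ((n + m) * 2 + (2 * n + 7)))))))) (s.flow (.inl a'))
    (fun _ => rfl) ?_ |>.le (by
      have : (n + 1) * (n + n + 1 + costRoute (n + m) + 2 + 1) ≤ (n + m + 1) *
        (n + m + (n + m) + 1 + costRoute (n + m) + 2 + 1) :=
        Nat.mul_le_mul (by omega) (by omega)
      unfold costProcess
      omega)
  refine (collect_bind (fun t => decide (s.loc t = some w ∧ s.flow (.inl a') < s.dem t))
    (fun _ _ => rfl) ?_).le (by rw [length_verts])
  have hlen' := List.length_filter_le
    (fun t => decide (s.loc t = some w ∧ s.flow (.inl a') < s.dem t)) verts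
  rw [length_verts] at hlen'
  -- A sink to be split exists since `a'` is present and nothing leaves its head.
  obtain ⟨t₀, h1, -, h2⟩ := hst.exists_lt (a := .inl a') hf (.inl (outflow_eq_zero fun e he =>
    hw.flow_eq_zero hL hst.core (he.trans hw.dst)))
  replace h1 : s.loc t₀ = some w := by rw [h1, ← hw.dst]; rfl
  refine (pick_bind (List.ne_nil_of_mem (a := t₀) (List.mem_filter.2 ⟨mem_verts _, by
    simpa using ⟨h1, h2⟩⟩)) fun t ht => ?_).le (Nat.add_le_add_right hlen' _)
  rw [List.mem_filter, decide_eq_true_eq] at ht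
  obtain ⟨-, h3, h4⟩ := ht
  refine bind (routeOthers (t := t) (mark := mark) hG χ hL hw hS hst.core
    (RouteInv.init hst h3 h4.le) hst.noReturn) ?_ le_rfl
  rintro _ s₁ ⟨hI, hN, hd, ho⟩
  rw [add_comm 1]
  refine rd_bind_eq (s₁.dem t) (fun _ => rfl) ?_
  refine bind (routeDemand (t := t) (c := s.flow (.inl a')) hG χ hL hw hS hst.core
    (by rw [if_pos rfl]) (by rw [hd]; linarith) ?_ hI.split_loc hS.root ?_) ?_ le_rfl
  · rw [add_sub_cancel, setDem_self]
    exact hI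
  · rintro P hP rfl
    refine (hN P hP).resolve_left ?_
    rw [hd]
    linarith
  rintro _ s₂ ⟨hI₂, h5, h6, h7, h8⟩
  rw [add_comm 1]
  refine wrDem_bind ?_
  change Runs _ _ (s₂.setDem t (s.flow (.inl a'))) _
  set V := s₂.setDem t (s.flow (.inl a')) with hV
  have hVt : V.dem t = s.flow (.inl a') := by simp [hV, St.setDem]
  have hVo : ∀ r v, r ≠ t → 0 < V.dem r → V.loc r = some v → mark v = false := by
    intro r v hrt hr hv
    refine ho r v hrt ?_ ?_
    · simpa [hV, St.setDem, hrt, h5] using hr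
    · rw [← h6]; exact hv
  have hz : ∀ a, mark (G.head a) = true → a ≠ .inl a' → V.flow a = 0 := fun a =>
    hI₂.flow_eq_zero hG hL hw hS hst.core hVt hVo
  have hVN : NoReturn G V := by
    intro P hP
    rcases h8 P hP with h9 | ⟨rfl, h9⟩
    · have hz' : ∀ a, s₁.flow a = 0 → V.flow a = 0 := fun a ha =>
        le_antisymm (ha ▸ h7 a) (hI₂.core.flow_nonneg a)
      refine (hN P h9).imp (fun h10 => ?_) fun h10 => h10.mono hz' fun v hv => .inl ?_
      · have : P.sink ≠ t := by
          rintro rfl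
          rw [hd] at h10
          linarith
        simpa [hV, St.setDem, this, h5] using h10
      · rw [← h6]; exact hv
    -- A path output for `t` starts at a marked source, whose dummy arc has been emptied.
    · exact .inr (.inl (hz (.inr P.source) h9 (by simp)))
  refine bind (c₁ := (n + m) * 2) (c₂ := 2 * n + 7) (Q' := fun _ s' => s' = V) ?_ ?_ le_rfl
  · refine (forEach (k := 1) (fun l _ s' => (∀ a ∈ l, a ∈ E) ∧ s' = V) ?_ E () V
      ⟨fun _ h => h, rfl⟩).mono (Nat.mul_le_mul_right _ hlen) fun _ _ h => h.2
    rintro a l _ _ ⟨h9, rfl⟩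
    refine wr (s' := V) (fun k => ?_) ⟨fun c hc => h9 c (List.mem_cons_of_mem _ hc), rfl⟩
    have h10 := hE a (h9 a (by simp))
    -- The removal changes nothing, as these arcs carry no flow any more.
    have h11 : Function.update V.flow a 0 = V.flow := by
      rw [← hz a h10.1 h10.2, Function.update_eq_self]
    exact congrArg (fun f => ({ V with flow := f } : St n m).mem k) h11
  · rintro _ _ rfl
    have htr := hI₂.core.trail_nodup hG (hVt ▸ hf)
    refine (moveSink (.inl a') htr.1 htr.2.le).mono le_rfl ?_
    rintro _ _ rfl
    exact hI₂.mid hG hL hw hS hst hM hVN hVt hVo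

end Transship

namespace Transship

variable {n m : ℕ} {G : Network n m} {b : Fin n → ℝ} {x : Fin m → ℝ} {s : St n m}
  {lab : Labels n}

/-! ## The phases of the algorithm -/

/-- The memory at the beginning. -/
noncomputable def St.zero (n m : ℕ) : St n m :=
  ⟨fun _ => 0, fun _ => none, fun _ => 0, fun _ => [], [], fun _ => 0⟩

/-- The state after the setup. -/
noncomputable def St.initial (b : Fin n → ℝ) (x : Fin m → ℝ) : St n m :=
  { St.zero n m with
    flow := Sum.elim x fun v => max (b v) 0
    loc := fun v => if b v < 0 then some v else none
    dem := fun v => max (-b v) 0 }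

theorem Runs.setup (b : Fin n → ℝ) (x : Fin m → ℝ) :
    Runs (setup b x) (2 * m + 3 * n) (St.zero n m) fun _ s' => s' = St.initial b x := by
  refine bind (c₂ := 3 * n) (forEach (k := 1) (fun l _ s' => ∃ d, arcs = d ++ l ∧
    s' = { St.zero n m with flow := Sum.elim (fun e => if e ∈ d then x e else 0) fun _ => 0 })
    ?_ arcs () _ ⟨[], rfl, ?_⟩) ?_ (by rw [length_arcs]; omega)
  · rintro e l _ _ ⟨d, hd, rfl⟩
    refine wr (s' := { St.zero n m with
      flow := Sum.elim (fun e' => if e' ∈ d ++ [e] then x e' else 0) fun _ => 0 }) (fun k => ?_)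
      ⟨d ++ [e], by simp [hd], rfl⟩
    simp only [St.mem, Memory.mk.injEq, true_and, and_true]
    ext (e' | v)
    · by_cases he : e' = e
      · subst he; simp
      · simp [he]
    · simp
  · simp only [St.zero, St.mk.injEq, and_true]
    ext (e | v) <;> simp
  rintro _ _ ⟨d, hd, rfl⟩
  rw [List.append_nil] at hd
  subst hd
  refine (forEach (k := 2) (fun l _ s' => ∃ d, verts = d ++ l ∧ s' = { St.zero n m with
      flow := Sum.elim x fun v => if v ∈ d then max (b v) 0 else 0
      loc := fun v => if v ∈ d ∧ b v < 0 then some v else none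
      dem := fun v => if v ∈ d then max (-b v) 0 else 0 }) ?_ verts () _ ⟨[], rfl, ?_⟩).mono
    (by rw [length_verts]; omega) ?_
  · rintro v l _ _ ⟨d, hd, rfl⟩
    have hvd : v ∉ d := fun h => by
      have h1 : (verts : List (Fin n)).Nodup := List.nodup_finRange n
      rw [hd] at h1
      exact (List.nodup_append.1 h1).2.2 v h v (by simp) rfl
    have key : ∀ (F : ExtArc n m → ℝ) (L : Fin n → Option (Fin n)) (D : Fin n → ℝ),
        (∀ a, F a = Sum.elim x (fun u => if u ∈ d ++ [v] then max (b u) 0 else 0) a) →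
        (∀ u, L u = if u ∈ d ++ [v] ∧ b u < 0 then some u else none) →
        (∀ u, D u = if u ∈ d ++ [v] then max (-b u) 0 else 0) →
        ∃ d', verts = d' ++ l ∧ ({ St.zero n m with flow := F, loc := L, dem := D } : St n m) =
          { St.zero n m with
            flow := Sum.elim x fun v => if v ∈ d' then max (b v) 0 else 0
            loc := fun v => if v ∈ d' ∧ b v < 0 then some v else none
            dem := fun v => if v ∈ d' then max (-b v) 0 else 0 } := by
      intro F L D hF hL hD
      refine ⟨d ++ [v], by simp [hd], ?_⟩
      rw [funext hF, funext hL, funext hD]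
    split_ifs with h1 h2
    · refine (wr (c := 0) (fun _ => rfl) (key
        (Function.update (Sum.elim x fun v => if v ∈ d then max (b v) 0 else 0)
          (.inr v) (b v))
        (fun v => if v ∈ d ∧ b v < 0 then some v else none)
        (fun v => if v ∈ d then max (-b v) 0 else 0) ?_ ?_ ?_)).le (by omega)
      · rintro (e | u)
        · simp
        · by_cases hu : u = v
          · subst hu; simp [h1.le]
          · simp [hu]
      · intro u
        by_cases hu : u = v
        · subst hu; simp [hvd, not_lt.2 h1.le]
        · simp [hu]
      · intro u
        by_cases hu : u = v
        · subst hu; simp [h1.le, hvd]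
        · simp [hu]
    · refine wrLoc_bind (c := 1) (wr (c := 0) (fun _ => rfl) (key
        (Sum.elim x fun v => if v ∈ d then max (b v) 0 else 0)
        (Function.update (fun v => if v ∈ d ∧ b v < 0 then some v else none) v (some v))
        (Function.update (fun v => if v ∈ d then max (-b v) 0 else 0) v (-b v)) ?_ ?_ ?_))
      · rintro (e | u)
        · simp
        · by_cases hu : u = v
          · subst hu; simp [h2.le]
          · simp [hu]
      · intro u
        by_cases hu : u = v
        · subst hu; simp [h2]
        · simp [hu]
      · intro u
        by_cases hu : u = v
        · subst hu; simp [h2.le]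
        · simp [hu]
    · have h3 : b v = 0 := le_antisymm (not_lt.1 h1) (not_lt.1 h2)
      refine pure (key _ _ _ ?_ ?_ ?_)
      · rintro (e | u)
        · simp
        · by_cases hu : u = v
          · subst hu; simp [h3]
          · simp [hu]
      · intro u
        by_cases hu : u = v
        · subst hu; simp [h3, hvd]
        · simp [hu]
      · intro u
        by_cases hu : u = v
        · subst hu; simp [h3]
        · simp [hu]
  · simp only [St.zero, St.mk.injEq, and_true]
    refine ⟨?_, by simp, by simp⟩
    ext (e | v) <;> simp [mem_arcs]
  · rintro _ _ ⟨d, hd, rfl⟩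
    rw [List.append_nil] at hd
    subst hd
    simp [St.initial, mem_verts]

theorem core_initial (hx : IsTransshipment G b x) : Core G b (St.initial b x) where
  flow_nonneg a := by
    rcases a with e | v
    · exact hx.1 e
    · exact le_max_right _ _
  dem_nonneg t := le_max_right _ _
  conserve v := by
    have h1 := hx.2 v
    rw [Finset.sum_eq_single v]
    · simp only [St.initial, Sum.elim_inl, Sum.elim_inr, sum_inc_eq]
      rcases lt_or_ge (b v) 0 with h2 | h2
      · simp only [h2, if_true, max_eq_right h2.le, max_eq_left (neg_nonneg.2 h2.le)]
        linarith
      · simp only [not_lt.2 h2, if_false, reduceCtorEq, max_eq_left h2]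
        linarith
    · intro t _ ht
      rw [if_neg]
      simp only [St.initial]
      split_ifs <;> simp [ht]
    · simp
  walk t ht := by
    have hb : b t < 0 := by
      by_contra h
      simp [St.initial, not_lt.1 h] at ht
    exact ⟨t, by simp [St.initial, hb], rfl⟩
  source v := by simp [St.initial, St.zero]
  sink t := by simp [St.initial, St.zero]
  paths_walk P hP := by simp [St.initial, St.zero] at hP
  paths_pos P hP := by simp [St.initial, St.zero] at hP
  pairs := by simp [St.initial, St.zero]
  total e := by simp [St.initial, St.zero]

/-- A bound on the number of steps of the preliminary phase and of the moving phase. -/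
def costMoves (N : ℕ) : ℕ := (N + N * (N + 1) + 1) * (costMove N + 1)

theorem costMoves_mono : ((n + m) + n * (n + 1) + 1) * (costMove (n + m) + 1) ≤
    costMoves (n + m) := by
  refine Nat.mul_le_mul (Nat.add_le_add_right (Nat.add_le_add_left ?_ _) 1) le_rfl
  exact Nat.mul_le_mul (by omega) (by omega)

/-- When no move is left, every demand exceeds the flow on all arcs entering its vertex, so there
are no irregular sinks at all. -/
theorem Runs.preliminary (hG : G.Acyclic) (χ : ℕ → Bool) (hC : Core G b s) (hN : NoReturn G s)
    (hx : ∀ e, x e ≤ s.routed e + s.flow (.inl e)) :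
    Runs (preliminary G χ) (costMoves (n + m)) s fun _ s' => StartInv G b x s' := by
  refine (loop (k := costMove (n + m)) (fun _ s' => Core G b s' ∧ NoReturn G s' ∧
    ∀ e, x e ≤ s'.routed e + s'.flow (.inl e)) (fun _ s => s.potential) _ ?_ ⟨hC, hN, hx⟩
    (potential_le s)).le costMoves_mono
  rintro - s ⟨hC, hN, hx⟩
  have hmem : ∀ q : Fin n × ExtArc n m, q ∈ sinkArcPairs.filter (fun q => decide
      (0 < s.dem q.1 ∧ s.loc q.1 = some (G.head q.2) ∧ s.dem q.1 ≤ s.flow q.2)) ↔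
      Movable G s q.1 q.2 := by
    intro q
    rw [List.mem_filter, decide_eq_true_eq]
    exact (and_iff_right (List.mem_product.2 ⟨mem_verts _, mem_extArcs _⟩)).trans
      ⟨fun h => ⟨h.1, h.2.1, h.2.2⟩, fun h => ⟨h.1, h.2, h.3⟩⟩
  refine (collect_bind (c := n * (n + m) + (2 * n + 7)) (fun q => decide
      (0 < s.dem q.1 ∧ s.loc q.1 = some (G.head q.2) ∧ s.dem q.1 ≤ s.flow q.2))
      (fun _ _ => rfl) ?_).le
      (by rw [length_sinkArcPairs]; unfold costMove; nlinarith)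
  have hlen := List.length_filter_le (fun q => decide
      (0 < s.dem q.1 ∧ s.loc q.1 = some (G.head q.2) ∧ s.dem q.1 ≤ s.flow q.2))
      (sinkArcPairs : List (Fin n × ExtArc n m))
  rw [length_sinkArcPairs] at hlen
  rcases hl : (sinkArcPairs : List (Fin n × ExtArc n m)).filter _ with _ | ⟨q₀, l⟩
  · rw [hl] at hmem
    have hlt : ∀ t a, 0 < s.dem t → s.loc t = some (G.head a) → s.flow a < s.dem t := by
      intro t a h1 h2
      by_contra h3
      simpa using (hmem (t, a)).2 ⟨h1, h2, not_lt.1 h3⟩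
    have hirr : ∀ t a, ¬ Irregular G s t a := fun t a h => lt_asymm h.lt (hlt t a h.pos h.loc)
    exact pure ⟨hC, hN, fun t a h1 h2 => (hlt t a h1 h2).ne, fun t a h => absurd h (hirr t a),
      fun t a _ _ h => absurd h (hirr t a), fun e => .inl (hx e)⟩
  · rw [hl] at hmem hlen
    refine (pick_bind (by simp) (c := 2 * n + 7) fun q hq => ?_).le (Nat.add_le_add_right hlen _)
    have hm := (hmem q).1 hq
    have ht := hC.trail_nodup hG hm.pos
    refine bind (moveSink q.2 ht.1 ht.2.le) (c₂ := 0) ?_ le_rfl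
    rintro _ _ rfl
    refine pure ⟨⟨hm.core hG hC hN, hm.noReturn hN, fun e => ?_⟩, hm.potential hG hC⟩
    rw [hm.routed hG hC]
    exact hx e

/-- A bound on the number of steps of an iteration. -/
def costIteration (N : ℕ) : ℕ :=
  2 * N + 3 * N + N * (2 * N + 1) + (N + (N + ((N + 1) * (N + costRound N + 1) +
    (costAugment N + costProcess N + costMoves N))))

/-- The potential drops either in the main step or, after an augmentation that only created a
candidate, in the moving phase. -/
theorem Runs.iteration (hG : G.Acyclic) (hb : ∃ t, b t < 0) (χ : ℕ → Bool)
    (h : StartInv G b x s) (hd : ∃ t, 0 < s.dem t) :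
    Runs (iteration G χ) (costIteration (n + m)) s fun _ s' =>
      StartInv G b x s' ∧ s'.potential < s.potential := by
  refine bind computeLabels (c₂ := n + (n + ((n + 1) * (m + costRound (n + m) + 1) +
    (costAugment (n + m) + costProcess (n + m) + costMoves (n + m))))) ?_ ?_
  · rintro lab s ⟨rfl, hL⟩
    refine (collect_bind (fun v => decide (0 < lab.deg v)) (fun _ _ => rfl) ?_).le
      (by rw [length_verts])
    have hlen := List.length_filter_le (fun v => decide (0 < lab.deg v)) verts
    rw [length_verts] at hlen
    -- Otherwise only dummy arcs carry flow, and the dummy arc at the position of an active sink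
    -- would carry the whole demand there, contrary to `StartInv.exists_lt`.
    obtain ⟨v₀, hv₀⟩ : ∃ v, 0 < lab.deg v := by
      by_contra hne
      push Not at hne
      have hout : ∀ v, outflow G s v = 0 := fun v => outflow_eq_zero fun e he => by
        by_contra h1
        have := hL.deg_pos ((h.core.flow_nonneg (.inl e)).lt_of_ne' h1)
        have := hne (G.src e)
        omega
      obtain ⟨t, ht⟩ := hd
      obtain ⟨v, hv, -⟩ := h.core.walk t ht
      have h1 := h.core.inflow v
      rw [hout, zero_add, Finset.sum_eq_zero, add_zero] at h1
      · have h2 := h.core.demandAt_ge hv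
        obtain ⟨t', h3, -, h4⟩ := h.exists_lt (a := .inr v) (by linarith) (.inl (hout _))
        have h5 := h.core.demandAt_ge (v := v) h3
        linarith
      · intro e _
        by_contra h2
        have := hL.deg_pos ((h.core.flow_nonneg (.inl e)).lt_of_ne' h2)
        have := hne (G.src e)
        omega
    refine (pick_bind (List.ne_nil_of_mem (a := v₀) (List.mem_filter.2 ⟨mem_verts _, by
      simpa using hv₀⟩)) fun v hv => ?_).le (Nat.add_le_add_right hlen _)
    rw [List.mem_filter, decide_eq_true_eq] at hv
    refine bind (findCycle hG hL χ hv.2) ?_ le_rfl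
    have hM := h.mid hG hb hL
    rintro (C | ⟨w, a', mark, E⟩) s ⟨rfl, hF⟩
    · refine bind (augment hF) (c₂ := costMoves (n + m)) ?_ ?_
      · rintro _ _ ⟨ε, hε, rfl⟩
        obtain ⟨h1, h2⟩ := hM.augmented h hF hε
        refine ((moveSinks hG χ hL h1).mono costMoves_mono ?_)
        rintro _ s' ⟨h3, h4, h5⟩
        refine ⟨h3, ?_⟩
        rcases h2 with h2 | ⟨h2, h6⟩
        · exact h4.trans_lt h2
        · exact (h5 h6).trans_le h2
      · have : costAugment n ≤ costAugment (n + m) := by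
          unfold costAugment
          exact Nat.mul_le_mul (by omega) (by omega)
        omega
    · obtain ⟨hw, hS, hlen, hE⟩ := hF
      refine bind (processDigraph hG χ hL hw hS h hM hlen fun a ha =>
        ⟨((hE a).1 ha).1, ((hE a).1 ha).2.2⟩) (c₂ := costMoves (n + m)) ?_ (by omega)
      rintro _ s' ⟨h1, h2⟩
      refine ((moveSinks hG χ hL h1).mono costMoves_mono ?_)
      rintro _ s'' ⟨h3, h4, -⟩
      exact ⟨h3, h4.trans_lt h2⟩
  · have h1 : (n + 1) * (m + costRound (n + m) + 1) ≤
        (n + m + 1) * (n + m + costRound (n + m) + 1) :=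
      Nat.mul_le_mul (by omega) (by omega)
    have h2 : n * (2 * m + 1) ≤ (n + m) * (2 * (n + m) + 1) :=
      Nat.mul_le_mul (by omega) (by omega)
    unfold costIteration
    omega

/-! ## The output -/

theorem sum_paths_mul (hG : G.Acyclic) (v : Fin n) : ∀ {L : List (RoutedPath n m)},
    (∀ P ∈ L, G.IsWalk P.source P.sink P.arcs) →
    ∑ e, (L.map fun P => if e ∈ P.arcs then P.value else 0).sum * G.inc v e =
      (L.map fun P => if P.sink = v then P.value else 0).sum -
      (L.map fun P => if P.source = v then P.value else 0).sum
  | [], _ => by simp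
  | P :: L, h => by
    have h1 := h P (by simp)
    simp only [List.map_cons, List.sum_cons, add_mul, Finset.sum_add_distrib]
    rw [sum_paths_mul hG v fun Q hQ => h Q (by simp [hQ]), sum_mem_mul (h1.arcs_nodup hG),
      h1.sum_inc]
    split_ifs <;> ring

theorem le_sum_map {L : List (RoutedPath n m)} {f : RoutedPath n m → ℝ} (h0 : ∀ P ∈ L, 0 ≤ f P)
    {P : RoutedPath n m} (hP : P ∈ L) : f P ≤ (L.map f).sum :=
  List.single_le_sum (fun r hr => by
    obtain ⟨Q, hQ, rfl⟩ := List.mem_map.1 hr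
    exact h0 Q hQ) _ (List.mem_map_of_mem hP)

/-- Conservation summed over all vertices cancels the arcs of the digraph and leaves the nonnegative
dummy flows with sum zero. -/
theorem Core.dummy_eq_zero (h : Core G b s) (hd : ∀ t, s.dem t = 0) (v : Fin n) :
    s.flow (.inr v) = 0 := by
  have h1 : ∑ v, s.flow (.inr v) = 0 := by
    have h2 := Finset.sum_congr (s₁ := Finset.univ) rfl fun v _ => h.conserve v
    simp only [hd, ite_self, Finset.sum_const_zero, Finset.sum_add_distrib] at h2
    rw [Finset.sum_comm, add_eq_left.2] at h2
    · exact h2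
    · refine Finset.sum_eq_zero fun e _ => ?_
      rw [← Finset.mul_sum]
      simp [Network.inc]
  exact (Finset.sum_eq_zero_iff_of_nonneg fun v _ => h.flow_nonneg _).1 h1 v (Finset.mem_univ v)

theorem Core.isUnsplittable (hG : G.Acyclic) (h : Core G b s) (hd : ∀ t, s.dem t = 0) :
    IsUnsplittable G b s.total s.paths := by
  have hnn : ∀ P ∈ s.paths, 0 ≤ P.value := fun P hP => (h.paths_pos P hP).le
  refine ⟨⟨fun e => ?_, fun v => ?_⟩, fun P hP => ?_, fun P hP => ?_, fun P hP => ?_, h.paths_pos,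
    h.pairs, h.total⟩
  · rw [h.total]
    refine List.sum_nonneg fun r hr => ?_
    obtain ⟨P, hP, rfl⟩ := List.mem_map.1 hr
    split_ifs
    exacts [hnn P hP, le_rfl]
  · have h1 := sum_paths_mul hG v h.paths_walk
    have h2 := h.source v
    have h3 := h.sink v
    rw [h.dummy_eq_zero hd, zero_add] at h2
    rw [hd, zero_add] at h3
    simp only [← h.total] at h1
    rw [sum_inc_eq, h2, h3] at h1
    rcases le_total (b v) 0 with h4 | h4
    · rw [max_eq_left (by linarith), max_eq_right h4] at h1
      linarith
    · rw [max_eq_right (by linarith), max_eq_left h4] at h1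
      linarith
  -- The values of the paths from a vertex add up to the positive part of `b` there, so a path of
  -- positive value starts at a source. The same argument with the negative part applies to its
  -- sink.
  · have h1 := le_sum_map (f := fun Q => if Q.source = P.source then Q.value else 0)
      (fun Q hQ => by split_ifs; exacts [hnn Q hQ, le_rfl]) hP
    have h2 := h.source P.source
    have h3 := h.paths_pos P hP
    rw [h.dummy_eq_zero hd, zero_add] at h2
    rw [h2, if_pos rfl] at h1
    exact (lt_max_iff.1 (h3.trans_le h1)).resolve_right (lt_irrefl _)
  · have h1 := le_sum_map (f := fun Q => if Q.sink = P.sink then Q.value else 0)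
      (fun Q hQ => by split_ifs; exacts [hnn Q hQ, le_rfl]) hP
    have h2 := h.sink P.sink
    have h3 := h.paths_pos P hP
    rw [hd, zero_add] at h2
    rw [h2, if_pos rfl] at h1
    have := (lt_max_iff.1 (h3.trans_le h1)).resolve_right (lt_irrefl _)
    linarith
  · exact ⟨h.paths_walk P hP, (h.paths_walk P hP).nodup hG⟩

/-- Without demand, flow entering a vertex must leave it, so in an acyclic digraph none is left.
Both alternatives of `low` then bound the output, the first one because `d_max` is positive. -/
theorem StartInv.lower (hG : G.Acyclic) (hb : ∃ t, b t < 0) (h : StartInv G b x s)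
    (hd : ∀ t, s.dem t = 0) (e : Fin m) : x e - maxDemand b < s.total e := by
  have hr : s.routed e = s.total e := by simp [St.routed, hd]
  have hz : ¬ 0 < s.flow (.inl e) := by
    refine G.not_of_propagates hG (P := fun e => 0 < s.flow (.inl e)) (fun e he => ?_) e
    have h1 := h.core.flow_le (.inl e)
    have h2 : demandAt s (G.head (.inl e)) = 0 := Finset.sum_eq_zero fun t _ => by simp [hd]
    rw [h2, add_zero] at h1
    by_contra hne
    push Not at hne
    have h3 : outflow G s (G.dst e) = 0 := outflow_eq_zero fun e' he' =>
      le_antisymm (hne e' he') (h.core.flow_nonneg _)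
    exact absurd (he.trans_le h1) (not_lt.2 h3.le)
  have hz' : s.flow (.inl e) = 0 := le_antisymm (not_lt.1 hz) (h.core.flow_nonneg _)
  rcases h.low e with h1 | h1
  · obtain ⟨t, ht⟩ := hb
    have := abs_le_maxDemand ht
    rw [hz', hr] at h1
    linarith
  · rwa [hr] at h1

/-- A bound on the number of steps of the algorithm. -/
def costTotal (N : ℕ) : ℕ :=
  2 * N + 3 * N + (costMoves N + ((N + N * (N + 1) + 1) * (N + costIteration N + 1) + 2))

theorem Runs.adaptedDGG (hG : G.Acyclic) (hx : IsTransshipment G b x) (hb : ∃ t, b t < 0)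
    (χ : ℕ → Bool) : Runs (adaptedDGG G b x χ) (costTotal (n + m)) (St.zero n m) fun r _ =>
      IsUnsplittable G b r.1 r.2 ∧ ∀ e, x e - maxDemand b < r.1 e := by
  refine bind (setup b x) ?_ (c₂ := costMoves (n + m) + (((n + m) + (n + m) * (n + m + 1) + 1) *
    (n + m + costIteration (n + m) + 1) + 2)) (by unfold costTotal; omega)
  rintro _ _ rfl
  refine bind (preliminary (x := x) hG χ (core_initial hx) (by simp [NoReturn, St.initial, St.zero])
    (by simp [St.routed, St.initial, St.zero])) ?_ le_rfl
  rintro _ s hs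
  refine bind (loop (k := n + m + costIteration (n + m)) (fun _ s' => StartInv G b x s')
    (fun _ s => s.potential) _ ?_ hs (Q := fun _ s' => StartInv G b x s' ∧ ∀ t, s'.dem t = 0)
    ((potential_le s).trans (Nat.add_le_add_left (Nat.mul_le_mul (by omega) (by omega)) _)))
    (c₂ := 2) ?_ le_rfl
  · rintro - s hs
    refine (collect_bind (c := costIteration (n + m)) (fun t => decide (0 < s.dem t))
      (fun _ _ => rfl) ?_).le (by rw [length_verts]; omega)
    rcases hl : verts.filter fun t => decide (0 < s.dem t) with _ | ⟨t, l⟩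
    · refine pure ⟨hs, fun t => le_antisymm ?_ (hs.core.dem_nonneg t)⟩
      have := List.filter_eq_nil_iff.1 hl t (mem_verts t)
      simpa using this
    · have ht : t ∈ verts.filter fun t => decide (0 < s.dem t) := by rw [hl]; simp
      rw [List.mem_filter, decide_eq_true_eq] at ht
      refine bind (iteration hG hb χ hs ⟨t, ht.2⟩) (c₂ := 0) ?_ le_rfl
      rintro _ s' ⟨h1, h2⟩
      exact pure ⟨h1, h2⟩
  · rintro _ s ⟨hs, hd⟩
    refine rd_bind_eq s.total (fun _ => rfl) <| rd_bind_eq (c := 0) s.paths (fun _ => rfl) <|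
      pure ⟨hs.core.isUnsplittable hG hd, hs.lower hG hb hd⟩

/-! ## The step bound is a polynomial -/

/-- The function `f` is given by a polynomial. -/
def IsPoly (f : ℕ → ℕ) : Prop := ∃ p : Polynomial ℕ, ∀ N, p.eval N = f N

theorem IsPoly.const (c : ℕ) : IsPoly fun _ => c := ⟨Polynomial.C c, by simp⟩

theorem IsPoly.id : IsPoly fun N => N := ⟨Polynomial.X, by simp⟩

theorem IsPoly.add {f g : ℕ → ℕ} (hf : IsPoly f) (hg : IsPoly g) : IsPoly fun N => f N + g N := by
  obtain ⟨p, hp⟩ := hf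
  obtain ⟨q, hq⟩ := hg
  exact ⟨p + q, by simp [hp, hq]⟩

theorem IsPoly.mul {f g : ℕ → ℕ} (hf : IsPoly f) (hg : IsPoly g) : IsPoly fun N => f N * g N := by
  obtain ⟨p, hp⟩ := hf
  obtain ⟨q, hq⟩ := hg
  exact ⟨p * q, by simp [hp, hq]⟩

theorem isPoly_costTotal : IsPoly costTotal := by
  unfold costTotal costIteration costProcess costRoute costTrace costMoves costMove costAugment
    costRound
  repeat' first
    | exact IsPoly.id
    | exact IsPoly.const _
    | apply IsPoly.add
    | apply IsPoly.mul

end Transship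

theorem mainTheorem4 :
    ∃ p : Polynomial ℕ, ∀ (n m : ℕ) (G : Transship.Network n m) (b : Fin n → ℝ) (x : Fin m → ℝ),
      G.Acyclic → Transship.IsTransshipment G b x → (∃ t, b t < 0) →
      ∀ χ : ℕ → Bool, ∃ (y : Fin m → ℝ) (L : List (Transship.RoutedPath n m)),
        Transship.runAdaptedDGG G b x χ (p.eval (n + m)) = some (y, L) ∧
        Transship.IsUnsplittable G b y L ∧
        ∀ a, x a - Transship.maxDemand b < y a := by
  obtain ⟨p, hp⟩ := Transship.isPoly_costTotal
  refine ⟨p, fun n m G b x hG hx hb χ => ?_⟩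
  obtain ⟨⟨y, L⟩, s, k, h1, -, h2, h3⟩ := Transship.Runs.adaptedDGG hG hx hb χ
    (p.eval (n + m)) (hp (n + m)).ge
  refine ⟨y, L, ?_, h2, h3⟩
  exact congrArg (Option.map Prod.fst) h1
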